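/- **Setting.** Let $N\ge 1$, $k\in\mathbb Z$, $\nu\in\mathbb C$, let $\chi$ be a Dirichlet character mod $N$, and put $e(x)=e^{2\pi i x}$. For $\gamma=\begin{pmatrix}a&b\\c&d\end{pmatrix}$ real with $\det\gamma>0$ put $(f|_k\gamma)(z)=\left(\frac{cz+d}{|cz+d|}\right)^{-k}f\left(\frac{az+b}{cz+d}\right)$, and for $\gamma\in\Gamma_0(N)$ put $\widetilde\chi(\gamma)=\chi(d)$. For $\gamma_{\mathfrak a}\in SL(2,\mathbb Z)$ with $\gamma_{\mathfrak a}\infty=\mathfrak a$ let $m_{\mathfrak a}$ be the least positive integer $m$ with $g=\gamma_{\mathfrak a}\begin{pmatrix}1&m\\0&1\end{pmatrix}\gamma_{\mathfrak a}^{-1}\in\Gamma_0(N)$, let $g_{\mathfrak a}$ be this matrix for $m=m_{\mathfrak a}$, let $0\le\mu_{\mathfrak a}<1$ be given by $\widetilde\chi(g_{\mathfrak a})=e(\mu_{\mathfrak a})$, and put $\sigma_{\mathfrak a}=\gamma_{\mathfrak a}\,\mathrm{diag}(\sqrt{m_{\mathfrak a}},1/\sqrt{m_{\mathfrak a}})$.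 A Maass form $f$ of weight $k$, type $\nu$, level $N$ and character $\chi$ is a smooth function on the upper half plane with $f|_k\gamma=\widetilde\chi(\gamma)f$ for $\gamma\in\Gamma_0(N)$, of moderate growth at all cusps, an eigenfunction of $-y^2(\partial_x^2+\partial_y^2)+iky\,\partial_x$ with eigenvalue $\nu(1-\nu)$, and cuspidal: $\int_0^1(f|_k\sigma_{\mathfrak a})(x+iy)\,dx=0$ for every cusp with $\mu_{\mathfrak a}=0$ and all $y>0$. Its Fourier coefficients $A(\mathfrak a,n)$ with respect to $\sigma_{\mathfrak a}$ are given by $$(f|_k\sigma_{\mathfrak a})(x+iy)=\sum_{n+\mu_{\mathfrak a}\ne0}A(\mathfrak a,n)\,W_{\operatorname{sgn}(n+\mu_{\mathfrak a})\frac k2,\ \nu-\frac12}\bigl(4\pi|n+\mu_{\mathfrak a}|y\bigr)\,e\bigl((n+\mu_{\mathfrak a})x\bigr),$$ where $W$ is the Whittaker function; put $A(\mathfrak a,x)=0$ if $x$ is not an integer or if $x+\mu_{\mathfrak a}=0$. The Hecke operator is $T_p^\chi f=\frac1{\sqrt p}\Bigl(\chi(p)\,f\big|_k\begin{pmatrix}p&0\\0&1\end{pmatrix}+\sum_{b=0}^{p-1}f\big|_k\begin{pmatrix}1&b\\0&p\end{pmatrix}\Bigr)$.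 **Cusps.** Write $N=\prod_{q\in S}q^{e_q}$ with $S$ the set of primes dividing $N$. Choose a set of representatives $\gamma_{\mathfrak a}$ of $\Gamma_0(N)\backslash SL(2,\mathbb Z)/\Gamma_\infty$, where $\Gamma_\infty=\{\pm\begin{pmatrix}1&n\\0&1\end{pmatrix}:n\in\mathbb Z\}$, such that for each $q\in S$ the matrix $\gamma_{\mathfrak a}$ is congruent mod $q^{e_q}$ to one of the matrices $\begin{pmatrix}1&0\\0&1\end{pmatrix}$, $\begin{pmatrix}0&-1\\1&0\end{pmatrix}$, $\begin{pmatrix}1&0\\c_1q^l&1\end{pmatrix}$ ($1\le l<e_q$, $\gcd(c_1,q)=1$, $1\le c_1<\min(q^l,q^{e_q-l})$); accordingly write $\mathfrak a_q=\infty$, $0$, $\frac1{c_1q^l}$. For $a$ prime to $N$ and $\gamma_{\mathfrak a}=\begin{pmatrix}*&*\\c&d\end{pmatrix}$, let $a\cdot\mathfrak a$ be the representative cusp $\mathfrak b$ such that the bottom row of $\gamma_{\mathfrak b}$ lies in the $\Gamma_\infty$-orbit of $[ac:d]$ in $\mathbb P^1(\mathbb Z/N\mathbb Z)$, and let $a^{-1}\cdot\mathfrak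 a$ be the cusp $\mathfrak b$ with $a\cdot\mathfrak b=\mathfrak a$. **Theorem.** Let $f$ be a Maass form of weight $k$, type $\nu$, level $N$ and character $\chi$, let $p\nmid N$ be a prime, and assume $T_p^\chi f=\lambda f$. Let $\mathfrak a$ be a representative cusp. Then the representative cusps $\mathfrak a'=p\cdot\mathfrak a$ and $\mathfrak a''=p^{-1}\cdot\mathfrak a$ exist and are unique, and there are integers $\lambda',\lambda'',j',j''$, described below, such that for all $n\in\mathbb Z$ $$\frac{\chi(\lambda'')}{\sqrt p}\,A\Bigl(\mathfrak a'',\tfrac{n+\mu_{\mathfrak a}}p-\mu_{\mathfrak a''}\Bigr)\,e\Bigl(\tfrac{j''(n+\mu_{\mathfrak a})}{p\,m_{\mathfrak a}}\Bigr)-\lambda A(\mathfrak a,n)+\sqrt p\,\chi(\lambda')\,e\Bigl(\tfrac{p\,j'(n+\mu_{\mathfrak a})}{m_{\mathfrak a}}\Bigr)A\bigl(\mathfrak a',\lfloor p(n+\mu_{\mathfrak a})\rfloor\bigr)=0 .$$ *Description of the constants.* For $q\in S$ write $e=e_q$. - If $\mathfrak a_q=\infty$, then $\mathfrak a_q'=\mathfrak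 a_q''=\infty$, $\lambda_q'=1$, $\lambda_q''=p$, $j_q'=j_q''=0$. - If $\mathfrak a_q=0$, then $\mathfrak a_q'=\mathfrak a_q''=0$, $\lambda_q'=p$, $\lambda_q''=1$, $j_q'=j_q''=0$. - If $\mathfrak a_q=\frac1{c_1q^l}$ with $l\ge\frac e2$, then $\mathfrak a_q'=\frac1{c_1'q^l}$, $\mathfrak a_q''=\frac1{c_1''q^l}$ with $0\le c_1',c_1''<q^{e-l}$, $c_1'\equiv c_1p$, $c_1''p\equiv c_1\pmod{q^{e-l}}$, and $\lambda_q'=1$, $\lambda_q''=p$, $j_q'=j_q''=0$. - If $\mathfrak a_q=\frac1{c_1q^l}$ with $l<\frac e2$, then $\mathfrak a_q'=\frac1{c_1'q^l}$, $\mathfrak a_q''=\frac1{c_1''q^l}$ with $0\le c_1',c_1''<q^l$, $0\le j_q',j_q''<q^{e-l}$ and $$c_1'\equiv c_1p,\quad c_1''p\equiv c_1\pmod{q^l},\qquad (1-q^lc_1j_q'p)\,c_1'\equiv c_1p,\quad c_1''(p-j_q''q^lc_1)\equiv c_1\pmod{q^e},$$ and $\lambda_q'\equiv(c_1')^{-1}c_1p$,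 $\lambda_q''\equiv(c_1'')^{-1}c_1\pmod{q^e}$. Put $e_q'=0,\ e_q,\ e_q-l$ according as $\mathfrak a_q=\infty,\ 0,\ \frac1{c_1q^l}$, and $N'=\prod_{q\in S}q^{e_q'}$. Then $\lambda',\lambda'',j',j''$ may be any solutions of the congruences $\lambda'\equiv\lambda'_q$, $\lambda''\equiv\lambda''_q\pmod{q^{e_q}}$, $j'\equiv j_q'$, $j''\equiv j_q''\pmod{q^{e_q'}}$ for all $q\in S$. These are solvable; in particular one may take $0<\lambda',\lambda''\le N$ and $0\le j',j''<N'$. Moreover, for all such $\lambda',\lambda'',j',j''$, if $\mathcal I$ denotes the right ideal of $\mathbb C[GL(2,\mathbb Q)^+]$ generated by all $\gamma-\widetilde\chi(\gamma)$, $\gamma\in\Gamma_0(N)$, then $$\Bigl(\chi(p)\begin{pmatrix}p&0\\0&1\end{pmatrix}+\sum_{b=0}^{p-1}\begin{pmatrix}1&b\\0&p\end{pmatrix}\Bigr)\gamma_{\mathfrak a}\equiv\chi(\lambda'')\,\gamma_{\mathfrak a''}\begin{pmatrix}1&j''\\0&1\end{pmatrix}\begin{pmatrix}p&0\\0&1\end{pmatrix}+\chi(\lambda')\,\gamma_{\mathfrak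 a'}\sum_{\substack{0\le b<N'p\\ b\equiv pj'\,(N')}}\begin{pmatrix}1&b\\0&p\end{pmatrix}\pmod{\mathcal I}.$$ -/

import Mathlib

noncomputable section

open MeasureTheory Set Filter Topology
open scoped MatrixGroups ContDiff

namespace MaassForm

/-! ## Slash operator, congruence character, cusps -/

/-- `e(x) = exp(2πix)`. -/
def expTwoPiI (x : ℝ) : ℂ := Complex.exp (2 * Real.pi * Complex.I * x)

/-- The weight `k` slash operator of a real matrix of positive determinant:
`(f |ₖ M)(z) = ((cz+d)/|cz+d|)^(-k) f((az+b)/(cz+d))`. -/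
def slash (k : ℤ) (M : Matrix (Fin 2) (Fin 2) ℝ) (f : UpperHalfPlane → ℂ)
    (z : UpperHalfPlane) : ℂ :=
  (((M 1 0 : ℂ) * z + M 1 1) / (‖(M 1 0 : ℂ) * z + M 1 1‖ : ℝ)) ^ (-k) *
    f (UpperHalfPlane.ofComplex
      (((M 0 0 : ℂ) * z + M 0 1) / ((M 1 0 : ℂ) * z + M 1 1)))

/-- An element of `SL(2, ℤ)` as a real matrix. -/
def realMatrix (γ : SL(2, ℤ)) : Matrix (Fin 2) (Fin 2) ℝ :=
  (γ : Matrix (Fin 2) (Fin 2) ℤ).map (fun n => (n : ℝ))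

/-- `χ̃(γ) = χ(d)` for `γ = (a b; c d)`. -/
def charTilde {N : ℕ} (χ : DirichletCharacter ℂ N) (γ : SL(2, ℤ)) : ℂ := χ ((γ 1 1 : ℤ) : ZMod N)

/-- The width `m` of the cusp `γ∞`: the least positive `m` with `γ (1 m; 0 1) γ⁻¹ ∈ Γ₀(N)`. -/
def cuspWidth (N : ℕ) (γ : SL(2, ℤ)) : ℕ :=
  sInf {m : ℕ | 0 < m ∧ γ * ModularGroup.T ^ m * γ⁻¹ ∈ CongruenceSubgroup.Gamma0 N}

/-- `σ = γ · diag(√m, 1/√m)`, where `m` is the width of the cusp `γ∞`. -/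
def scalingMatrix (N : ℕ) (γ : SL(2, ℤ)) : Matrix (Fin 2) (Fin 2) ℝ :=
  realMatrix γ * !![√(cuspWidth N γ : ℝ), 0; 0, (√(cuspWidth N γ : ℝ))⁻¹]

/-- The generator `g = σ (1 1; 0 1) σ⁻¹ = γ (1 m; 0 1) γ⁻¹` of the stabilizer of the cusp `γ∞`
in `Γ₀(N)` modulo `±1`. -/
def cuspGenerator (N : ℕ) (γ : SL(2, ℤ)) : SL(2, ℤ) :=
  γ * ModularGroup.T ^ cuspWidth N γ * γ⁻¹

/-- The cusp parameter: the number `0 ≤ μ < 1` with `χ̃(g) = e(μ)`, where `g` is the generator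
above (`χ̃(g)` is a root of unity). -/
def cuspParam {N : ℕ} (χ : DirichletCharacter ℂ N) (γ : SL(2, ℤ)) : ℝ :=
  Int.fract (Complex.arg (charTilde χ (cuspGenerator N γ)) / (2 * Real.pi))

/-! ## Maass forms and Hecke operators -/

/-- The weight `k` Laplace operator `-y² (∂²/∂x² + ∂²/∂y²) + i k y ∂/∂x`. -/
def weightLaplacian (k : ℤ) (f : UpperHalfPlane → ℂ) (z : UpperHalfPlane) : ℂ :=
  let F : ℝ → ℝ → ℂ := fun x y => f (UpperHalfPlane.ofComplex (x + y * Complex.I))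
  Complex.I * k * z.im * deriv (fun x => F x z.im) z.re -
    (z.im : ℂ) ^ 2 * (iteratedDeriv 2 (fun x => F x z.im) z.re +
      iteratedDeriv 2 (fun y => F z.re y) z.im)

/-- Maass (cusp) forms of weight `k`, type `ν`, level `N` and character `χ`. -/
structure IsMaassForm {N : ℕ} (k : ℤ) (ν : ℂ) (χ : DirichletCharacter ℂ N)
    (f : UpperHalfPlane → ℂ) : Prop where
  smooth : ContDiffOn ℝ ∞ (fun w : ℂ => f (UpperHalfPlane.ofComplex w)) {w : ℂ | 0 < w.im}
  automorphic : ∀ γ ∈ CongruenceSubgroup.Gamma0 N, ∀ z,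
    slash k (realMatrix γ) f z = charTilde χ γ * f z
  eigen : ∀ z, weightLaplacian k f z = ν * (1 - ν) * f z
  moderate : ∀ γ : SL(2, ℤ), ∃ B c : ℝ, ∀ z : UpperHalfPlane, 1 ≤ z.im →
    ‖slash k (realMatrix γ) f z‖ ≤ c * z.im ^ B
  /-- The constant term vanishes at every cusp that has one, that is, where `μ = 0`. -/
  cuspidal : ∀ γ : SL(2, ℤ), cuspParam χ γ = 0 → ∀ y : ℝ, 0 < y →
    ∫ x in (0 : ℝ)..1,
      slash k (scalingMatrix N γ) f (UpperHalfPlane.ofComplex (x + y * Complex.I)) = 0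

/-- The Hecke operator
`T_n^χ f = n^(-1/2) ∑_{ad = n} χ(a) ∑_{0 ≤ b < d} f |ₖ (a b; 0 d)`. -/
def hecke {N : ℕ} (k : ℤ) (χ : DirichletCharacter ℂ N) (n : ℕ) (f : UpperHalfPlane → ℂ)
    (z : UpperHalfPlane) : ℂ :=
  1 / (√(n : ℝ) : ℂ) * ∑ x ∈ n.divisorsAntidiagonal, χ (x.1 : ZMod N) *
    ∑ b ∈ Finset.range x.2, slash k !![(x.1 : ℝ), (b : ℝ); 0, (x.2 : ℝ)] f z

/-! ## Whittaker functions -/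

/-- The number of integrations by parts needed to make the exponent `a` have positive real part
(none if `0 < re a` already). -/
def whittakerShift (a : ℂ) : ℕ := if 0 < a.re then 0 else ⌊-a.re⌋₊ + 1

/-- The Whittaker function `W_{α,ν}(y)`, `y > 0`. If `re (ν - α + 1/2) > 0` the shift `m` is `0`
and this is the classical formula
`y^(ν+1/2) e^(-y/2) / Γ(ν-α+1/2) * ∫₀^∞ e^(-yt) t^(ν-α-1/2) (1+t)^(ν+α-1/2) dt`.
That integral diverges for other parameters; there the function is defined, as usual, by analytic
continuation in the parameters, which is given by `m` integrations by parts (the power of `t` is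
integrated, the other factor is differentiated); the value does not depend on `m` as long as
`re (ν - α + 1/2) + m > 0`. -/
def whittakerW (α : ℝ) (ν : ℂ) (y : ℝ) : ℂ :=
  (y : ℂ) ^ (ν + 1 / 2) * Complex.exp (-(y : ℂ) / 2) /
      Complex.Gamma (ν - α + 1 / 2 + whittakerShift (ν - α + 1 / 2)) *
    ∫ t in Ioi (0 : ℝ),
      (-1) ^ whittakerShift (ν - α + 1 / 2) *
        (t : ℂ) ^ (ν - α - 1 / 2 + whittakerShift (ν - α + 1 / 2)) *
        iteratedDeriv (whittakerShift (ν - α + 1 / 2))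
          (fun s : ℝ => Complex.exp (-(y : ℂ) * s) * (1 + (s : ℂ)) ^ (ν + α - 1 / 2)) t

theorem whittakerShift_pos (a : ℂ) : 0 < (a + whittakerShift a).re := by
  unfold whittakerShift
  split_ifs with h
  · simpa using h
  · have := Nat.lt_floor_add_one (-a.re)
    simp
    linarith

theorem iteratedDeriv_exp_aux (y : ℝ) (i : ℕ) :
    iteratedDeriv i (fun s : ℝ => Complex.exp (-(y : ℂ) * s)) =
      fun s : ℝ => (-(y : ℂ)) ^ i * Complex.exp (-(y : ℂ) * s) := by
  induction i with
  | zero => simp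
  | succ i ih =>
    rw [iteratedDeriv_succ, ih]
    funext s
    have h : HasDerivAt (fun s : ℝ => (-(y : ℂ)) ^ i * Complex.exp (-(y : ℂ) * s))
        ((-(y : ℂ)) ^ i * (Complex.exp (-(y : ℂ) * s) * (-(y : ℂ) * 1))) s :=
      (((Complex.ofRealCLM.hasDerivAt (x := s)).const_mul (-(y : ℂ))).cexp).const_mul _
    rw [h.deriv]
    ring

theorem one_add_mem_slitPlane {t : ℝ} (ht : -1 < t) : (1 + (t : ℂ)) ∈ Complex.slitPlane := by
  left
  simp
  linarith

theorem iteratedDeriv_pow_aux (β : ℂ) (j : ℕ) (t : ℝ) (ht : -1 < t) :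
    iteratedDeriv j (fun s : ℝ => (1 + (s : ℂ)) ^ β) t =
      (∏ i ∈ Finset.range j, (β - i)) * (1 + (t : ℂ)) ^ (β - j) := by
  induction j generalizing t with
  | zero => simp
  | succ j ih =>
    rw [iteratedDeriv_succ]
    have he : iteratedDeriv j (fun s : ℝ => (1 + (s : ℂ)) ^ β) =ᶠ[𝓝 t]
        fun t : ℝ => (∏ i ∈ Finset.range j, (β - i)) * (1 + (t : ℂ)) ^ (β - j) := by
      filter_upwards [lt_mem_nhds ht] with s hs using ih s hs
    rw [he.deriv_eq]
    have h := (((((hasDerivAt_id (t : ℂ)).const_add 1).cpow_const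
      (c := β - j) (one_add_mem_slitPlane ht)).const_mul
        (∏ i ∈ Finset.range j, (β - i)))).comp_ofReal
    have h2 := h.deriv
    simp only [id_eq] at h2
    rw [h2, Finset.prod_range_succ]
    push_cast
    rw [sub_sub]
    simp
    ring

theorem iteratedDeriv_aux (β : ℂ) (y : ℝ) (m : ℕ) (t : ℝ) (ht : -1 < t) :
    iteratedDeriv m (fun s : ℝ => Complex.exp (-(y : ℂ) * s) * (1 + (s : ℂ)) ^ β) t =
      Complex.exp (-(y : ℂ) * t) * ∑ j ∈ Finset.range (m + 1), (m.choose j : ℂ) *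
        ((-(y : ℂ)) ^ (m - j) * (∏ i ∈ Finset.range j, (β - i)) * (1 + (t : ℂ)) ^ (β - j)) := by
  have hc : ContDiffAt ℝ m (fun s : ℝ => (1 + (s : ℂ)) ^ β) t := by
    have h1 : ContDiffAt ℝ m (fun z : ℂ => z ^ β) (1 + (t : ℂ)) :=
      ((analyticAt_id.cpow analyticAt_const (one_add_mem_slitPlane ht)).contDiffAt :
        ContDiffAt ℂ m (fun z : ℂ => z ^ β) (1 + (t : ℂ))).restrict_scalars ℝ
    have h2 : ContDiffAt ℝ m (fun s : ℝ => 1 + (s : ℂ)) t :=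
      contDiffAt_const.add Complex.ofRealCLM.contDiff.contDiffAt
    exact h1.comp t h2
  have he : ContDiffAt ℝ m (fun s : ℝ => Complex.exp (-(y : ℂ) * s)) t :=
    (contDiffAt_const.mul Complex.ofRealCLM.contDiff.contDiffAt).cexp
  have hm := iteratedDeriv_mul hc he
  have e0 : (fun s : ℝ => Complex.exp (-(y : ℂ) * s) * (1 + (s : ℂ)) ^ β) =
      (fun s : ℝ => (1 + (s : ℂ)) ^ β) * (fun s : ℝ => Complex.exp (-(y : ℂ) * s)) := by
    funext s
    simp [mul_comm]
  rw [e0, hm, Finset.mul_sum]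
  refine Finset.sum_congr rfl fun j _ => ?_
  rw [iteratedDeriv_pow_aux β j t ht, iteratedDeriv_exp_aux]
  ring

/-- No Whittaker function vanishes identically: it is asymptotic to `y^α e^(-y/2)`. -/
theorem exists_whittakerW_ne_zero (α : ℝ) (ν : ℂ) : ∃ t : ℝ, 0 < t ∧ whittakerW α ν t ≠ 0 := by
  by_contra! H
  set a : ℂ := ν - α + 1 / 2 with ha
  set m := whittakerShift a with hm
  set β : ℂ := ν + α - 1 / 2 with hβ
  have hb : 0 < (a + m).re := whittakerShift_pos a
  have hexp : ν - α - 1 / 2 + m = a + m - 1 := by rw [ha]; ring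
  -- the rescaled integrand
  let G : ℝ → ℝ → ℂ := fun y s => Complex.exp (-(s : ℂ)) * (s : ℂ) ^ (a + m - 1) *
    ∑ j ∈ Finset.range (m + 1), (m.choose j : ℂ) *
      ((-(1 / (y : ℂ))) ^ j * (∏ i ∈ Finset.range j, (β - i)) *
        (1 + ((s / y : ℝ) : ℂ)) ^ (β - j))
  have hzero : ∀ y : ℝ, 0 < y → ∫ s in Ioi (0 : ℝ), G y s = 0 := by
    intro y hy
    have h := H y hy
    unfold whittakerW at h
    rw [← ha, ← hm, ← hβ, hexp] at h
    have hy' : (y : ℂ) ≠ 0 := by exact_mod_cast hy.ne'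
    have hI := (mul_eq_zero.1 h).resolve_left (by
      refine div_ne_zero (mul_ne_zero ?_ (Complex.exp_ne_zero _)) (Complex.Gamma_ne_zero_of_re_pos hb)
      rw [Complex.cpow_def_of_ne_zero hy']
      exact Complex.exp_ne_zero _)
    have hs := integral_comp_mul_left_Ioi (fun t : ℝ => (-1) ^ m * (t : ℂ) ^ (a + m - 1) *
        iteratedDeriv m
          (fun s : ℝ => Complex.exp (-(y : ℂ) * s) * (1 + (s : ℂ)) ^ β) t) 0 (inv_pos.2 hy)
    rw [mul_zero, hI, smul_zero] at hs
    have hcong : ∫ s in Ioi (0 : ℝ), G y s = ∫ s in Ioi (0 : ℝ),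
        ((y : ℂ) ^ (a + m - 1) / (y : ℂ) ^ m) * ((-1) ^ m * ((y⁻¹ * s : ℝ) : ℂ) ^ (a + m - 1) *
        iteratedDeriv m
          (fun s : ℝ => Complex.exp (-(y : ℂ) * s) * (1 + (s : ℂ)) ^ β) (y⁻¹ * s)) := by
      refine setIntegral_congr_fun measurableSet_Ioi fun s (hs : 0 < s) => ?_
      simp only [G]
      rw [iteratedDeriv_aux β y m _ (by have := mul_pos (inv_pos.2 hy) hs; linarith)]
      have e1 : (s : ℂ) ^ (a + m - 1) =
          (y : ℂ) ^ (a + m - 1) * ((y⁻¹ * s : ℝ) : ℂ) ^ (a + m - 1) := by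
        rw [← Complex.mul_cpow_ofReal_nonneg hy.le (by positivity), ← Complex.ofReal_mul,
          mul_inv_cancel_left₀ hy.ne']
      have e2 : -(y : ℂ) * ((y⁻¹ * s : ℝ) : ℂ) = -(s : ℂ) := by
        push_cast
        field_simp
      have e3 : y⁻¹ * s = s / y := by ring
      rw [e1, e2, e3, Finset.mul_sum, Finset.mul_sum, Finset.mul_sum, Finset.mul_sum]
      refine Finset.sum_congr rfl fun j hj => ?_
      have hj' : j ≤ m := Nat.lt_succ_iff.1 (Finset.mem_range.1 hj)
      have e4 : (-(1 / (y : ℂ))) ^ j = (-1) ^ m * (-(y : ℂ)) ^ (m - j) / (y : ℂ) ^ m := by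
        obtain ⟨d, hd⟩ := Nat.exists_eq_add_of_le hj'
        rw [hd, Nat.add_sub_cancel_left, neg_pow, neg_pow (y : ℂ), pow_add, pow_add, one_div, inv_pow]
        have : ((-1 : ℂ) ^ d) * (-1) ^ d = 1 := by rw [← mul_pow]; simp
        field_simp
        linear_combination -this
      rw [e4]
      ring
    rw [hcong, integral_const_mul, hs, mul_zero]
  -- dominated convergence
  let B : ℝ := |β.re|
  let K : ℝ := ∑ j ∈ Finset.range (m + 1), ‖(m.choose j : ℂ)‖ * ‖∏ i ∈ Finset.range j, (β - i)‖
  have hlim : Tendsto (fun y : ℝ => ∫ s in Ioi (0 : ℝ), G y s) atTop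
      (𝓝 (∫ s in Ioi (0 : ℝ), Complex.exp (-(s : ℂ)) * (s : ℂ) ^ (a + m - 1))) := by
    refine tendsto_integral_filter_of_dominated_convergence
      (fun s : ℝ => K * (Real.exp (-s) * s ^ ((a + m).re - 1) * (1 + s) ^ B)) ?_ ?_ ?_ ?_
    · filter_upwards [eventually_gt_atTop 0] with y hy
      refine ContinuousOn.aestronglyMeasurable ?_ measurableSet_Ioi
      refine ContinuousOn.mul (ContinuousOn.mul ?_ ?_) ?_
      · fun_prop
      · exact fun s (hs : 0 < s) => ((Complex.continuousAt_ofReal_cpow_const s _ (Or.inr hs.ne'))).continuousWithinAt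
      · refine continuousOn_finsetSum _ fun j _ => ?_
        refine continuousOn_const.mul (continuousOn_const.mul ?_)
        intro s (hs : 0 < s)
        refine ContinuousAt.continuousWithinAt ?_
        refine ContinuousAt.cpow ?_ continuousAt_const
          (one_add_mem_slitPlane (by have := div_pos hs hy; linarith))
        fun_prop
    · filter_upwards [eventually_ge_atTop 1] with y hy
      refine (ae_restrict_iff' measurableSet_Ioi).2 (ae_of_all _ fun s (hs : 0 < s) => ?_)
      have hy0 : 0 < y := by linarith
      simp only [G]
      rw [norm_mul, norm_mul, Complex.norm_exp, Complex.norm_cpow_eq_rpow_re_of_pos hs]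
      have hsum : ‖∑ j ∈ Finset.range (m + 1), (m.choose j : ℂ) *
          ((-(1 / (y : ℂ))) ^ j * (∏ i ∈ Finset.range j, (β - i)) *
            (1 + ((s / y : ℝ) : ℂ)) ^ (β - j))‖ ≤ K * (1 + s) ^ B := by
        rw [Finset.sum_mul]
        refine (norm_sum_le _ _).trans (Finset.sum_le_sum fun j _ => ?_)
        have hq : (1 + ((s / y : ℝ) : ℂ)) = ((1 + s / y : ℝ) : ℂ) := by push_cast; ring
        have hsy : 0 < s / y := div_pos hs hy0
        rw [norm_mul, norm_mul, norm_mul, norm_pow, hq,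
          Complex.norm_cpow_eq_rpow_re_of_pos (by linarith)]
        have h1 : ‖-(1 / (y : ℂ))‖ ^ j ≤ 1 := by
          refine pow_le_one₀ (norm_nonneg _) ?_
          rw [norm_neg, norm_div, norm_one, Complex.norm_real, Real.norm_of_nonneg hy0.le]
          exact (div_le_one hy0).2 hy
        have h2 : (1 + s / y) ^ (β - j).re ≤ (1 + s) ^ B := by
          calc (1 + s / y) ^ (β - j).re ≤ (1 + s / y) ^ B := by
                refine Real.rpow_le_rpow_of_exponent_le (by linarith) ?_
                have : β.re ≤ |β.re| := le_abs_self _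
                simp only [Complex.sub_re, Complex.natCast_re, B]
                have : (0 : ℝ) ≤ j := Nat.cast_nonneg _
                linarith
            _ ≤ (1 + s) ^ B := by
                refine Real.rpow_le_rpow (by linarith) ?_ (abs_nonneg _)
                have := div_le_self hs.le hy
                linarith
        have h3 : 0 ≤ ‖∏ i ∈ Finset.range j, (β - i)‖ := norm_nonneg _
        have h4 : 0 ≤ (1 + s / y) ^ (β - j).re := Real.rpow_nonneg (by linarith) _
        calc ‖(m.choose j : ℂ)‖ * (‖-(1 / (y : ℂ))‖ ^ j * ‖∏ i ∈ Finset.range j, (β - i)‖ *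
              (1 + s / y) ^ (β - j).re)
            ≤ ‖(m.choose j : ℂ)‖ * (1 * ‖∏ i ∈ Finset.range j, (β - i)‖ * (1 + s) ^ B) := by
              gcongr
          _ = _ := by ring
      have hre : (a + m - 1).re = (a + m).re - 1 := by simp
      have hre2 : (-(s : ℂ)).re = -s := by simp
      rw [hre, hre2]
      calc Real.exp (-s) * s ^ ((a + m).re - 1) * _
          ≤ Real.exp (-s) * s ^ ((a + m).re - 1) * (K * (1 + s) ^ B) := by
            refine mul_le_mul_of_nonneg_left hsum ?_
            have := Real.rpow_nonneg hs.le ((a + m).re - 1)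
            positivity
        _ = _ := by ring
    · refine Integrable.const_mul ?_ K
      -- compare with a Gamma integrand
      obtain ⟨n, hn⟩ := exists_nat_ge B
      have hpow : IntegrableOn (fun s : ℝ => ∑ i ∈ Finset.range (n + 1),
          (n.choose i : ℝ) * (Real.exp (-s) * s ^ ((a + m).re + i - 1))) (Ioi 0) := by
        refine integrable_finsetSum _ fun i _ => Integrable.const_mul ?_ _
        exact Real.GammaIntegral_convergent (by positivity)
      refine Integrable.mono' hpow ?_ ?_
      · refine ContinuousOn.aestronglyMeasurable ?_ measurableSet_Ioi
        refine ContinuousOn.mul (ContinuousOn.mul (by fun_prop) ?_) ?_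
        · exact fun s (hs : 0 < s) => (Real.continuousAt_rpow_const s _ (Or.inl hs.ne')).continuousWithinAt
        · exact ContinuousOn.rpow_const (by fun_prop) fun s (hs : 0 < s) => Or.inl (by positivity)
      · refine (ae_restrict_iff' measurableSet_Ioi).2 (ae_of_all _ fun s (hs : 0 < s) => ?_)
        have h0 := Real.rpow_nonneg hs.le ((a + m).re - 1)
        rw [Real.norm_of_nonneg (by positivity)]
        calc Real.exp (-s) * s ^ ((a + m).re - 1) * (1 + s) ^ B
            ≤ Real.exp (-s) * s ^ ((a + m).re - 1) * (1 + s) ^ (n : ℝ) := by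
              gcongr
              linarith
          _ = _ := by
              rw [Real.rpow_natCast, add_comm 1 s, add_pow, Finset.mul_sum]
              refine Finset.sum_congr rfl fun i _ => ?_
              rw [show (a + m).re + i - 1 = ((a + m).re - 1) + i by ring, Real.rpow_add hs,
                Real.rpow_natCast]
              ring
    · refine (ae_restrict_iff' measurableSet_Ioi).2 (ae_of_all _ fun s (hs : 0 < s) => ?_)
      have hinv : Tendsto (fun y : ℝ => ((1 / y : ℝ) : ℂ)) atTop (𝓝 0) := by
        have : Tendsto (fun y : ℝ => 1 / y) atTop (𝓝 0) := by
          simpa using tendsto_inv_atTop_zero (𝕜 := ℝ)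
        exact_mod_cast (Complex.continuous_ofReal.tendsto 0).comp this
      have hsum : Tendsto (fun y : ℝ => ∑ j ∈ Finset.range (m + 1), (m.choose j : ℂ) *
          ((-(1 / (y : ℂ))) ^ j * (∏ i ∈ Finset.range j, (β - i)) *
            (1 + ((s / y : ℝ) : ℂ)) ^ (β - j))) atTop
          (𝓝 (∑ j ∈ Finset.range (m + 1), (m.choose j : ℂ) *
          ((-0) ^ j * (∏ i ∈ Finset.range j, (β - i)) *
            (1 + (s : ℂ) * 0) ^ (β - j)))) := by
        refine tendsto_finsetSum _ fun j _ => ?_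
        refine tendsto_const_nhds.mul (Tendsto.mul (Tendsto.mul ?_ tendsto_const_nhds) ?_)
        · refine Tendsto.pow (Tendsto.neg ?_) j
          simpa using hinv
        · have h1 : Tendsto (fun y : ℝ => 1 + ((s / y : ℝ) : ℂ)) atTop (𝓝 (1 + (s : ℂ) * 0)) := by
            refine tendsto_const_nhds.add ?_
            have := hinv.const_mul (s : ℂ)
            refine this.congr fun y => ?_
            push_cast
            ring
          exact h1.cpow tendsto_const_nhds (by simp)
      have hval : (∑ j ∈ Finset.range (m + 1), (m.choose j : ℂ) *
          ((-0) ^ j * (∏ i ∈ Finset.range j, (β - i)) *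
            (1 + (s : ℂ) * 0) ^ (β - j))) = 1 := by
        rw [Finset.sum_eq_single 0]
        · simp
        · intro j _ hj
          simp [hj]
        · simp
      rw [hval] at hsum
      have h := hsum.const_mul (Complex.exp (-(s : ℂ)) * (s : ℂ) ^ (a + m - 1))
      rw [mul_one] at h
      exact h
  have h0 : Tendsto (fun y : ℝ => ∫ s in Ioi (0 : ℝ), G y s) atTop (𝓝 0) := by
    refine tendsto_const_nhds.congr' ?_
    filter_upwards [eventually_gt_atTop 0] with y hy using (hzero y hy).symm
  have hG := tendsto_nhds_unique hlim h0
  refine Complex.Gamma_ne_zero_of_re_pos hb ?_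
  rw [Complex.Gamma_eq_integral hb, Complex.GammaIntegral, ← hG]
  simp

/-- A positive point where `W_{α,ν}` does not vanish. -/
def whittakerPoint (α : ℝ) (ν : ℂ) : ℝ := Classical.choose (exists_whittakerW_ne_zero α ν)

theorem whittakerPoint_pos (α : ℝ) (ν : ℂ) : 0 < whittakerPoint α ν :=
  (Classical.choose_spec (exists_whittakerW_ne_zero α ν)).1

theorem whittakerW_point_ne_zero (α : ℝ) (ν : ℂ) : whittakerW α ν (whittakerPoint α ν) ≠ 0 :=
  (Classical.choose_spec (exists_whittakerW_ne_zero α ν)).2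

/-! ## Fourier coefficients -/

/-- The frequency `n + μ` at the cusp `γ∞`. -/
def freq {N : ℕ} (χ : DirichletCharacter ℂ N) (γ : SL(2, ℤ)) (n : ℤ) : ℝ := n + cuspParam χ γ

/-- The first Whittaker index `sgn(κ) k / 2` attached to the frequency `κ ≠ 0`. -/
def whittakerIndex (k : ℤ) (κ : ℝ) : ℝ := Real.sign κ * k / 2

/-- The Fourier integral `∫₀¹ (f |ₖ σ)(x + iy) e(-(n+μ)x) dx`. -/
def fourierIntegral {N : ℕ} (k : ℤ) (χ : DirichletCharacter ℂ N) (f : UpperHalfPlane → ℂ)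
    (γ : SL(2, ℤ)) (n : ℤ) (y : ℝ) : ℂ :=
  ∫ x in (0 : ℝ)..1,
    slash k (scalingMatrix N γ) f (UpperHalfPlane.ofComplex (x + y * Complex.I)) *
      expTwoPiI (-(freq χ γ n * x))

/-- The numbers `A n` are the coefficients of a Fourier-Whittaker expansion of `f` at the cusp
`γ∞`: for all `z = x + iy`,
`(f |ₖ σ)(z) = ∑_{n+μ ≠ 0} A n · W_{sgn(n+μ)k/2, ν-1/2}(4π|n+μ|y) e((n+μ)x)`. -/
def HasFourierWhittakerExpansion {N : ℕ} (k : ℤ) (ν : ℂ) (χ : DirichletCharacter ℂ N)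
    (f : UpperHalfPlane → ℂ) (γ : SL(2, ℤ)) (A : ℤ → ℂ) : Prop :=
  ∀ z : UpperHalfPlane,
    HasSum (fun n : {n : ℤ // freq χ γ n ≠ 0} =>
      A n * whittakerW (whittakerIndex k (freq χ γ n)) (ν - 1 / 2)
        (4 * Real.pi * |freq χ γ n| * z.im) * expTwoPiI (freq χ γ n * z.re))
      (slash k (scalingMatrix N γ) f z)

/-- The `n`-th Fourier coefficient `A(𝔞, n)` at the cusp `𝔞 = γ∞`, with respect to `σ`: the factor
of proportionality between the Fourier integral, as a function of `y`, and
`W_{sgn(n+μ)k/2, ν-1/2}(4π|n+μ|y)`. It is read off at a height where the Whittaker function does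
not vanish. By the theorem that follows, these are the coefficients of the Fourier-Whittaker
expansion. There is no coefficient for `n + μ = 0`, and we put `0` there. -/
def fourierCoeff {N : ℕ} (k : ℤ) (ν : ℂ) (χ : DirichletCharacter ℂ N)
    (f : UpperHalfPlane → ℂ) (γ : SL(2, ℤ)) (n : ℤ) : ℂ :=
  open Classical in
  if freq χ γ n = 0 then 0 else
    fourierIntegral k χ f γ n
        (whittakerPoint (whittakerIndex k (freq χ γ n)) (ν - 1 / 2) /
          (4 * Real.pi * |freq χ γ n|)) /
      whittakerW (whittakerIndex k (freq χ γ n)) (ν - 1 / 2)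
        (whittakerPoint (whittakerIndex k (freq χ γ n)) (ν - 1 / 2))

theorem expTwoPiI_add (x y : ℝ) : expTwoPiI (x + y) = expTwoPiI x * expTwoPiI y := by
  unfold expTwoPiI
  rw [← Complex.exp_add]
  push_cast
  ring_nf

theorem norm_expTwoPiI (x : ℝ) : ‖expTwoPiI x‖ = 1 := by
  unfold expTwoPiI
  rw [show 2 * (Real.pi : ℂ) * Complex.I * x = ((2 * Real.pi * x : ℝ) : ℂ) * Complex.I by
    push_cast; ring]
  exact Complex.norm_exp_ofReal_mul_I _

theorem continuous_expTwoPiI_mul (c : ℝ) : Continuous fun x : ℝ => expTwoPiI (c * x) := by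
  unfold expTwoPiI
  fun_prop

theorem integral_expTwoPiI (n : ℤ) (hn : n ≠ 0) :
    ∫ x in (0 : ℝ)..1, expTwoPiI (n * x) = 0 := by
  have hc : 2 * (Real.pi : ℂ) * Complex.I * n ≠ 0 := by
    simp [Real.pi_ne_zero, hn]
  have h := integral_exp_mul_complex (a := 0) (b := 1) hc
  have e1 : Complex.exp (2 * (Real.pi : ℂ) * Complex.I * n) = 1 := by
    rw [mul_comm]
    exact Complex.exp_int_mul_two_pi_mul_I n
  simp only [Complex.ofReal_one, mul_one, Complex.ofReal_zero, mul_zero, Complex.exp_zero, e1,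
    sub_self, zero_div] at h
  rw [← h]
  refine intervalIntegral.integral_congr fun x _ => ?_
  simp only [expTwoPiI]
  push_cast
  ring_nf

/-- If `f` has a Fourier-Whittaker expansion at the cusp `γ∞`, then `fourierCoeff` gives its
coefficients. -/
theorem fourierCoeff_eq_of_expansion {N : ℕ} {k : ℤ} {ν : ℂ} {χ : DirichletCharacter ℂ N}
    {f : UpperHalfPlane → ℂ} {γ : SL(2, ℤ)} {A : ℤ → ℂ}
    (hA : HasFourierWhittakerExpansion k ν χ f γ A) (n : ℤ) (hn : freq χ γ n ≠ 0) :
    fourierCoeff k ν χ f γ n = A n := by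
  unfold fourierCoeff
  rw [if_neg hn]
  set t := whittakerPoint (whittakerIndex k (freq χ γ n)) (ν - 1 / 2) with ht
  have htpos : 0 < t := whittakerPoint_pos _ _
  have hW : whittakerW (whittakerIndex k (freq χ γ n)) (ν - 1 / 2) t ≠ 0 :=
    whittakerW_point_ne_zero _ _
  have hκ : 0 < |freq χ γ n| := abs_pos.2 hn
  have hden : 0 < 4 * Real.pi * |freq χ γ n| := by positivity
  set y := t / (4 * Real.pi * |freq χ γ n|) with hy
  have hypos : 0 < y := div_pos htpos hden
  have hty : 4 * Real.pi * |freq χ γ n| * y = t := by rw [hy]; field_simp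
  rw [div_eq_iff hW]
  -- the terms of the series, without the exponential
  let a : {n : ℤ // freq χ γ n ≠ 0} → ℂ := fun m =>
    A m * whittakerW (whittakerIndex k (freq χ γ m)) (ν - 1 / 2)
        (4 * Real.pi * |freq χ γ m| * y)
  have him : ∀ x : ℝ, 0 < ((x : ℂ) + y * Complex.I).im := fun x => by simpa using hypos
  have hsum : ∀ x : ℝ, HasSum (fun m => a m * expTwoPiI (freq χ γ m * x))
      (slash k (scalingMatrix N γ) f (UpperHalfPlane.ofComplex (x + y * Complex.I))) := by
    intro x
    have h := hA (UpperHalfPlane.ofComplex (x + y * Complex.I))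
    rw [UpperHalfPlane.ofComplex_apply_of_im_pos (him x)] at h ⊢
    simpa [UpperHalfPlane.im, UpperHalfPlane.re, a] using h
  have hnorm : Summable fun m => ‖a m‖ := by
    have h := (hsum 0).summable.norm
    simpa [norm_mul, norm_expTwoPiI] using h
  let F : {n : ℤ // freq χ γ n ≠ 0} → C(ℝ, ℂ) := fun m =>
    ⟨fun x => a m * expTwoPiI (((m : ℤ) - n : ℤ) * x),
      continuous_const.mul (continuous_expTwoPiI_mul _)⟩
  have hF : ∀ x : ℝ, HasSum (fun m => F m x)
      (slash k (scalingMatrix N γ) f (UpperHalfPlane.ofComplex (x + y * Complex.I)) *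
        expTwoPiI (-(freq χ γ n * x))) := by
    intro x
    have h := (hsum x).mul_right (expTwoPiI (-(freq χ γ n * x)))
    refine h.congr_fun ?_
    intro m
    simp only [F, ContinuousMap.coe_mk]
    rw [mul_assoc (a m), ← expTwoPiI_add]
    congr 2
    simp only [freq]
    push_cast
    ring
  have hFs : Summable fun m => ‖(F m).restrict (⟨uIcc (0 : ℝ) 1, isCompact_uIcc⟩ :
      TopologicalSpace.Compacts ℝ)‖ := by
    refine Summable.of_nonneg_of_le (fun _ => norm_nonneg _) (fun m => ?_) hnorm
    refine (ContinuousMap.norm_le _ (norm_nonneg _)).2 fun x => ?_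
    simp [F, norm_expTwoPiI]
  have hint := intervalIntegral.hasSum_intervalIntegral_of_summable_norm hFs
  have hval : ∀ m : {n : ℤ // freq χ γ n ≠ 0}, m ≠ ⟨n, hn⟩ →
      ∫ x in (0 : ℝ)..1, F m x = 0 := by
    intro m hm
    have hmn : (m : ℤ) - n ≠ 0 := fun h => hm (Subtype.ext (by simpa using sub_eq_zero.1 h))
    simp only [F, ContinuousMap.coe_mk]
    rw [intervalIntegral.integral_const_mul, integral_expTwoPiI _ hmn, mul_zero]
  have h1 := hint.unique (hasSum_single ⟨n, hn⟩ hval)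
  have h2 : ∫ x in (0 : ℝ)..1, F ⟨n, hn⟩ x = a ⟨n, hn⟩ := by
    simp [F, expTwoPiI]
  rw [h2] at h1
  have h3 : fourierIntegral k χ f γ n y = ∫ x in (0 : ℝ)..1, ∑' m, F m x := by
    refine intervalIntegral.integral_congr fun x _ => ?_
    exact (hF x).tsum_eq.symm
  rw [h3, h1]
  simp only [a, hty]

/-- `A(𝔞, x)` for real `x`, with the convention that it is zero when `x` is not an integer. -/
def fourierCoeffReal {N : ℕ} (k : ℤ) (ν : ℂ) (χ : DirichletCharacter ℂ N)
    (f : UpperHalfPlane → ℂ) (γ : SL(2, ℤ)) (x : ℝ) : ℂ :=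
  open Classical in if ((⌊x⌋ : ℤ) : ℝ) = x then fourierCoeff k ν χ f γ ⌊x⌋ else 0

/-! ## Cusp representatives -/

/-- The standard cusps `∞`, `0`, `1/(c q^l)` of `Γ₀(q^e)`. -/
inductive LocalCusp where
  | infty : LocalCusp
  | zero : LocalCusp
  | frac (c l : ℕ) : LocalCusp

/-- The conditions on `c` and `l` in the list of standard cusps of `Γ₀(q^e)`. -/
def LocalCusp.IsStandard (q e : ℕ) : LocalCusp → Prop
  | .infty => True
  | .zero => True
  | .frac c l => 1 ≤ l ∧ l < e ∧ c.Coprime q ∧ 1 ≤ c ∧ c < min (q ^ l) (q ^ (e - l))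

/-- The standard matrices `(1 0; 0 1)`, `(0 -1; 1 0)`, `(1 0; c q^l 1)`. -/
def LocalCusp.matrix (q : ℕ) : LocalCusp → Matrix (Fin 2) (Fin 2) ℤ
  | .infty => !![1, 0; 0, 1]
  | .zero => !![0, -1; 1, 0]
  | .frac c l => !![1, 0; (c : ℤ) * (q : ℤ) ^ l, 1]

/-- The exponent `e'`: `0` for `∞`, `e` for `0`, and `e - l` for `1/(c q^l)`. -/
def LocalCusp.exponent (e : ℕ) : LocalCusp → ℕ
  | .infty => 0
  | .zero => e
  | .frac _ l => e - l

/-- `s` is the standard cusp `𝔞_q` of `Γ₀(q^e)`, `e = v_q(N)`, whose matrix is congruent to `γ`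
modulo `q^e`. -/
def IsLocalCusp (N q : ℕ) (γ : SL(2, ℤ)) (s : LocalCusp) : Prop :=
  s.IsStandard q (N.factorization q) ∧
    ∀ i j, γ i j ≡ s.matrix q i j [ZMOD (q : ℤ) ^ N.factorization q]

/-- `C` is a set of representatives `γ_𝔞` of `Γ₀(N) \ SL(2, ℤ) / Γ_∞`, each congruent, modulo
every prime power `q^e` exactly dividing `N`, to one of the standard matrices. (As `-1 ∈ Γ₀(N)`,
only the translations in `Γ_∞` have to be mentioned.) -/
def IsCuspRepresentatives (N : ℕ) (C : Set SL(2, ℤ)) : Prop :=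
  (∀ g : SL(2, ℤ), ∃! γ : SL(2, ℤ), γ ∈ C ∧ ∃ γ₀ ∈ CongruenceSubgroup.Gamma0 N, ∃ j : ℤ,
    g = γ₀ * γ * ModularGroup.T ^ j) ∧
  ∀ γ ∈ C, ∀ q ∈ N.primeFactors, ∃ s, IsLocalCusp N q γ s

/-- `γ'` represents the cusp `a · 𝔞`, where `γ = (* *; c d)` represents `𝔞`: the bottom row of
`γ'` lies in the `Γ_∞`-orbit of `[a c : d]` in the projective line over `ℤ/N`. -/
def IsCuspMul (N : ℕ) (a : ℤ) (γ γ' : SL(2, ℤ)) : Prop :=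
  ∃ (u : (ZMod N)ˣ) (j : ℤ),
    ((a * γ 1 0 : ℤ) : ZMod N) = u * (γ' 1 0 : ℤ) ∧
    ((γ 1 1 : ℤ) : ZMod N) = u * (j * γ' 1 0 + γ' 1 1 : ℤ)

/-! ## The constants `λ'`, `j'`, `λ''`, `j''` -/

/-- The relation between the standard cusp `𝔞_q` of `Γ₀(q^e)`, the cusp `𝔞'_q` and the integers
`λ'_q` (modulo `q^e`) and `j'_q`. -/
def LocalDataOne (p q e : ℕ) : LocalCusp → LocalCusp → ℤ → ℤ → Prop
  | .infty, s', lam, j => s' = .infty ∧ lam ≡ 1 [ZMOD (q : ℤ) ^ e] ∧ j = 0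
  | .zero, s', lam, j => s' = .zero ∧ lam ≡ p [ZMOD (q : ℤ) ^ e] ∧ j = 0
  | .frac c l, s', lam, j => ∃ c' : ℕ, s' = .frac c' l ∧
      (e ≤ 2 * l → c' < q ^ (e - l) ∧ (c' : ℤ) ≡ c * p [ZMOD (q : ℤ) ^ (e - l)] ∧
        lam ≡ 1 [ZMOD (q : ℤ) ^ e] ∧ j = 0) ∧
      (2 * l < e → c' < q ^ l ∧ (c' : ℤ) ≡ c * p [ZMOD (q : ℤ) ^ l] ∧
        0 ≤ j ∧ j < (q : ℤ) ^ (e - l) ∧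
        (1 - (q : ℤ) ^ l * c * j * p) * c' ≡ c * p [ZMOD (q : ℤ) ^ e] ∧
        lam * c' ≡ c * p [ZMOD (q : ℤ) ^ e])

/-- The relation between the standard cusp `𝔞_q` of `Γ₀(q^e)`, the cusp `𝔞''_q` and the integers
`λ''_q` (modulo `q^e`) and `j''_q`. -/
def LocalDataTwo (p q e : ℕ) : LocalCusp → LocalCusp → ℤ → ℤ → Prop
  | .infty, s'', lam, j => s'' = .infty ∧ lam ≡ p [ZMOD (q : ℤ) ^ e] ∧ j = 0
  | .zero, s'', lam, j => s'' = .zero ∧ lam ≡ 1 [ZMOD (q : ℤ) ^ e] ∧ j = 0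
  | .frac c l, s'', lam, j => ∃ c'' : ℕ, s'' = .frac c'' l ∧
      (e ≤ 2 * l → c'' < q ^ (e - l) ∧ (c'' * p : ℤ) ≡ c [ZMOD (q : ℤ) ^ (e - l)] ∧
        lam ≡ p [ZMOD (q : ℤ) ^ e] ∧ j = 0) ∧
      (2 * l < e → c'' < q ^ l ∧ (c'' * p : ℤ) ≡ c [ZMOD (q : ℤ) ^ l] ∧
        0 ≤ j ∧ j < (q : ℤ) ^ (e - l) ∧
        c'' * (p - j * (q : ℤ) ^ l * c) ≡ c [ZMOD (q : ℤ) ^ e] ∧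
        lam * c'' ≡ c [ZMOD (q : ℤ) ^ e])

/-- `N' = ∏_q q^(e'_q)`, for the standard cusps `s q` attached to a cusp of `Γ₀(N)`. -/
def auxLevel (N : ℕ) (s : ℕ → LocalCusp) : ℕ :=
  ∏ q ∈ N.primeFactors, q ^ (s q).exponent (N.factorization q)

/-- `lam` and `j` solve the systems of congruences `lam ≡ lam_q` modulo `q^(e_q)` and `j ≡ j_q`
modulo `q^(e'_q)`, where `lam_q` and `j_q` are attached by `D` to the prime powers dividing `N`. -/
def GlobalData (D : ℕ → ℕ → LocalCusp → LocalCusp → ℤ → ℤ → Prop) (N : ℕ)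
    (s s' : ℕ → LocalCusp) (lam j : ℤ) : Prop :=
  ∀ q ∈ N.primeFactors, ∃ lamq jq : ℤ,
    D q (N.factorization q) (s q) (s' q) lamq jq ∧
    lam ≡ lamq [ZMOD (q : ℤ) ^ N.factorization q] ∧
    j ≡ jq [ZMOD (q : ℤ) ^ (s q).exponent (N.factorization q)]

/-! ## The group ring of `GL(2, ℚ)⁺` -/

/-- The group ring `ℂ[GL(2, ℚ)⁺]`. -/
abbrev RatGroupRing : Type := MonoidAlgebra ℂ GL(2, ℚ)⁺

/-- The matrix `(a b; 0 d)`, `a, d > 0`. -/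
def ratTriangular (a d : ℕ+) (b : ℤ) : GL(2, ℚ)⁺ :=
  ⟨Matrix.GeneralLinearGroup.mkOfDetNeZero !![((a : ℕ) : ℚ), (b : ℚ); 0, ((d : ℕ) : ℚ)] (by
      rw [Matrix.det_fin_two_of]
      simp), by
    rw [Matrix.mem_glpos]
    change 0 < Matrix.det !![((a : ℕ) : ℚ), (b : ℚ); 0, ((d : ℕ) : ℚ)]
    rw [Matrix.det_fin_two_of]
    simp⟩

/-- An element of `SL(2, ℤ)` in `GL(2, ℚ)⁺`. -/
def ratSL (γ : SL(2, ℤ)) : GL(2, ℚ)⁺ :=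
  Matrix.SpecialLinearGroup.toGLPos (Matrix.SpecialLinearGroup.map (Int.castRingHom ℚ) γ)

/-- An element of `GL(2, ℚ)⁺` in the group ring. -/
def ringOf (g : GL(2, ℚ)⁺) : RatGroupRing := MonoidAlgebra.single g 1

/-- The element `χ(p) (p 0; 0 1) + ∑_{0 ≤ b < p} (1 b; 0 p)` of the group ring. -/
def heckeElement {N : ℕ} (χ : DirichletCharacter ℂ N) (p : ℕ+) : RatGroupRing :=
  χ ((p : ℕ) : ZMod N) • ringOf (ratTriangular p 1 0) +
    ∑ b ∈ Finset.range p, ringOf (ratTriangular 1 p b)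

/-- The right ideal generated by all `γ - χ̃(γ)`, `γ ∈ Γ₀(N)`. -/
def automorphyIdeal {N : ℕ} (χ : DirichletCharacter ℂ N) :
    Submodule RatGroupRingᵐᵒᵖ RatGroupRing :=
  Submodule.span RatGroupRingᵐᵒᵖ
    {x | ∃ γ ∈ CongruenceSubgroup.Gamma0 N, x = ringOf (ratSL γ) - charTilde χ γ • 1}

end MaassForm
end

/-!
The Hecke element `χ(p) (p 0; 0 1) + ∑ (1 b; 0 p)` is the sum of `χ(a_M) M` over the classes `M`
of `Γ₀(N) \ Δ`, where `Δ` consists of the integral matrices `M = (a_M *; c_M *)` of determinant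
`p` with `N ∣ c_M`. Modulo the right ideal generated by the `γ - χ̃(γ)`, the term `χ(a_M) M`
depends only on the class of `M` (`exists_heckeRep_congruence`), so that the sum may be formed
with any `p + 1` inequivalent matrices in `Δ` (`heckeElement_congruence`). Such matrices are
`γ_𝔞'' (1 j''; 0 1) (p 0; 0 1) γ_𝔞⁻¹` and `γ_𝔞' (1 b; 0 p) γ_𝔞⁻¹`, `b ≡ p j'` modulo `N'`: their
first columns are `(λ'', 0)` and `(λ', 0)` modulo `N`, which is what the congruences defining the
constants say, one prime power at a time (`conjColumn_globalDataOne`, `conjColumn_globalDataTwo`).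
This is the congruence in the group ring.

The cusps `𝔞' = p · 𝔞` and `𝔞'' = p⁻¹ · 𝔞` exist because a primitive vector stays primitive modulo
`N` after multiplication of one entry by `p`, and are unique because the bottom row determines the
double coset. Comparing standard cusps locally (`localMul_of_bottom_rows`) shows that the
constants exist modulo prime powers, and the Chinese remainder theorem glues them
(`exists_globalData`).

Applied to the eigenfunction `f`, the congruence becomes a relation between the functions `f |ₖ
γ_𝔞`, `f |ₖ γ_𝔞'` and `f |ₖ γ_𝔞''` (`hecke_functional_relation`). The three cusps have the same
width `m`, and `μ' ≡ p μ`, `μ ≡ p μ''` modulo `1`. Integrating against `e(-(n + μ)x)` at height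
`y` produces the Fourier integral at `𝔞''` at height `p y`, or zero if `(n + μ)/p - μ''` is not an
integer (`integral_comp_mul_add_of_frequency`, `integral_comp_mul_add_eq_zero`), and at `𝔞'` at
height `y/p`, the translations `b` covering a full period since `N'/m` is prime to `p`
(`sum_integral_comp_add_div`). The products of frequency and height agree at the three cusps, so
that the same value of the Whittaker function is divided out everywhere.
-/

noncomputable section

open MeasureTheory Set Filter Topology
open scoped MatrixGroups ContDiff

namespace MaassForm

/-! ### Congruences modulo prime powers -/

theorem natCast_dvd_of_prime_powers {N : ℕ} (hN : 0 < N) {x : ℤ}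
    (h : ∀ q ∈ N.primeFactors, (q : ℤ) ^ N.factorization q ∣ x) : (N : ℤ) ∣ x := by
  have e : (N : ℤ) = ∏ q ∈ N.primeFactors, (q : ℤ) ^ N.factorization q := by
    conv_lhs => rw [← Nat.prod_factorization_pow_eq_self hN.ne']
    simp [Finsupp.prod]
  rw [e]
  refine Finset.prod_dvd_of_coprime (fun a ha b hb hab => ?_) h
  exact (Nat.isCoprime_iff_coprime.2 ((Nat.coprime_primes (Nat.prime_of_mem_primeFactors ha)
    (Nat.prime_of_mem_primeFactors hb)).2 hab)).pow

theorem prime_power_dvd (N q : ℕ) : (q : ℤ) ^ N.factorization q ∣ (N : ℤ) := by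
  exact_mod_cast Nat.ordProj_dvd N q

theorem factorization_pos_of_mem {N q : ℕ} (hq : q ∈ N.primeFactors) :
    1 ≤ N.factorization q :=
  (Nat.prime_of_mem_primeFactors hq).factorization_pos_of_dvd (Nat.mem_primeFactors.1 hq).2.2
    (Nat.dvd_of_mem_primeFactors hq)

/-- The Chinese remainder theorem for integers and powers of the primes dividing `N`. -/
theorem exists_int_modEq_prime_powers (N : ℕ) (ε : ℕ → ℕ) (a : ℕ → ℤ) :
    ∃ x : ℤ, 0 ≤ x ∧ x < (∏ q ∈ N.primeFactors, q ^ ε q : ℕ) ∧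
      ∀ q ∈ N.primeFactors, x ≡ a q [ZMOD (q : ℤ) ^ ε q] := by
  have hpos : ∀ q ∈ N.primeFactors, 0 < (q : ℤ) ^ ε q := fun q hq =>
    pow_pos (by exact_mod_cast (Nat.prime_of_mem_primeFactors hq).pos) _
  have hs : ∀ q ∈ N.primeFactors, q ^ ε q ≠ 0 := fun q hq =>
    pow_ne_zero _ (Nat.prime_of_mem_primeFactors hq).ne_zero
  have hco : Set.Pairwise (N.primeFactors : Set ℕ)
      (Function.onFun Nat.Coprime fun q => q ^ ε q) := fun b hb c hc hbc =>
    Nat.Coprime.pow _ _ ((Nat.coprime_primes (Nat.prime_of_mem_primeFactors hb)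
      (Nat.prime_of_mem_primeFactors hc)).2 hbc)
  let x := Nat.chineseRemainderOfFinset (fun q => (a q % (q : ℤ) ^ ε q).toNat)
    (fun q => q ^ ε q) N.primeFactors hs hco
  refine ⟨(x : ℕ), Int.natCast_nonneg _, ?_, fun q hq => ?_⟩
  · exact_mod_cast Nat.chineseRemainderOfFinset_lt_prod (fun q => (a q % (q : ℤ) ^ ε q).toNat)
      (fun q => q ^ ε q) hs hco
  · have h := Int.natCast_modEq_iff.2 (x.2 q hq)
    rw [Int.toNat_of_nonneg (Int.emod_nonneg _ (hpos q hq).ne')] at h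
    push_cast at h
    exact h.trans (Int.mod_modEq _ _)

theorem exists_mul_modEq_one {a m : ℤ} (h : IsCoprime a m) : ∃ b, a * b ≡ 1 [ZMOD m] := by
  obtain ⟨x, y, hxy⟩ := h
  refine ⟨x, (Int.modEq_iff_dvd.2 ⟨y, ?_⟩)⟩
  linear_combination -hxy

/-! ### Multiplication of cusps -/

theorem det_eq_one (γ : SL(2, ℤ)) : γ 0 0 * γ 1 1 - γ 0 1 * γ 1 0 = 1 := by
  rw [← Matrix.det_fin_two]
  exact γ.2

/-- The relation `IsCuspMul` in terms of integers. -/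
theorem isCuspMul_iff {N : ℕ} {a : ℤ} {γ γ' : SL(2, ℤ)} :
    IsCuspMul N a γ γ' ↔ ∃ u v j : ℤ, u * v ≡ 1 [ZMOD N] ∧ a * γ 1 0 ≡ u * γ' 1 0 [ZMOD N] ∧
      γ 1 1 ≡ u * (j * γ' 1 0 + γ' 1 1) [ZMOD N] := by
  simp only [← ZMod.intCast_eq_intCast_iff]
  constructor
  · rintro ⟨u, j, h1, h2⟩
    obtain ⟨x, hx⟩ := ZMod.intCast_surjective (u : ZMod N)
    obtain ⟨y, hy⟩ := ZMod.intCast_surjective ((u⁻¹ : (ZMod N)ˣ) : ZMod N)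
    refine ⟨x, y, j, ?_, ?_, ?_⟩
    · push_cast
      rw [hx, hy, Units.mul_inv]
    · rw [h1]
      push_cast
      rw [hx]
    · rw [h2]
      push_cast
      rw [hx]
  · rintro ⟨u, v, j, h, h1, h2⟩
    push_cast at h
    refine ⟨⟨u, v, h, by rw [mul_comm, h]⟩, j, ?_, ?_⟩
    · rw [h1]
      push_cast
      rfl
    · rw [h2]
      push_cast
      rfl

/-- Two matrices whose bottom rows agree up to a unit and a translation lie in the same double
coset. -/
theorem exists_eq_mul_of_bottom_rows {N : ℕ} {γ γ' : SL(2, ℤ)} {w k : ℤ}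
    (h1 : γ' 1 0 ≡ w * γ 1 0 [ZMOD N]) (h2 : γ' 1 1 ≡ w * (k * γ 1 0 + γ 1 1) [ZMOD N]) :
    ∃ γ₀ ∈ CongruenceSubgroup.Gamma0 N, ∃ j : ℤ, γ' = γ₀ * γ * ModularGroup.T ^ j := by
  refine ⟨γ' * ModularGroup.T ^ (-k) * γ⁻¹, ?_, k, by group⟩
  rw [CongruenceSubgroup.Gamma0_mem]
  rw [← ZMod.intCast_eq_intCast_iff] at h1 h2
  push_cast at h1 h2
  rw [Matrix.SpecialLinearGroup.coe_mul, Matrix.SpecialLinearGroup.coe_mul,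
    ModularGroup.coe_T_zpow, Matrix.SpecialLinearGroup.coe_inv, Matrix.adjugate_fin_two]
  simp only [Matrix.mul_apply, Fin.sum_univ_two, Matrix.of_apply, Matrix.cons_val_zero,
    Matrix.cons_val_one]
  push_cast
  rw [h1, h2]
  ring

/-- The bottom row of `γ₀ γ (1 j; 0 1)`, `γ₀ ∈ Γ₀(N)`, modulo `N`. -/
theorem bottom_row_modEq {N : ℕ} {g γ₀ γ : SL(2, ℤ)} {j : ℤ}
    (h₀ : γ₀ ∈ CongruenceSubgroup.Gamma0 N) (h : g = γ₀ * γ * ModularGroup.T ^ j) :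
    γ₀ 1 1 * γ₀ 0 0 ≡ 1 [ZMOD N] ∧ g 1 0 ≡ γ₀ 1 1 * γ 1 0 [ZMOD N] ∧
      g 1 1 ≡ γ₀ 1 1 * (j * γ 1 0 + γ 1 1) [ZMOD N] := by
  rw [CongruenceSubgroup.Gamma0_mem] at h₀
  simp only [← ZMod.intCast_eq_intCast_iff]
  have hd := congrArg (Int.cast : ℤ → ZMod N) (det_eq_one γ₀)
  push_cast at hd
  subst h
  refine ⟨?_, ?_, ?_⟩
  · push_cast
    linear_combination hd + γ₀ 0 1 * h₀
  · simp [ModularGroup.coe_T_zpow, Matrix.mul_apply, Fin.sum_univ_two, h₀]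
  · simp [ModularGroup.coe_T_zpow, Matrix.mul_apply, Fin.sum_univ_two, h₀]
    ring

theorem eq_of_mem_representatives {N : ℕ} {C : Set SL(2, ℤ)} (hC : IsCuspRepresentatives N C)
    {γ γ' : SL(2, ℤ)} (hγ : γ ∈ C) (hγ' : γ' ∈ C) {w k : ℤ}
    (h1 : γ' 1 0 ≡ w * γ 1 0 [ZMOD N]) (h2 : γ' 1 1 ≡ w * (k * γ 1 0 + γ 1 1) [ZMOD N]) :
    γ' = γ := by
  obtain ⟨x, -, hx⟩ := hC.1 γ'
  rw [hx γ ⟨hγ, exists_eq_mul_of_bottom_rows h1 h2⟩]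
  exact hx γ' ⟨hγ', 1, one_mem _, 0, by simp⟩

theorem exists_bottom_row {x y : ℤ} (h : IsCoprime x y) :
    ∃ g : SL(2, ℤ), g 1 0 = x ∧ g 1 1 = y := by
  obtain ⟨g, hg⟩ := h.exists_SL2_row 1
  exact ⟨g, hg.1, hg.2⟩

theorem isCoprime_bottom_row (γ : SL(2, ℤ)) : IsCoprime (γ 1 0) (γ 1 1) :=
  ⟨-γ 0 1, γ 0 0, by linear_combination det_eq_one γ⟩

/-- If `(x, y)` is a primitive vector and `p` does not divide `N`, the class of `(p x, y)` modulo
`N` contains a primitive vector. -/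
theorem exists_isCoprime_mul {N p : ℕ} (hp : p.Prime) (hpN : ¬ p ∣ N) {x y : ℤ}
    (h : IsCoprime x y) : ∃ t : ℤ, IsCoprime (p * x) (y + t * N) := by
  have hp' : Prime (p : ℤ) := Nat.prime_iff_prime_int.1 hp
  by_cases hy : (p : ℤ) ∣ y
  · have hx : ¬ (p : ℤ) ∣ x := fun hx => hp'.not_isUnit (h.isUnit_of_dvd' hx hy)
    refine ⟨x, IsCoprime.mul_left ((Prime.coprime_iff_not_dvd hp').2 fun h1 => ?_) ?_⟩
    · have h2 := (Int.dvd_add_right hy).1 h1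
      rcases hp'.dvd_or_dvd h2 with h3 | h3
      · exact hx h3
      · exact hpN (Int.natCast_dvd_natCast.1 h3)
    · exact h.add_mul_left_right N
  · exact ⟨0, by simpa using IsCoprime.mul_left ((Prime.coprime_iff_not_dvd hp').2 hy) h⟩

theorem isCuspMul_unique_right {N : ℕ} {C : Set SL(2, ℤ)} (hC : IsCuspRepresentatives N C)
    {a : ℤ} {γ g g' : SL(2, ℤ)} (hg : g ∈ C) (hg' : g' ∈ C)
    (h : IsCuspMul N a γ g) (h' : IsCuspMul N a γ g') : g' = g := by
  obtain ⟨u, v, j, h0, h1, h2⟩ := isCuspMul_iff.1 h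
  obtain ⟨u', v', j', h0', h1', h2'⟩ := isCuspMul_iff.1 h'
  simp only [← ZMod.intCast_eq_intCast_iff] at *
  push_cast at *
  refine eq_of_mem_representatives hC hg hg' (w := v' * u) (k := j - j') ?_ ?_ <;>
    simp only [← ZMod.intCast_eq_intCast_iff] <;> push_cast
  · linear_combination -g' 1 0 * h0' + v' * h1 - v' * h1'
  · linear_combination -g' 1 1 * h0' + v' * h2 - v' * h2' - j' * v' * (h1 - h1')

/-- Multiplication by a unit is injective on the representatives of the cusps. -/
theorem isCuspMul_unique_left {N : ℕ} {C : Set SL(2, ℤ)} (hC : IsCuspRepresentatives N C)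
    {a b : ℤ} (hab : a * b ≡ 1 [ZMOD N])
    {γ g g' : SL(2, ℤ)} (hg : g ∈ C) (hg' : g' ∈ C)
    (h : IsCuspMul N a g γ) (h' : IsCuspMul N a g' γ) : g' = g := by
  obtain ⟨u, v, j, h0, h1, h2⟩ := isCuspMul_iff.1 h
  obtain ⟨u', v', j', h0', h1', h2'⟩ := isCuspMul_iff.1 h'
  simp only [← ZMod.intCast_eq_intCast_iff] at *
  push_cast at *
  refine eq_of_mem_representatives hC hg hg' (w := v * u') (k := a * (j' - j)) ?_ ?_ <;>
    simp only [← ZMod.intCast_eq_intCast_iff] <;> push_cast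
  · linear_combination b * h1' - v * u' * b * h1 - (g' 1 0 - v * u' * g 1 0) * hab -
      b * u' * γ 1 0 * h0
  · linear_combination h2' - v * u' * h2 - v * u' * (j' - j) * h1 -
      u' * (j' * γ 1 0 + γ 1 1) * h0

/-- The cusp `p · 𝔞` exists. -/
theorem exists_isCuspMul_right {N p : ℕ} {C : Set SL(2, ℤ)} (hC : IsCuspRepresentatives N C)
    (hp : p.Prime) (hpN : ¬ p ∣ N) (γ : SL(2, ℤ)) : ∃ g ∈ C, IsCuspMul N p γ g := by
  obtain ⟨t, ht⟩ := exists_isCoprime_mul hp hpN (isCoprime_bottom_row γ)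
  obtain ⟨g, hg0, hg1⟩ := exists_bottom_row ht
  obtain ⟨x, ⟨hx, γ₀, h₀, j, h⟩, -⟩ := hC.1 g
  obtain ⟨h1, h2, h3⟩ := bottom_row_modEq h₀ h
  rw [hg0] at h2
  rw [hg1] at h3
  refine ⟨x, hx, isCuspMul_iff.2 ⟨_, _, j, h1, h2, Int.ModEq.trans ?_ h3⟩⟩
  exact Int.modEq_iff_dvd.2 ⟨t, by ring⟩

/-- The cusp `p⁻¹ · 𝔞` exists. -/
theorem exists_isCuspMul_left {N p : ℕ} {C : Set SL(2, ℤ)} (hC : IsCuspRepresentatives N C)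
    (hp : p.Prime) (hpN : ¬ p ∣ N) {b : ℤ} (hb : p * b ≡ 1 [ZMOD N]) (γ : SL(2, ℤ)) :
    ∃ g ∈ C, IsCuspMul N p g γ := by
  obtain ⟨t, ht⟩ := exists_isCoprime_mul hp hpN (isCoprime_bottom_row γ).symm
  obtain ⟨g, hg0, hg1⟩ := exists_bottom_row ht.symm
  obtain ⟨x, ⟨hx, γ₀, h₀, j, h⟩, -⟩ := hC.1 g
  obtain ⟨h1, h2, h3⟩ := bottom_row_modEq h₀ h
  rw [hg0] at h2
  rw [hg1] at h3
  refine ⟨x, hx, isCuspMul_iff.2 ⟨p * γ₀ 0 0, b * γ₀ 1 1, -j * b, ?_, ?_, ?_⟩⟩ <;>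
    simp only [← ZMod.intCast_eq_intCast_iff] at * <;> push_cast at * <;>
    rw [ZMod.natCast_self, mul_zero, add_zero] at h2
  · linear_combination hb + p * b * h1
  · linear_combination -p * γ₀ 0 0 * h2 - p * x 1 0 * h1
  · linear_combination -γ₀ 0 0 * h3 - (x 1 1 + j * x 1 0) * h1 +
      j * γ₀ 0 0 * γ 1 0 * hb + j * γ₀ 0 0 * h2 + j * x 1 0 * h1

/-! ### Multiplication of the standard cusps of `Γ₀(q^e)` -/

/-- The effect of multiplication by `p` on the standard cusps of `Γ₀(q^e)`. -/
def LocalMul (p q e : ℕ) : LocalCusp → LocalCusp → Prop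
  | .infty, s' => s' = .infty
  | .zero, s' => s' = .zero
  | .frac c l, s' => ∃ c' : ℕ, s' = .frac c' l ∧ (c' : ℤ) ≡ c * p [ZMOD (q : ℤ) ^ min l (e - l)]

/-- Multiplication by `p` permutes the standard cusps as `LocalMul` says: the cusps are told apart
by the power of `q` dividing the lower left entry, and the bottom right entries give `u ≡ 1` modulo
`q^l`, which determines the numerator modulo `q^(min(l, e - l))`. -/
theorem localMul_of_bottom_rows {p q e : ℕ} (hq : q.Prime) (he : 1 ≤ e) (hpq : IsCoprime (p : ℤ) q)
    {s s' : LocalCusp} (hs : s.IsStandard q e) (hs' : s'.IsStandard q e) {u v j : ℤ}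
    (h0 : u * v ≡ 1 [ZMOD (q : ℤ) ^ e])
    (h1 : p * s.matrix q 1 0 ≡ u * s'.matrix q 1 0 [ZMOD (q : ℤ) ^ e])
    (h2 : s.matrix q 1 1 ≡ u * (j * s'.matrix q 1 0 + s'.matrix q 1 1) [ZMOD (q : ℤ) ^ e]) :
    LocalMul p q e s s' := by
  have hq' : Prime (q : ℤ) := Nat.prime_iff_prime_int.1 hq
  have hp0 : ¬ (q : ℤ) ∣ p := (Prime.coprime_iff_not_dvd hq').1 hpq.symm
  have hqe : (q : ℤ) ∣ (q : ℤ) ^ e := dvd_pow_self _ (by omega)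
  have hu : ¬ (q : ℤ) ∣ u := fun hu => hq'.not_isUnit (isUnit_of_dvd_one <| by
    exact ((h0.of_dvd hqe).dvd_iff).1 (hu.mul_right v))
  -- a standard fraction has a lower left entry that is neither a unit nor zero
  have hval : ∀ c l : ℕ, (LocalCusp.frac c l).IsStandard q e → ∀ w : ℤ, ¬ (q : ℤ) ∣ w →
      (q : ℤ) ∣ w * ((c : ℤ) * (q : ℤ) ^ l) ∧
        ¬ (q : ℤ) ^ (l + 1) ∣ w * ((c : ℤ) * (q : ℤ) ^ l) := by
    rintro c l ⟨hl, -, hc, -⟩ w hw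
    refine ⟨((dvd_pow_self _ (by omega)).mul_left _).mul_left _, fun h => ?_⟩
    rw [← mul_assoc, mul_comm, pow_succ] at h
    rcases hq'.dvd_or_dvd (Int.dvd_of_mul_dvd_mul_left (pow_ne_zero l hq'.ne_zero) h) with h | h
    · exact hw h
    · exact hq.not_isUnit (by
        have := Nat.dvd_gcd (Int.natCast_dvd_natCast.1 h) dvd_rfl
        rw [hc] at this
        exact isUnit_of_dvd_one this)
  rcases s with _ | _ | ⟨c, l⟩ <;> rcases s' with _ | _ | ⟨c', l'⟩ <;>
    simp only [LocalMul, LocalCusp.matrix, Matrix.of_apply, Matrix.cons_val_one,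
      Matrix.cons_val_zero, Matrix.cons_val', Matrix.cons_val_fin_one, mul_one, mul_zero,
      zero_add] at h1 h2 ⊢
  · exact absurd ((h1.of_dvd hqe).dvd_iff.1 (dvd_zero _)) hu
  · refine absurd ?_ (hval c' l' hs' u hu).2
    exact (h1.of_dvd (pow_dvd_pow _ hs'.2.1)).dvd_iff.1 (dvd_zero _)
  · exact absurd ((h1.of_dvd hqe).dvd_iff.2 (dvd_zero _)) hp0
  · exact absurd ((h1.of_dvd hqe).dvd_iff.2 (hval c' l' hs' u hu).1) hp0
  · refine absurd ?_ (hval c l hs p hp0).2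
    exact (h1.of_dvd (pow_dvd_pow _ hs.2.1)).dvd_iff.2 (dvd_zero _)
  · exact absurd ((h1.of_dvd hqe).dvd_iff.1 (hval c l hs p hp0).1) hu
  · have hl : l = l' := by
      rcases lt_trichotomy l l' with h | h | h
      · refine absurd ?_ (hval c l hs p hp0).2
        exact (h1.of_dvd (pow_dvd_pow _ hs.2.1)).dvd_iff.2
          (((pow_dvd_pow _ h).mul_left _).mul_left _)
      · exact h
      · refine absurd ?_ (hval c' l' hs' u hu).2
        exact (h1.of_dvd (pow_dvd_pow _ hs'.2.1)).dvd_iff.1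
          (((pow_dvd_pow _ h).mul_left _).mul_left _)
    subst hl
    refine ⟨c', rfl, ?_⟩
    have hle : l ≤ e := hs.2.1.le
    have h3 : p * (c : ℤ) ≡ u * c' [ZMOD (q : ℤ) ^ (e - l)] := by
      rw [Int.modEq_iff_dvd] at h1 ⊢
      refine Int.dvd_of_mul_dvd_mul_left (pow_ne_zero l hq'.ne_zero) ?_
      rw [← pow_add, Nat.add_sub_cancel' hle]
      refine h1.trans (dvd_of_eq (by ring))
    have h4 : 1 ≡ u [ZMOD (q : ℤ) ^ l] := by
      have h := h2.of_dvd (pow_dvd_pow _ hle)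
      refine h.trans (Int.modEq_iff_dvd.2 ⟨-(u * (j * c')), by ring⟩)
    have h5 := h3.of_dvd (pow_dvd_pow _ (min_le_right l (e - l)))
    have h6 := (h4.of_dvd (pow_dvd_pow _ (min_le_left l (e - l)))).mul_right (c' : ℤ)
    rw [one_mul] at h6
    refine (h6.trans h5.symm).trans (by rw [mul_comm])

/-- A linear congruence `a x ≡ w` modulo `m` with `a` a unit is solvable with `0 ≤ x < m`. -/
theorem exists_mul_modEq {a m : ℤ} (hm : 0 < m) (h : IsCoprime a m) (w : ℤ) :
    ∃ x, 0 ≤ x ∧ x < m ∧ a * x ≡ w [ZMOD m] := by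
  obtain ⟨b, hb⟩ := exists_mul_modEq_one h
  refine ⟨(b * w) % m, Int.emod_nonneg _ hm.ne', Int.emod_lt_of_pos _ hm, ?_⟩
  refine ((Int.mod_modEq (b * w) m).mul_left a).trans ?_
  have := hb.mul_right w
  rwa [mul_assoc, one_mul] at this

theorem IsStandard.isCoprime {q e c l : ℕ} (h : (LocalCusp.frac c l).IsStandard q e) (n : ℕ) :
    IsCoprime (c : ℤ) ((q : ℤ) ^ n) :=
  (Nat.isCoprime_iff_coprime.2 h.2.2.1).pow_right

/-- The local constants at `𝔞'` exist. If `2 l < e`, the equation for `j` is linear with a unit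
coefficient `c p c'`, once the factor `q^l` of `c' - c p` is removed. -/
theorem exists_localDataOne {p q e : ℕ} (hq : q.Prime) (hpq : IsCoprime (p : ℤ) q)
    {s s' : LocalCusp} (hs : s.IsStandard q e) (hs' : s'.IsStandard q e)
    (h : LocalMul p q e s s') : ∃ lam j, LocalDataOne p q e s s' lam j := by
  have hq0 : ∀ n, 0 < (q : ℤ) ^ n := fun n => pow_pos (by exact_mod_cast hq.pos) n
  rcases s with _ | _ | ⟨c, l⟩
  · exact ⟨1, 0, h, Int.ModEq.refl _, rfl⟩
  · exact ⟨p, 0, h, Int.ModEq.refl _, rfl⟩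
  · obtain ⟨c', rfl, hc⟩ := h
    have hlt : c' < min (q ^ l) (q ^ (e - l)) := hs'.2.2.2.2
    by_cases hl : e ≤ 2 * l
    · rw [min_eq_right (by omega)] at hc
      exact ⟨1, 0, c', rfl, fun _ => ⟨hlt.trans_le (min_le_right _ _), hc, Int.ModEq.refl _, rfl⟩,
        fun h => by omega⟩
    · rw [min_eq_left (by omega)] at hc
      have hle : l ≤ e := hs.2.1.le
      obtain ⟨w, hw⟩ := hc.symm.dvd
      obtain ⟨j, hj0, hj1, hj⟩ := exists_mul_modEq (hq0 (e - l))
        (((IsStandard.isCoprime hs (e - l)).mul_left (hpq.pow_right (n := e - l))).mul_left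
          (IsStandard.isCoprime hs' (e - l))) w
      obtain ⟨lam, -, -, hlam⟩ := exists_mul_modEq (hq0 e) (IsStandard.isCoprime hs' e) (c * p)
      refine ⟨lam, j, c', rfl, fun h => by omega, fun _ => ⟨hlt.trans_le (min_le_left _ _), hc,
        hj0, hj1, ?_, by rwa [mul_comm]⟩⟩
      obtain ⟨r, hr⟩ := hj.dvd
      refine Int.modEq_iff_dvd.2 ⟨-r, ?_⟩
      have e1 : (q : ℤ) ^ e = (q : ℤ) ^ l * (q : ℤ) ^ (e - l) := by
        rw [← pow_add, Nat.add_sub_cancel' hle]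
      rw [e1]
      linear_combination -hw - (q : ℤ) ^ l * hr

/-- The local constants at `𝔞''` exist, by the argument of `exists_localDataOne`. -/
theorem exists_localDataTwo {p q e : ℕ} (hq : q.Prime)
    {s s'' : LocalCusp} (hs : s.IsStandard q e) (hs'' : s''.IsStandard q e)
    (h : LocalMul p q e s'' s) : ∃ lam j, LocalDataTwo p q e s s'' lam j := by
  have hq0 : ∀ n, 0 < (q : ℤ) ^ n := fun n => pow_pos (by exact_mod_cast hq.pos) n
  rcases s'' with _ | _ | ⟨c'', l⟩
  · obtain rfl := h
    exact ⟨p, 0, rfl, Int.ModEq.refl _, rfl⟩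
  · obtain rfl := h
    exact ⟨1, 0, rfl, Int.ModEq.refl _, rfl⟩
  · obtain ⟨c, rfl, hc⟩ := h
    have hlt : c'' < min (q ^ l) (q ^ (e - l)) := hs''.2.2.2.2
    by_cases hl : e ≤ 2 * l
    · rw [min_eq_right (by omega)] at hc
      exact ⟨p, 0, c'', rfl, fun _ => ⟨hlt.trans_le (min_le_right _ _), hc.symm,
        Int.ModEq.refl _, rfl⟩, fun h => by omega⟩
    · rw [min_eq_left (by omega)] at hc
      have hle : l ≤ e := hs.2.1.le
      obtain ⟨w, hw⟩ := hc.dvd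
      obtain ⟨j, hj0, hj1, hj⟩ := exists_mul_modEq (hq0 (e - l))
        ((IsStandard.isCoprime hs'' (e - l)).mul_left (IsStandard.isCoprime hs (e - l))) w
      obtain ⟨lam, -, -, hlam⟩ := exists_mul_modEq (hq0 e) (IsStandard.isCoprime hs'' e) c
      refine ⟨lam, j, c'', rfl, fun h => by omega, fun _ => ⟨hlt.trans_le (min_le_left _ _),
        hc.symm, hj0, hj1, ?_, by rwa [mul_comm]⟩⟩
      obtain ⟨r, hr⟩ := hj.dvd
      refine Int.modEq_iff_dvd.2 ⟨-r, ?_⟩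
      have e1 : (q : ℤ) ^ e = (q : ℤ) ^ l * (q : ℤ) ^ (e - l) := by
        rw [← pow_add, Nat.add_sub_cancel' hle]
      rw [e1]
      linear_combination -hw - (q : ℤ) ^ l * hr

/-! ### The constants modulo `N` -/

theorem pow_exponent_dvd_auxLevel {N q : ℕ} (hq : q ∈ N.primeFactors) (s : ℕ → LocalCusp) :
    (q : ℤ) ^ (s q).exponent (N.factorization q) ∣ (auxLevel N s : ℤ) := by
  have h := Finset.dvd_prod_of_mem (fun q => q ^ (s q).exponent (N.factorization q)) hq
  exact_mod_cast h

theorem auxLevel_dvd {N : ℕ} (hN : 0 < N) (s : ℕ → LocalCusp) : auxLevel N s ∣ N := by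
  conv_rhs => rw [← Nat.prod_factorization_pow_eq_self hN.ne']
  refine Finset.prod_dvd_prod_of_dvd _ _ fun q _ => pow_dvd_pow _ ?_
  cases s q <;> simp [LocalCusp.exponent]

theorem auxLevel_pos {N : ℕ} (hN : 0 < N) (s : ℕ → LocalCusp) : 0 < auxLevel N s :=
  Nat.pos_of_dvd_of_pos (auxLevel_dvd hN s) hN

/-- The translation by `N'` fixes the bottom row of `γ` modulo `N`. -/
theorem dvd_auxLevel_mul {N : ℕ} (hN : 0 < N) {γ : SL(2, ℤ)} {s : ℕ → LocalCusp}
    (hs : ∀ q ∈ N.primeFactors, IsLocalCusp N q γ (s q)) : (N : ℤ) ∣ auxLevel N s * γ 1 0 := by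
  refine natCast_dvd_of_prime_powers hN fun q hq => ?_
  have h1 := pow_exponent_dvd_auxLevel hq s
  obtain ⟨h2, h3⟩ := hs q hq
  refine ((h3 1 0).mul_left _).dvd_iff.2 ?_
  rcases hsq : s q with _ | _ | ⟨c, l⟩ <;> rw [hsq] at h1 h2 <;>
    simp only [LocalCusp.matrix, LocalCusp.exponent, Matrix.of_apply, Matrix.cons_val_one,
      Matrix.cons_val_zero, Matrix.cons_val', Matrix.cons_val_fin_one, mul_zero, mul_one] at h1 ⊢
  · exact dvd_zero _
  · exact h1
  · rw [← Nat.sub_add_cancel h2.2.1.le, pow_add]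
    exact mul_dvd_mul h1 (dvd_mul_left _ _)

/-- Local constants glue to solutions of the systems of congruences, in the stated ranges. -/
theorem exists_globalData {N : ℕ} (hN : 0 < N) {D : ℕ → ℕ → LocalCusp → LocalCusp → ℤ → ℤ → Prop}
    {s s' : ℕ → LocalCusp}
    (h : ∀ q ∈ N.primeFactors, ∃ lam j, D q (N.factorization q) (s q) (s' q) lam j) :
    ∃ lam j : ℤ, 0 < lam ∧ lam ≤ N ∧ 0 ≤ j ∧ j < auxLevel N s ∧ GlobalData D N s s' lam j := by
  choose! a b hab using h
  obtain ⟨x, hx0, hx1, hx⟩ := exists_int_modEq_prime_powers N (N.factorization ·) a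
  obtain ⟨y, hy0, hy1, hy⟩ :=
    exists_int_modEq_prime_powers N (fun q => (s q).exponent (N.factorization q)) b
  have hprod : ∏ q ∈ N.primeFactors, q ^ N.factorization q = N :=
    Nat.prod_factorization_pow_eq_self hN.ne'
  rw [hprod] at hx1
  -- the residue class `0` has the representative `N` in `(0, N]`
  rcases hx0.eq_or_lt with h0 | h0
  · subst h0
    refine ⟨N, y, by exact_mod_cast hN, le_rfl, hy0, hy1,
      fun q hq => ⟨a q, b q, hab q hq, ?_, hy q hq⟩⟩
    exact (Int.modEq_zero_iff_dvd.2 (prime_power_dvd N q)).trans (hx q hq)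
  · exact ⟨x, y, h0, hx1.le, hy0, hy1, fun q hq => ⟨a q, b q, hab q hq, hx q hq, hy q hq⟩⟩

theorem localMul_of_isCuspMul {N p q : ℕ} (hp : p.Prime) (hpN : ¬ p ∣ N) {γ γ' : SL(2, ℤ)}
    (h : IsCuspMul N p γ γ') (hq : q ∈ N.primeFactors) {s s' : LocalCusp}
    (hs : IsLocalCusp N q γ s) (hs' : IsLocalCusp N q γ' s') :
    LocalMul p q (N.factorization q) s s' := by
  obtain ⟨u, v, j, h0, h1, h2⟩ := isCuspMul_iff.1 h
  have hd := prime_power_dvd N q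
  have hqp := Nat.prime_of_mem_primeFactors hq
  refine localMul_of_bottom_rows hqp (factorization_pos_of_mem hq) ?_ hs.1 hs'.1
    (h0.of_dvd hd) (u := u) (j := j) ?_ ?_
  · refine Nat.isCoprime_iff_coprime.2 ((Nat.coprime_primes hp hqp).2 ?_)
    rintro rfl
    exact hpN (Nat.dvd_of_mem_primeFactors hq)
  · exact (((hs.2 1 0).mul_left _).symm.trans (h1.of_dvd hd)).trans ((hs'.2 1 0).mul_left _)
  · refine ((hs.2 1 1).symm.trans (h2.of_dvd hd)).trans (Int.ModEq.mul_left _ ?_)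
    exact ((hs'.2 1 0).mul_left _).add (hs'.2 1 1)

theorem modEq_of_mul_right_modEq {a b c m : ℤ} (h : a * c ≡ b * c [ZMOD m]) (hc : IsCoprime c m) :
    a ≡ b [ZMOD m] := by
  rw [Int.modEq_iff_dvd, ← sub_mul] at h
  exact Int.modEq_iff_dvd.2 (hc.symm.dvd_of_dvd_mul_right h)

/-- The first column of `A (α β; 0 δ) B⁻¹`, for matrices `A`, `B` of determinant one. -/
def conjColumn (A B : Matrix (Fin 2) (Fin 2) ℤ) (α β δ : ℤ) (i : Fin 2) : ℤ :=
  A i 0 * α * B 1 1 - (A i 0 * β + A i 1 * δ) * B 1 0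

theorem conjColumn_modEq {m : ℤ} {A A' B B' : Matrix (Fin 2) (Fin 2) ℤ}
    (hA : ∀ i j, A i j ≡ A' i j [ZMOD m]) (hB : ∀ i j, B i j ≡ B' i j [ZMOD m]) (α β δ : ℤ)
    (i : Fin 2) : conjColumn A B α β δ i ≡ conjColumn A' B' α β δ i [ZMOD m] := by
  unfold conjColumn
  exact ((((hA i 0).mul_right _).mul (hB 1 1))).sub
    ((((hA i 0).mul_right _).add ((hA i 1).mul_right _)).mul (hB 1 0))

theorem conjColumn_localDataOne {p q e : ℕ} {s s' : LocalCusp} (hs : s.IsStandard q e)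
    (hs' : s'.IsStandard q e)
    {lam j b : ℤ} (h : LocalDataOne p q e s s' lam j)
    (hb : b ≡ p * j [ZMOD (q : ℤ) ^ s.exponent e]) :
    conjColumn (s'.matrix q) (s.matrix q) 1 b p 0 ≡ lam [ZMOD (q : ℤ) ^ e] ∧
    conjColumn (s'.matrix q) (s.matrix q) 1 b p 1 ≡ 0 [ZMOD (q : ℤ) ^ e] := by
  rcases s with _ | _ | ⟨c, l⟩
  · obtain ⟨rfl, h1, rfl⟩ := h
    simpa [conjColumn, LocalCusp.matrix] using h1.symm
  · obtain ⟨rfl, h1, rfl⟩ := h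
    simp only [LocalCusp.exponent, mul_zero] at hb
    simpa [conjColumn, LocalCusp.matrix] using ⟨h1.symm, hb.neg⟩
  · obtain ⟨c', rfl, h1, h2⟩ := h
    have e1 : (q : ℤ) ^ e = (q : ℤ) ^ l * (q : ℤ) ^ (e - l) := by
      rw [← pow_add, Nat.add_sub_cancel' hs.2.1.le]
    obtain ⟨r, hr⟩ := hb.symm.dvd
    simp only [LocalCusp.exponent] at hr
    simp only [conjColumn, LocalCusp.matrix, Matrix.of_apply, Matrix.cons_val_one,
      Matrix.cons_val_zero, Matrix.cons_val', Matrix.cons_val_fin_one, mul_one, one_mul, zero_mul,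
      add_zero]
    by_cases hl : e ≤ 2 * l
    · obtain ⟨-, h3, h4, rfl⟩ := h1 hl
      obtain ⟨t, ht⟩ := h3.symm.dvd
      refine ⟨Int.ModEq.trans (Int.modEq_iff_dvd.2 ⟨r * c, ?_⟩) h4.symm,
        Int.modEq_zero_iff_dvd.2 ⟨t - c' * c * q ^ l * r, ?_⟩⟩ <;> rw [e1]
      · linear_combination c * (q : ℤ) ^ l * hr
      · linear_combination (q : ℤ) ^ l * ht - c' * c * (q : ℤ) ^ l * (q : ℤ) ^ l * hr
    · obtain ⟨-, -, -, -, h3, h4⟩ := h2 (by omega)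
      obtain ⟨t, ht⟩ := h3.symm.dvd
      refine ⟨?_, Int.modEq_zero_iff_dvd.2 ⟨q ^ l * t - c' * c * q ^ l * r, ?_⟩⟩
      · have h5 : (1 - b * (c * (q : ℤ) ^ l)) * c' ≡ lam * c' [ZMOD (q : ℤ) ^ e] := by
          refine Int.ModEq.trans (Int.modEq_iff_dvd.2 ⟨r * c * c', ?_⟩) (h3.trans h4.symm)
          rw [e1]
          linear_combination c * c' * (q : ℤ) ^ l * hr
        exact modEq_of_mul_right_modEq h5 (IsStandard.isCoprime hs' e)
      · rw [e1] at ht ⊢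
        linear_combination (q : ℤ) ^ l * ht - c' * c * (q : ℤ) ^ l * (q : ℤ) ^ l * hr

theorem conjColumn_localDataTwo {p q e : ℕ} {s s'' : LocalCusp} (hs : s.IsStandard q e)
    (hs'' : s''.IsStandard q e)
    {lam j b : ℤ} (h : LocalDataTwo p q e s s'' lam j)
    (hb : b ≡ j [ZMOD (q : ℤ) ^ s.exponent e]) :
    conjColumn (s''.matrix q) (s.matrix q) p b 1 0 ≡ lam [ZMOD (q : ℤ) ^ e] ∧
    conjColumn (s''.matrix q) (s.matrix q) p b 1 1 ≡ 0 [ZMOD (q : ℤ) ^ e] := by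
  rcases s with _ | _ | ⟨c, l⟩
  · obtain ⟨rfl, h1, rfl⟩ := h
    simpa [conjColumn, LocalCusp.matrix] using h1.symm
  · obtain ⟨rfl, h1, rfl⟩ := h
    simp only [LocalCusp.exponent] at hb
    simpa [conjColumn, LocalCusp.matrix] using ⟨h1.symm, hb.neg⟩
  · obtain ⟨c'', rfl, h1, h2⟩ := h
    have e1 : (q : ℤ) ^ e = (q : ℤ) ^ l * (q : ℤ) ^ (e - l) := by
      rw [← pow_add, Nat.add_sub_cancel' hs.2.1.le]
    obtain ⟨r, hr⟩ := hb.symm.dvd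
    simp only [LocalCusp.exponent] at hr
    simp only [conjColumn, LocalCusp.matrix, Matrix.of_apply, Matrix.cons_val_one,
      Matrix.cons_val_zero, Matrix.cons_val', Matrix.cons_val_fin_one, mul_one, one_mul,
      add_zero]
    by_cases hl : e ≤ 2 * l
    · obtain ⟨-, h3, h4, rfl⟩ := h1 hl
      obtain ⟨t, ht⟩ := h3.symm.dvd
      refine ⟨Int.ModEq.trans (Int.modEq_iff_dvd.2 ⟨r * c, ?_⟩) h4.symm,
        Int.modEq_zero_iff_dvd.2 ⟨t - c'' * c * q ^ l * r, ?_⟩⟩ <;> rw [e1]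
      · linear_combination c * (q : ℤ) ^ l * hr
      · linear_combination (q : ℤ) ^ l * ht - c'' * c * (q : ℤ) ^ l * (q : ℤ) ^ l * hr
    · obtain ⟨-, -, -, -, h3, h4⟩ := h2 (by omega)
      obtain ⟨t, ht⟩ := h3.symm.dvd
      refine ⟨?_, Int.modEq_zero_iff_dvd.2 ⟨q ^ l * t - c'' * c * q ^ l * r, ?_⟩⟩
      · have h5 : (p - b * (c * (q : ℤ) ^ l)) * c'' ≡ lam * c'' [ZMOD (q : ℤ) ^ e] := by
          refine Int.ModEq.trans (Int.modEq_iff_dvd.2 ⟨r * c * c'', ?_⟩) (h3.trans h4.symm)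
          rw [e1]
          linear_combination c * c'' * (q : ℤ) ^ l * hr
        exact modEq_of_mul_right_modEq h5 (IsStandard.isCoprime hs'' e)
      · rw [e1] at ht ⊢
        linear_combination (q : ℤ) ^ l * ht - c'' * c * (q : ℤ) ^ l * (q : ℤ) ^ l * hr

/-- If `lam` and `j` are the constants attached to `𝔞` and `𝔞'` and `b ≡ p j` modulo `N'`, the
integral matrix `γ_𝔞' (1 b; 0 p) γ_𝔞⁻¹` has first column `(lam, 0)` modulo `N`. -/
theorem conjColumn_globalDataOne {N p : ℕ} (hN : 0 < N) {γ γ' : SL(2, ℤ)} {s s' : ℕ → LocalCusp}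
    (hs : ∀ q ∈ N.primeFactors, IsLocalCusp N q γ (s q))
    (hs' : ∀ q ∈ N.primeFactors, IsLocalCusp N q γ' (s' q)) {lam j b : ℤ}
    (h : GlobalData (LocalDataOne p) N s s' lam j) (hb : b ≡ p * j [ZMOD auxLevel N s]) :
    conjColumn γ' γ 1 b p 0 ≡ lam [ZMOD N] ∧ conjColumn γ' γ 1 b p 1 ≡ 0 [ZMOD N] := by
  have key : ∀ q ∈ N.primeFactors,
      conjColumn γ' γ 1 b p 0 ≡ lam [ZMOD (q : ℤ) ^ N.factorization q] ∧
      conjColumn γ' γ 1 b p 1 ≡ 0 [ZMOD (q : ℤ) ^ N.factorization q] := fun q hq => by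
    obtain ⟨lq, jq, hD, hl, hj⟩ := h q hq
    obtain ⟨h1, h2⟩ := conjColumn_localDataOne (hs q hq).1 (hs' q hq).1 hD
      ((hb.of_dvd (pow_exponent_dvd_auxLevel hq s)).trans (hj.mul_left _))
    have hc := conjColumn_modEq (hs' q hq).2 (hs q hq).2 1 b p
    exact ⟨((hc 0).trans h1).trans hl.symm, (hc 1).trans h2⟩
  exact ⟨Int.modEq_iff_dvd.2 (natCast_dvd_of_prime_powers hN fun q hq => (key q hq).1.dvd),
    Int.modEq_iff_dvd.2 (natCast_dvd_of_prime_powers hN fun q hq => (key q hq).2.dvd)⟩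

/-- If `lam` and `j` are the constants attached to `𝔞` and `𝔞''`, the integral matrix
`γ_𝔞'' (1 j; 0 1) (p 0; 0 1) γ_𝔞⁻¹` has first column `(lam, 0)` modulo `N`. -/
theorem conjColumn_globalDataTwo {N p : ℕ} (hN : 0 < N) {γ γ'' : SL(2, ℤ)} {s s'' : ℕ → LocalCusp}
    (hs : ∀ q ∈ N.primeFactors, IsLocalCusp N q γ (s q))
    (hs'' : ∀ q ∈ N.primeFactors, IsLocalCusp N q γ'' (s'' q)) {lam j : ℤ}
    (h : GlobalData (LocalDataTwo p) N s s'' lam j) :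
    conjColumn γ'' γ p j 1 0 ≡ lam [ZMOD N] ∧ conjColumn γ'' γ p j 1 1 ≡ 0 [ZMOD N] := by
  have key : ∀ q ∈ N.primeFactors,
      conjColumn γ'' γ p j 1 0 ≡ lam [ZMOD (q : ℤ) ^ N.factorization q] ∧
      conjColumn γ'' γ p j 1 1 ≡ 0 [ZMOD (q : ℤ) ^ N.factorization q] := fun q hq => by
    obtain ⟨lq, jq, hD, hl, hj⟩ := h q hq
    obtain ⟨h1, h2⟩ := conjColumn_localDataTwo (hs q hq).1 (hs'' q hq).1 hD hj
    have hc := conjColumn_modEq (hs'' q hq).2 (hs q hq).2 p j 1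
    exact ⟨((hc 0).trans h1).trans hl.symm, (hc 1).trans h2⟩
  exact ⟨Int.modEq_iff_dvd.2 (natCast_dvd_of_prime_powers hN fun q hq => (key q hq).1.dvd),
    Int.modEq_iff_dvd.2 (natCast_dvd_of_prime_powers hN fun q hq => (key q hq).2.dvd)⟩

/-! ### Integral matrices of prime determinant -/

/-- The integral matrices `(p 0; 0 1)` (for `none`) and `(1 b; 0 p)` (for `some b`). -/
def heckeRep (p : ℕ) : Option ℤ → Matrix (Fin 2) (Fin 2) ℤ
  | none => !![p, 0; 0, 1]
  | some b => !![1, b; 0, p]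

theorem det_heckeRep (p : ℕ) (i : Option ℤ) : (heckeRep p i).det = p := by
  cases i <;> simp [heckeRep, Matrix.det_fin_two]

/-- Every integral matrix of determinant `p` is left equivalent to one of the `p + 1` matrices
`(p 0; 0 1)` and `(1 t; 0 p)`, `0 ≤ t < p`. -/
theorem exists_eq_mul_heckeRep {p : ℕ} (hp : p.Prime) (M : Matrix (Fin 2) (Fin 2) ℤ)
    (hM : M.det = p) : ∃ (δ : SL(2, ℤ)) (k : Option (Fin p)),
      M = (δ : Matrix (Fin 2) (Fin 2) ℤ) * heckeRep p (k.map fun t => ((t : ℕ) : ℤ)) := by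
  have hp' : Prime (p : ℤ) := Nat.prime_iff_prime_int.1 hp
  have hp0 : (p : ℤ) ≠ 0 := hp'.ne_zero
  rw [Matrix.det_fin_two] at hM
  by_cases h : (p : ℤ) ∣ M 0 0 ∧ (p : ℤ) ∣ M 1 0
  · obtain ⟨⟨a, ha⟩, ⟨c, hc⟩⟩ := h
    refine ⟨⟨!![a, M 0 1; c, M 1 1], ?_⟩, none, ?_⟩
    · rw [Matrix.det_fin_two_of]
      refine mul_left_cancel₀ hp0 ?_
      rw [ha, hc] at hM
      linear_combination hM
    · ext i j
      fin_cases i <;> fin_cases j <;> simp [heckeRep, ha, hc, mul_comm]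
  · -- the second column is a multiple of the first modulo `p`
    have ht : ∃ t : ℤ, (p : ℤ) ∣ M 0 1 - t * M 0 0 ∧ (p : ℤ) ∣ M 1 1 - t * M 1 0 := by
      by_cases ha : (p : ℤ) ∣ M 0 0
      · have hc : ¬ (p : ℤ) ∣ M 1 0 := fun hc => h ⟨ha, hc⟩
        obtain ⟨b, hb⟩ := exists_mul_modEq_one ((Prime.coprime_iff_not_dvd hp').2 hc).symm
        obtain ⟨r, hr⟩ := hb.dvd
        refine ⟨b * M 1 1, ⟨M 0 1 * r - b, ?_⟩, ⟨M 1 1 * r, ?_⟩⟩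
        · linear_combination -b * hM + M 0 1 * hr
        · linear_combination M 1 1 * hr
      · obtain ⟨b, hb⟩ := exists_mul_modEq_one ((Prime.coprime_iff_not_dvd hp').2 ha).symm
        obtain ⟨r, hr⟩ := hb.dvd
        refine ⟨b * M 0 1, ⟨M 0 1 * r, ?_⟩, ⟨M 1 1 * r + b, ?_⟩⟩
        · linear_combination M 0 1 * hr
        · linear_combination b * hM + M 1 1 * hr
    obtain ⟨t, h1, h2⟩ := ht
    obtain ⟨r, hr⟩ := (Int.mod_modEq t p).dvd
    have ht0 := Int.emod_nonneg t hp0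
    have ht1 := Int.emod_lt_of_pos t (show (0 : ℤ) < p by exact_mod_cast hp.pos)
    obtain ⟨b, hb⟩ := h1
    obtain ⟨d, hd⟩ := h2
    have e1 : M 0 1 = p * (b + r * M 0 0) + (t % p) * M 0 0 := by
      linear_combination hb + M 0 0 * hr
    have e2 : M 1 1 = p * (d + r * M 1 0) + (t % p) * M 1 0 := by
      linear_combination hd + M 1 0 * hr
    refine ⟨⟨!![M 0 0, b + r * M 0 0; M 1 0, d + r * M 1 0], ?_⟩,
      some ⟨(t % p).toNat, by omega⟩, ?_⟩
    · rw [Matrix.det_fin_two_of]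
      refine mul_left_cancel₀ hp0 ?_
      rw [e1, e2] at hM
      linear_combination hM
    · ext i j
      fin_cases i <;> fin_cases j <;>
        simp [heckeRep, Matrix.mul_apply, Fin.sum_univ_two, Int.toNat_of_nonneg ht0]
      · linear_combination e1
      · linear_combination e2

/-- Left equivalent matrices among `(p 0; 0 1)` and `(1 b; 0 p)` are equal up to the class of `b`
modulo `p`. -/
theorem heckeRep_injective {p : ℕ} (hp : p.Prime) {i i' : Option ℤ} {δ : SL(2, ℤ)}
    (h : heckeRep p i = (δ : Matrix (Fin 2) (Fin 2) ℤ) * heckeRep p i') :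
    i.map (Int.cast : ℤ → ZMod p) = i'.map Int.cast := by
  have hp0 : (p : ℤ) ≠ 0 := by exact_mod_cast hp.ne_zero
  have hp1 : ¬ (p : ℤ) ∣ 1 := fun h =>
    (Nat.prime_iff_prime_int.1 hp).not_isUnit (isUnit_of_dvd_one h)
  have hdet := det_eq_one δ
  have e := fun i j => congrFun (congrFun h i) j
  rcases i with _ | b <;> rcases i' with _ | b' <;>
    simp only [heckeRep, Matrix.mul_apply, Fin.sum_univ_two, Matrix.of_apply, Matrix.cons_val_one,
      Matrix.cons_val_zero, Matrix.cons_val', Matrix.cons_val_fin_one] at e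
  · rfl
  · exfalso
    have h00 := e 0 0
    have h10 := e 1 0
    simp at h00 h10
    rw [← h00, ← h10] at hdet
    exact hp1 ⟨δ 1 1, by linear_combination -hdet⟩
  · exfalso
    have h00 := e 0 0
    simp at h00
    exact hp1 ⟨δ 0 0, by linear_combination h00⟩
  · have h00 := e 0 0
    have h01 := e 0 1
    simp at h00 h01
    rw [← h00] at h01
    simp [h01]

/-! ### The congruence in the group ring -/

/-- The elements `(p 0; 0 1)` (for `none`) and `(1 b; 0 p)` (for `some b`) of `GL(2, ℚ)⁺`. -/
def ratHecke (p : ℕ+) : Option ℤ → GL(2, ℚ)⁺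
  | none => ratTriangular p 1 0
  | some b => ratTriangular 1 p b

theorem coe_ratSL (γ : SL(2, ℤ)) :
    ((ratSL γ : GL (Fin 2) ℚ) : Matrix (Fin 2) (Fin 2) ℚ) =
      (γ : Matrix (Fin 2) (Fin 2) ℤ).map (Int.castRingHom ℚ) := rfl

theorem coe_ratTriangular (a d : ℕ+) (b : ℤ) :
    ((ratTriangular a d b : GL (Fin 2) ℚ) : Matrix (Fin 2) (Fin 2) ℚ) =
      !![((a : ℕ) : ℚ), (b : ℚ); 0, ((d : ℕ) : ℚ)] := rfl

theorem coe_ratHecke (p : ℕ+) (i : Option ℤ) :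
    ((ratHecke p i : GL (Fin 2) ℚ) : Matrix (Fin 2) (Fin 2) ℚ) =
      (heckeRep p i).map (Int.castRingHom ℚ) := by
  cases i <;> ext i j <;> fin_cases i <;> fin_cases j <;>
    simp [ratHecke, heckeRep, coe_ratTriangular]

theorem ratSL_mul (γ γ' : SL(2, ℤ)) : ratSL (γ * γ') = ratSL γ * ratSL γ' := by
  simp [ratSL]

theorem ratTriangular_one_one (j : ℤ) : ratTriangular 1 1 j = ratSL (ModularGroup.T ^ j) := by
  apply Subtype.ext
  apply Units.ext
  rw [coe_ratTriangular, coe_ratSL, ModularGroup.coe_T_zpow]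
  ext i j
  fin_cases i <;> fin_cases j <;> simp

theorem ratSL_mul_ratHecke_eq {p : ℕ+} {A γ₀ γ : SL(2, ℤ)} {i k : Option ℤ}
    (h : (A : Matrix (Fin 2) (Fin 2) ℤ) * heckeRep p i = γ₀ * heckeRep p k * γ) :
    ratSL A * ratHecke p i = ratSL γ₀ * (ratHecke p k * ratSL γ) := by
  apply Subtype.ext
  apply Units.ext
  simp only [Subgroup.coe_mul, Units.val_mul, coe_ratSL, coe_ratHecke]
  rw [← Matrix.map_mul, h, Matrix.map_mul, Matrix.map_mul, mul_assoc]

theorem ringOf_mul (g h : GL(2, ℚ)⁺) : ringOf (g * h) = ringOf g * ringOf h := by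
  simp [ringOf, MonoidAlgebra.single_mul_single]

theorem ringOf_sub_mem_automorphyIdeal {N : ℕ} (χ : DirichletCharacter ℂ N) {γ : SL(2, ℤ)}
    (hγ : γ ∈ CongruenceSubgroup.Gamma0 N) (x : RatGroupRing) :
    ringOf (ratSL γ) * x - charTilde χ γ • x ∈ automorphyIdeal χ := by
  have h : ringOf (ratSL γ) - charTilde χ γ • 1 ∈ automorphyIdeal χ :=
    Submodule.subset_span ⟨γ, hγ, rfl⟩
  have h2 := (automorphyIdeal χ).smul_mem (MulOpposite.op x) h
  rwa [op_smul_eq_mul, sub_mul, smul_mul_assoc, one_mul] at h2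

theorem smul_mem_automorphyIdeal {N : ℕ} (χ : DirichletCharacter ℂ N) (c : ℂ) {x : RatGroupRing}
    (hx : x ∈ automorphyIdeal χ) : c • x ∈ automorphyIdeal χ := by
  have h2 := (automorphyIdeal χ).smul_mem (MulOpposite.op (c • (1 : RatGroupRing))) hx
  rwa [op_smul_eq_mul, mul_smul_comm, mul_one] at h2

/-- The coefficient of a matrix in the Hecke element: the character at the upper left entry. -/
def heckeCoeff {N : ℕ} (χ : DirichletCharacter ℂ N) (p : ℕ) (k : Option ℤ) : ℂ :=
  χ ((heckeRep p k 0 0 : ℤ) : ZMod N)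

/-- Modulo the automorphy ideal, `χ(upper left entry of M) M` depends only on the class of `M` in
`Γ₀(N) \ Δ`, where `Δ` is the set of integral matrices `M` of determinant `p` with lower left entry
divisible by `N`. Here `M = A h γ⁻¹`, where `h` is the matrix given by `i`. -/
theorem exists_heckeRep_congruence {N : ℕ} (χ : DirichletCharacter ℂ N) {p : ℕ+}
    (hp : (p : ℕ).Prime) (hpN : ¬ (p : ℕ) ∣ N) (A γ : SL(2, ℤ)) (i : Option ℤ) {lam : ℤ}
    (h0 : ((A : Matrix (Fin 2) (Fin 2) ℤ) * heckeRep p i * (γ⁻¹ : SL(2, ℤ))) 0 0 ≡ lam [ZMOD N])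
    (h1 : ((A : Matrix (Fin 2) (Fin 2) ℤ) * heckeRep p i * (γ⁻¹ : SL(2, ℤ))) 1 0 ≡ 0 [ZMOD N]) :
    ∃ (γ₀ : SL(2, ℤ)) (k : Option (Fin p)),
      (A : Matrix (Fin 2) (Fin 2) ℤ) * heckeRep p i =
        γ₀ * heckeRep p (k.map fun t => ((t : ℕ) : ℤ)) * γ ∧
      χ (lam : ZMod N) • ringOf (ratSL A * ratHecke p i) -
        heckeCoeff χ p (k.map fun t => ((t : ℕ) : ℤ)) •
          ringOf (ratHecke p (k.map fun t => ((t : ℕ) : ℤ)) * ratSL γ) ∈ automorphyIdeal χ := by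
  obtain ⟨γ₀, k, hk⟩ := exists_eq_mul_heckeRep hp
    ((A : Matrix (Fin 2) (Fin 2) ℤ) * heckeRep p i * (γ⁻¹ : SL(2, ℤ)))
    (by rw [Matrix.det_mul, Matrix.det_mul, A.2, (γ⁻¹).2, det_heckeRep, one_mul, mul_one])
  rw [hk] at h0 h1
  set K : Option ℤ := k.map fun t => ((t : ℕ) : ℤ) with hK
  have hM : (A : Matrix (Fin 2) (Fin 2) ℤ) * heckeRep p i = γ₀ * heckeRep p K * γ := by
    rw [← hk, mul_assoc, ← Matrix.SpecialLinearGroup.coe_mul, inv_mul_cancel,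
      Matrix.SpecialLinearGroup.coe_one, mul_one]
  have hcol : ∀ r, ((γ₀ : Matrix (Fin 2) (Fin 2) ℤ) * heckeRep p K) r 0 =
      γ₀ r 0 * heckeRep p K 0 0 := by
    intro r
    rw [Matrix.mul_apply, Fin.sum_univ_two]
    rcases K with _ | b <;> simp [heckeRep]
  rw [hcol] at h0 h1
  have hunit : IsCoprime (heckeRep p K 0 0) (N : ℤ) := by
    rcases K with _ | b
    · exact Nat.isCoprime_iff_coprime.2 ((Nat.Prime.coprime_iff_not_dvd hp).2 hpN)
    · exact isCoprime_one_left
  have hΓ : γ₀ ∈ CongruenceSubgroup.Gamma0 N := by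
    rw [CongruenceSubgroup.Gamma0_mem, ZMod.intCast_zmod_eq_zero_iff_dvd]
    exact hunit.symm.dvd_of_dvd_mul_right (Int.modEq_zero_iff_dvd.1 h1)
  refine ⟨γ₀, k, hM, ?_⟩
  rw [ratSL_mul_ratHecke_eq hM, ringOf_mul (ratSL γ₀)]
  have hmem := smul_mem_automorphyIdeal χ (χ (lam : ZMod N))
    (ringOf_sub_mem_automorphyIdeal χ hΓ (ringOf (ratHecke p K * ratSL γ)))
  rw [smul_sub, smul_smul] at hmem
  have hc : χ (lam : ZMod N) * charTilde χ γ₀ = heckeCoeff χ p K := by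
    rw [charTilde, heckeCoeff, ← map_mul]
    congr 1
    have e0 := (ZMod.intCast_eq_intCast_iff _ _ _).2 h0
    have e1 := (ZMod.intCast_eq_intCast_iff _ _ _).2 (bottom_row_modEq (j := 0) hΓ
      (g := γ₀) (γ := 1) (by simp)).1
    push_cast at e0 e1
    rw [← e0]
    linear_combination (heckeRep p K 0 0 : ZMod N) * e1
  rwa [hc] at hmem

theorem heckeElement_mul_ringOf {N : ℕ} (χ : DirichletCharacter ℂ N) (p : ℕ+) (γ : SL(2, ℤ)) :
    heckeElement χ p * ringOf (ratSL γ) = ∑ k : Option (Fin p),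
      heckeCoeff χ p (k.map fun t => ((t : ℕ) : ℤ)) •
        ringOf (ratHecke p (k.map fun t => ((t : ℕ) : ℤ)) * ratSL γ) := by
  rw [Fintype.sum_option, heckeElement, add_mul, Finset.sum_mul, Finset.sum_range]
  simp [heckeCoeff, heckeRep, ratHecke, ringOf_mul]

/-- The Hecke element times `γ` may be computed, modulo the automorphy ideal, from any `p + 1`
pairwise left inequivalent matrices `M = A h γ⁻¹` in `Δ`. -/
theorem heckeElement_congruence {N : ℕ} (χ : DirichletCharacter ℂ N) {p : ℕ+}
    (hp : (p : ℕ).Prime) (hpN : ¬ (p : ℕ) ∣ N) (γ : SL(2, ℤ)) (A : Option (Fin p) → SL(2, ℤ))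
    (H : Option (Fin p) → Option ℤ) (lam : Option (Fin p) → ℤ)
    (h0 : ∀ i, ((A i : Matrix (Fin 2) (Fin 2) ℤ) * heckeRep p (H i) * (γ⁻¹ : SL(2, ℤ))) 0 0 ≡
      lam i [ZMOD N])
    (h1 : ∀ i, ((A i : Matrix (Fin 2) (Fin 2) ℤ) * heckeRep p (H i) * (γ⁻¹ : SL(2, ℤ))) 1 0 ≡
      0 [ZMOD N])
    (hH : Function.Injective fun i => (H i).map (Int.cast : ℤ → ZMod p)) :
    heckeElement χ p * ringOf (ratSL γ) -
      ∑ i, χ (lam i : ZMod N) • ringOf (ratSL (A i) * ratHecke p (H i)) ∈ automorphyIdeal χ := by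
  choose δ κ hδ hκ using fun i => exists_heckeRep_congruence χ hp hpN (A i) γ (H i) (h0 i) (h1 i)
  have hinj : Function.Injective κ := by
    intro i i' h
    refine hH (heckeRep_injective hp (δ := (A i)⁻¹ * δ i * (δ i')⁻¹ * A i') ?_)
    have e1 := hδ i
    have e2 := hδ i'
    rw [← h] at e2
    have c : ∀ B : SL(2, ℤ), ((B⁻¹ : SL(2, ℤ)) : Matrix (Fin 2) (Fin 2) ℤ) * B = 1 := fun B => by
      rw [← Matrix.SpecialLinearGroup.coe_mul, inv_mul_cancel, Matrix.SpecialLinearGroup.coe_one]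
    simp only [Matrix.SpecialLinearGroup.coe_mul]
    rw [mul_assoc, e2]
    simp only [mul_assoc]
    rw [← mul_assoc _ (δ i' : Matrix (Fin 2) (Fin 2) ℤ), c, one_mul,
      ← mul_assoc (δ i : Matrix (Fin 2) (Fin 2) ℤ), ← e1, ← mul_assoc, c, one_mul]
  have hbij : Function.Bijective κ := Finite.injective_iff_bijective.1 hinj
  rw [heckeElement_mul_ringOf, ← hbij.sum_comp, ← Finset.sum_sub_distrib]
  refine (automorphyIdeal χ).sum_mem fun i _ => ?_
  rw [← neg_sub]
  exact (automorphyIdeal χ).neg_mem (hκ i)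

/-- The elements of `[0, M p)` in the residue class of `r` modulo `M`. -/
theorem sum_filter_modEq {α : Type*} [AddCommMonoid α] {M : ℕ} (hM : 0 < M) (p : ℕ) (r : ℤ)
    (F : ℕ → α) :
    ∑ b ∈ (Finset.range (M * p)).filter (fun b : ℕ => (b : ℤ) ≡ r [ZMOD M]), F b =
      ∑ t : Fin p, F ((r % M).toNat + M * t) := by
  have hM' : (0 : ℤ) < M := by exact_mod_cast hM
  have h0 := Int.emod_nonneg r hM'.ne'
  have h1 := Int.emod_lt_of_pos r hM'
  have hcast : (((r % M).toNat : ℕ) : ℤ) = r % M := Int.toNat_of_nonneg h0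
  have hlt : (r % M).toNat < M := by omega
  rw [← Finset.sum_range (fun t => F ((r % M).toNat + M * t))]
  symm
  refine Finset.sum_bij (fun t _ => (r % M).toNat + M * t) ?_ ?_ ?_ fun _ _ => rfl
  · intro t ht
    rw [Finset.mem_range] at ht
    rw [Finset.mem_filter, Finset.mem_range]
    refine ⟨?_, ?_⟩
    · calc (r % M).toNat + M * t < M + M * t := by omega
        _ = M * (t + 1) := by ring
        _ ≤ M * p := Nat.mul_le_mul_left _ ht
    · push_cast
      rw [hcast]
      exact (Int.modEq_iff_dvd.2 ⟨-t, by ring⟩ : _ ≡ r % M [ZMOD M]).trans (Int.mod_modEq _ _)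
  · intro t _ t' _ h
    exact Nat.eq_of_mul_eq_mul_left hM (Nat.add_left_cancel h)
  · intro b hb
    rw [Finset.mem_filter, Finset.mem_range] at hb
    refine ⟨b / M, Finset.mem_range.2 (Nat.div_lt_of_lt_mul hb.1), ?_⟩
    have h2 : (r % M).toNat = b % M := by
      have h3 : (b : ℤ) % M = r % M := hb.2
      rw [← h3]
      exact_mod_cast Int.toNat_natCast (b % M)
    rw [h2, Nat.mod_add_div]

/-- The congruence in the group ring of `GL(2, ℚ)⁺` satisfied by the Hecke element at a cusp. -/
theorem heckeElement_mul_cusp_congruence {N : ℕ} (hN : 0 < N) (χ : DirichletCharacter ℂ N) {p : ℕ+}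
    (hp : (p : ℕ).Prime) (hpN : ¬ (p : ℕ) ∣ N) {γ γ₁ γ₂ : SL(2, ℤ)} {s s₁ s₂ : ℕ → LocalCusp}
    (hs : ∀ q ∈ N.primeFactors, IsLocalCusp N q γ (s q))
    (hs₁ : ∀ q ∈ N.primeFactors, IsLocalCusp N q γ₁ (s₁ q))
    (hs₂ : ∀ q ∈ N.primeFactors, IsLocalCusp N q γ₂ (s₂ q)) {lam₁ j₁ lam₂ j₂ : ℤ}
    (h₁ : GlobalData (LocalDataOne p) N s s₁ lam₁ j₁)
    (h₂ : GlobalData (LocalDataTwo p) N s s₂ lam₂ j₂) :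
    heckeElement χ p * ringOf (ratSL γ) -
      (χ (lam₂ : ZMod N) • ringOf (ratSL γ₂ * (ratTriangular 1 1 j₂ * ratTriangular p 1 0)) +
        χ (lam₁ : ZMod N) • ∑ b ∈ (Finset.range (auxLevel N s * p)).filter
          (fun b : ℕ => (b : ℤ) ≡ (p : ℕ) * j₁ [ZMOD auxLevel N s]),
          ringOf (ratSL γ₁ * ratTriangular 1 p b)) ∈ automorphyIdeal χ := by
  have hM := auxLevel_pos hN s
  rw [sum_filter_modEq hM]
  set M := auxLevel N s with hMdef
  set B : Fin p → ℕ := fun t => ((((p : ℕ) : ℤ) * j₁) % M).toNat + M * t with hB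
  have hBmod : ∀ t, (B t : ℤ) ≡ (p : ℕ) * j₁ [ZMOD M] := by
    intro t
    have hM' : (0 : ℤ) < M := by exact_mod_cast hM
    simp only [hB]
    push_cast
    rw [Int.toNat_of_nonneg (Int.emod_nonneg _ hM'.ne')]
    exact (Int.modEq_iff_dvd.2 ⟨-t, by ring⟩ : _ ≡ ((p : ℕ) * j₁ : ℤ) % M [ZMOD M]).trans
      (Int.mod_modEq _ _)
  have hcol : ∀ (A : SL(2, ℤ)) (α β δ : ℤ) (i : Fin 2),
      ((A : Matrix (Fin 2) (Fin 2) ℤ) * !![α, β; 0, δ] * (γ⁻¹ : SL(2, ℤ))) i 0 =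
        conjColumn A γ α β δ i := by
    intro A α β δ i
    rw [Matrix.SpecialLinearGroup.coe_inv, Matrix.adjugate_fin_two]
    simp [Matrix.mul_apply, Fin.sum_univ_two, conjColumn]
    ring
  have hT : ((γ₂ * ModularGroup.T ^ j₂ : SL(2, ℤ)) : Matrix (Fin 2) (Fin 2) ℤ) *
      heckeRep p none = (γ₂ : Matrix (Fin 2) (Fin 2) ℤ) * !![((p : ℕ) : ℤ), j₂; 0, 1] := by
    rw [Matrix.SpecialLinearGroup.coe_mul, ModularGroup.coe_T_zpow, mul_assoc]
    congr 1
    ext i j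
    fin_cases i <;> fin_cases j <;> simp [heckeRep]
  have c2 := conjColumn_globalDataTwo hN hs hs₂ h₂
  have c1 := fun t => conjColumn_globalDataOne hN hs hs₁ h₁ (hBmod t)
  have hdist : Function.Injective fun i : Option (Fin p) =>
      (i.map fun t => (B t : ℤ)).map (Int.cast : ℤ → ZMod p) := by
    have hMp : IsCoprime ((p : ℕ) : ℤ) (M : ℤ) := Nat.isCoprime_iff_coprime.2
      ((Nat.Prime.coprime_iff_not_dvd hp).2 fun h => hpN (h.trans (auxLevel_dvd hN s)))
    simp only [Option.map_map]
    refine Option.map_injective fun t t' h => ?_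
    simp only [Function.comp_apply] at h
    rw [ZMod.intCast_eq_intCast_iff] at h
    obtain ⟨r, hr⟩ := h.dvd
    simp only [hB] at hr
    push_cast at hr
    have h3 : ((p : ℕ) : ℤ) ∣ (M : ℤ) * ((t' : ℕ) - (t : ℕ) : ℤ) := ⟨r, by linear_combination hr⟩
    have h4 : ((t : ℕ) : ℤ) ≡ (t' : ℕ) [ZMOD (p : ℕ)] :=
      Int.modEq_iff_dvd.2 (hMp.dvd_of_dvd_mul_left h3)
    exact Fin.ext (Nat.ModEq.eq_of_lt_of_lt (Int.natCast_modEq_iff.1 h4) t.2 t'.2)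
  have key := heckeElement_congruence χ hp hpN γ
    (fun i => i.elim (γ₂ * ModularGroup.T ^ j₂) fun _ => γ₁)
    (fun i => i.map fun t => (B t : ℤ)) (fun i => i.elim lam₂ fun _ => lam₁) ?_ ?_ hdist
  · rw [Fintype.sum_option] at key
    simp only [Option.elim, Option.map_none, Option.map_some] at key
    rw [ratTriangular_one_one, ← mul_assoc, ← ratSL_mul, Finset.smul_sum]
    exact key
  · rintro (_ | t)
    · simp only [Option.elim, Option.map_none]
      rw [hT, hcol]
      exact c2.1
    · simp only [Option.elim, Option.map_some, heckeRep]
      rw [hcol]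
      exact (c1 t).1
  · rintro (_ | t)
    · simp only [Option.elim, Option.map_none]
      rw [hT, hcol]
      exact c2.2
    · simp only [Option.elim, Option.map_some, heckeRep]
      rw [hcol]
      exact (c1 t).2

/-! ### The slash operator as a right action -/

/-- The slash operator through the action of `GL(2, ℝ)` on the upper half plane. -/
theorem slash_coe {g : GL (Fin 2) ℝ} (hg : 0 < g.det.val) (k : ℤ) (f : UpperHalfPlane → ℂ)
    (z : UpperHalfPlane) : slash k (g : Matrix (Fin 2) (Fin 2) ℝ) f z =
      (UpperHalfPlane.denom g z / (‖UpperHalfPlane.denom g z‖ : ℝ)) ^ (-k) * f (g • z) := by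
  have h : UpperHalfPlane.ofComplex (UpperHalfPlane.num g z / UpperHalfPlane.denom g z) =
      g • z := by
    rw [← UpperHalfPlane.coe_smul_of_det_pos hg, UpperHalfPlane.ofComplex_apply]
  rw [← h]
  rfl

theorem slash_coe_mul {g h : GL (Fin 2) ℝ} (hg : 0 < g.det.val) (hh : 0 < h.det.val) (k : ℤ)
    (f : UpperHalfPlane → ℂ) :
    slash k ((g * h : GL (Fin 2) ℝ) : Matrix (Fin 2) (Fin 2) ℝ) f =
      slash k (h : Matrix (Fin 2) (Fin 2) ℝ) (slash k (g : Matrix (Fin 2) (Fin 2) ℝ) f) := by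
  have hgh : 0 < (g * h).det.val := by
    rw [map_mul, Units.val_mul]
    exact mul_pos hg hh
  funext z
  rw [slash_coe hgh, slash_coe hh, slash_coe hg, mul_smul, UpperHalfPlane.denom_cocycle_σ,
    UpperHalfPlane.σ, if_pos hh, ContinuousAlgEquiv.refl_apply, norm_mul, Complex.ofReal_mul,
    mul_div_mul_comm, mul_zpow]
  ring

theorem slash_mul {A B : Matrix (Fin 2) (Fin 2) ℝ} (hA : 0 < A.det) (hB : 0 < B.det) (k : ℤ)
    (f : UpperHalfPlane → ℂ) : slash k (A * B) f = slash k B (slash k A f) :=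
  slash_coe_mul (g := Matrix.GeneralLinearGroup.mkOfDetNeZero A hA.ne')
    (h := Matrix.GeneralLinearGroup.mkOfDetNeZero B hB.ne') hA hB k f

theorem slash_add (k : ℤ) (A : Matrix (Fin 2) (Fin 2) ℝ) (f g : UpperHalfPlane → ℂ) :
    slash k A (f + g) = slash k A f + slash k A g := by
  funext z
  simp [slash, mul_add]

theorem slash_smul (k : ℤ) (A : Matrix (Fin 2) (Fin 2) ℝ) (c : ℂ) (f : UpperHalfPlane → ℂ) :
    slash k A (c • f) = c • slash k A f := by
  funext z
  simp [slash]
  ring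

theorem slash_zero (k : ℤ) (A : Matrix (Fin 2) (Fin 2) ℝ) : slash k A 0 = 0 := by
  funext z
  simp [slash]

theorem slash_triangular {a d : ℝ} (hd : 0 < d) (b : ℝ) (k : ℤ) (f : UpperHalfPlane → ℂ)
    (z : UpperHalfPlane) :
    slash k !![a, b; 0, d] f z = f (UpperHalfPlane.ofComplex ((a * z + b) / d)) := by
  have hd' : (d : ℂ) ≠ 0 := by exact_mod_cast hd.ne'
  simp [slash, abs_of_pos hd, div_self hd']

/-- A rational matrix of positive determinant as a real matrix. -/
def realOfRat (g : GL(2, ℚ)⁺) : Matrix (Fin 2) (Fin 2) ℝ :=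
  ((g : GL (Fin 2) ℚ) : Matrix (Fin 2) (Fin 2) ℚ).map (Rat.castHom ℝ)

theorem det_realOfRat_pos (g : GL(2, ℚ)⁺) : 0 < (realOfRat g).det := by
  have h : (realOfRat g).det =
      (Rat.castHom ℝ) ((g : GL (Fin 2) ℚ) : Matrix (Fin 2) (Fin 2) ℚ).det :=
    ((Rat.castHom ℝ).map_det _).symm
  rw [h]
  have h2 : 0 < ((g : GL (Fin 2) ℚ) : Matrix (Fin 2) (Fin 2) ℚ).det := g.2
  simpa using h2

theorem realOfRat_mul (g h : GL(2, ℚ)⁺) : realOfRat (g * h) = realOfRat g * realOfRat h := by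
  simp only [realOfRat, Subgroup.coe_mul, Units.val_mul, Matrix.map_mul]

theorem realOfRat_ratSL (γ : SL(2, ℤ)) : realOfRat (ratSL γ) = realMatrix γ := by
  ext i j
  simp [realOfRat, coe_ratSL, realMatrix]

theorem realOfRat_ratTriangular (a d : ℕ+) (b : ℤ) :
    realOfRat (ratTriangular a d b) = !![((a : ℕ) : ℝ), (b : ℝ); 0, ((d : ℕ) : ℝ)] := by
  ext i j
  fin_cases i <;> fin_cases j <;> simp [realOfRat, coe_ratTriangular]

theorem det_realMatrix (γ : SL(2, ℤ)) : (realMatrix γ).det = 1 := by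
  have h : (realMatrix γ).det = (Int.castRingHom ℝ) (γ : Matrix (Fin 2) (Fin 2) ℤ).det :=
    ((Int.castRingHom ℝ).map_det _).symm
  rw [h, γ.2, map_one]

theorem realMatrix_mul (γ γ' : SL(2, ℤ)) : realMatrix (γ * γ') = realMatrix γ * realMatrix γ' := by
  simp only [realMatrix, Matrix.SpecialLinearGroup.coe_mul]
  exact Matrix.map_mul (f := Int.castRingHom ℝ)

theorem slash_realMatrix_mul (k : ℤ) (γ γ' : SL(2, ℤ)) (f : UpperHalfPlane → ℂ) :
    slash k (realMatrix (γ * γ')) f = slash k (realMatrix γ') (slash k (realMatrix γ) f) := by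
  rw [realMatrix_mul, slash_mul] <;> rw [det_realMatrix] <;> exact one_pos

/-- The linear extension `x ↦ f |ₖ x` of the slash operator to the group ring. -/
def slashRing (k : ℤ) (f : UpperHalfPlane → ℂ) : RatGroupRing →ₗ[ℂ] (UpperHalfPlane → ℂ) :=
  Finsupp.linearCombination ℂ (fun g : GL(2, ℚ)⁺ => slash k (realOfRat g) f) ∘ₗ
    (MonoidAlgebra.coeffLinearEquiv ℂ).toLinearMap

theorem slashRing_ringOf (k : ℤ) (f : UpperHalfPlane → ℂ) (g : GL(2, ℚ)⁺) :
    slashRing k f (ringOf g) = slash k (realOfRat g) f := by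
  simp [slashRing, ringOf]

theorem single_eq_smul_ringOf (g : GL(2, ℚ)⁺) (c : ℂ) :
    (MonoidAlgebra.single g c : RatGroupRing) = c • ringOf g := by
  simp [ringOf]

theorem slashRing_mul_ringOf (k : ℤ) (f : UpperHalfPlane → ℂ) (x : RatGroupRing) (g : GL(2, ℚ)⁺) :
    slashRing k f (x * ringOf g) = slash k (realOfRat g) (slashRing k f x) := by
  induction x using MonoidAlgebra.induction_linear with
  | zero => simp [slash_zero]
  | add x y hx hy => rw [add_mul, map_add, map_add, hx, hy, slash_add]
  | single h c =>
    rw [single_eq_smul_ringOf, smul_mul_assoc, ← ringOf_mul, map_smul, map_smul, slashRing_ringOf,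
      slashRing_ringOf, slash_smul, realOfRat_mul,
      slash_mul (det_realOfRat_pos h) (det_realOfRat_pos g)]

/-- The automorphy ideal annihilates automorphic functions. -/
theorem slashRing_eq_zero {N : ℕ} {χ : DirichletCharacter ℂ N} {k : ℤ} {f : UpperHalfPlane → ℂ}
    (hf : ∀ γ ∈ CongruenceSubgroup.Gamma0 N, ∀ z,
      slash k (realMatrix γ) f z = charTilde χ γ * f z)
    {x : RatGroupRing} (hx : x ∈ automorphyIdeal χ) : slashRing k f x = 0 := by
  induction hx using Submodule.span_induction with
  | mem x hx =>
    obtain ⟨γ, hγ, rfl⟩ := hx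
    have h1 : (1 : RatGroupRing) = ringOf (ratSL 1) := by
      simp [ringOf, ratSL, MonoidAlgebra.one_def]
    have hf1 : slash k (realMatrix 1) f = f := by
      funext z
      rw [hf 1 (one_mem _) z]
      simp [charTilde]
    funext z
    rw [h1, map_sub, map_smul, slashRing_ringOf, slashRing_ringOf, realOfRat_ratSL,
      realOfRat_ratSL, hf1]
    simp [hf γ hγ z]
  | zero => simp
  | add x y _ _ hx hy => rw [map_add, hx, hy, add_zero]
  | smul r x _ hx =>
    rw [← MulOpposite.op_unop r, op_smul_eq_mul]
    generalize MulOpposite.unop r = y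
    induction y using MonoidAlgebra.induction_linear with
    | zero => simp
    | add y z hy hz => rw [mul_add, map_add, hy, hz, add_zero]
    | single h c =>
      rw [single_eq_smul_ringOf, mul_smul_comm, map_smul, slashRing_mul_ringOf, hx, slash_zero,
        smul_zero]

theorem slashRing_heckeElement {N : ℕ} (χ : DirichletCharacter ℂ N) {p : ℕ+}
    (hp : (p : ℕ).Prime) (k : ℤ) (f : UpperHalfPlane → ℂ) (z : UpperHalfPlane) :
    slashRing k f (heckeElement χ p) z = (√((p : ℕ) : ℝ) : ℂ) * hecke k χ p f z := by
  have hsq : (√((p : ℕ) : ℝ) : ℂ) ≠ 0 := by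
    simp
  rw [hecke, ← mul_assoc, mul_one_div_cancel hsq, one_mul,
    Nat.sum_divisorsAntidiagonal (f := fun a d => χ ((a : ℕ) : ZMod N) *
      ∑ b ∈ Finset.range d, slash k !![(a : ℝ), (b : ℝ); 0, (d : ℝ)] f z),
    Nat.Prime.sum_divisors hp, heckeElement, map_add, map_smul, map_sum]
  simp only [slashRing_ringOf, realOfRat_ratTriangular, Pi.add_apply, Pi.smul_apply, smul_eq_mul,
    Finset.sum_apply]
  simp [Nat.div_self hp.pos]

/-! ### The relation between the functions at the three cusps -/

/-- The relation between `f |ₖ γ_𝔞`, `f |ₖ γ_𝔞'` and `f |ₖ γ_𝔞''` for an automorphic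
eigenfunction `f` of the Hecke operator. -/
theorem hecke_functional_relation {N : ℕ} (hN : 0 < N) {χ : DirichletCharacter ℂ N} {k : ℤ}
    {f : UpperHalfPlane → ℂ} (hf : ∀ γ ∈ CongruenceSubgroup.Gamma0 N, ∀ z,
      slash k (realMatrix γ) f z = charTilde χ γ * f z) {p : ℕ+}
    (hp : (p : ℕ).Prime) (hpN : ¬ (p : ℕ) ∣ N)
    {lam : ℂ} (hT : ∀ z, hecke k χ p f z = lam * f z)
    {γ γ₁ γ₂ : SL(2, ℤ)} {s s₁ s₂ : ℕ → LocalCusp}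
    (hs : ∀ q ∈ N.primeFactors, IsLocalCusp N q γ (s q))
    (hs₁ : ∀ q ∈ N.primeFactors, IsLocalCusp N q γ₁ (s₁ q))
    (hs₂ : ∀ q ∈ N.primeFactors, IsLocalCusp N q γ₂ (s₂ q)) {lam₁ j₁ lam₂ j₂ : ℤ}
    (h₁ : GlobalData (LocalDataOne p) N s s₁ lam₁ j₁)
    (h₂ : GlobalData (LocalDataTwo p) N s s₂ lam₂ j₂) (z : UpperHalfPlane) :
    (√((p : ℕ) : ℝ) : ℂ) * lam * slash k (realMatrix γ) f z =
      χ (lam₂ : ZMod N) * slash k (realMatrix γ₂) f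
        (UpperHalfPlane.ofComplex ((p : ℕ) * z + j₂)) +
      χ (lam₁ : ZMod N) * ∑ t : Fin p, slash k (realMatrix γ₁) f (UpperHalfPlane.ofComplex
        ((z + (((((p : ℕ) * j₁ : ℤ) % auxLevel N s).toNat + auxLevel N s * t : ℕ) : ℂ)) /
          (p : ℕ))) := by
  have hp0 : (0 : ℝ) < (p : ℕ) := by exact_mod_cast p.pos
  have h := slashRing_eq_zero hf (heckeElement_mul_cusp_congruence hN χ hp hpN hs hs₁ hs₂ h₁ h₂)
  rw [sum_filter_modEq (auxLevel_pos hN s), map_sub, sub_eq_zero, slashRing_mul_ringOf,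
    realOfRat_ratSL, map_add, map_smul, map_smul, map_sum] at h
  have hh : slashRing k f (heckeElement χ p) = ((√((p : ℕ) : ℝ) : ℂ) * lam) • f := by
    funext z
    rw [slashRing_heckeElement χ hp, hT]
    simp [mul_assoc]
  have hprod : realOfRat (ratTriangular 1 1 j₂ * ratTriangular p 1 0) =
      !![((p : ℕ) : ℝ), (j₂ : ℝ); 0, 1] := by
    rw [realOfRat_mul, realOfRat_ratTriangular, realOfRat_ratTriangular]
    ext i j
    fin_cases i <;> fin_cases j <;> simp
  have hsl : ∀ (γ : SL(2, ℤ)) (g : GL(2, ℚ)⁺), slash k (realMatrix γ * realOfRat g) f =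
      slash k (realOfRat g) (slash k (realMatrix γ) f) := fun γ g =>
    slash_mul (by rw [det_realMatrix]; exact one_pos) (det_realOfRat_pos g) k f
  rw [hh, slash_smul] at h
  have hz := congrFun h z
  simp only [slashRing_ringOf, realOfRat_mul (ratSL _), realOfRat_ratSL, hsl, Pi.add_apply,
    Pi.smul_apply, smul_eq_mul, Finset.sum_apply] at hz
  rw [hz, hprod, slash_triangular one_pos]
  congr 2
  · simp
  · refine Finset.sum_congr rfl fun t _ => ?_
    rw [realOfRat_ratTriangular, slash_triangular hp0]
    simp only [PNat.one_coe, Nat.cast_one, Complex.ofReal_one, one_mul, Int.cast_natCast,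
      Complex.ofReal_natCast]

/-! ### Widths and parameters of cusps -/

theorem mul_T_pow_mul_inv_apply (γ : SL(2, ℤ)) (m : ℕ) :
    (γ * ModularGroup.T ^ m * γ⁻¹) 1 0 = -(m * γ 1 0 ^ 2) ∧
    (γ * ModularGroup.T ^ m * γ⁻¹) 1 1 = 1 + m * γ 0 0 * γ 1 0 := by
  have hd := det_eq_one γ
  rw [← zpow_natCast, Matrix.SpecialLinearGroup.coe_mul, Matrix.SpecialLinearGroup.coe_mul,
    ModularGroup.coe_T_zpow, Matrix.SpecialLinearGroup.coe_inv, Matrix.adjugate_fin_two]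
  simp only [Matrix.mul_apply, Fin.sum_univ_two, Matrix.of_apply, Matrix.cons_val_zero,
    Matrix.cons_val_one, Matrix.cons_val', Matrix.cons_val_fin_one]
  constructor
  · ring
  · linear_combination hd

theorem mul_T_pow_mul_inv_mem_iff {N : ℕ} {γ : SL(2, ℤ)} {m : ℕ} :
    γ * ModularGroup.T ^ m * γ⁻¹ ∈ CongruenceSubgroup.Gamma0 N ↔
      (N : ℤ) ∣ m * γ 1 0 ^ 2 := by
  rw [CongruenceSubgroup.Gamma0_mem, (mul_T_pow_mul_inv_apply γ m).1,
    ZMod.intCast_zmod_eq_zero_iff_dvd, dvd_neg]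

theorem cuspWidth_spec {N : ℕ} (hN : 0 < N) (γ : SL(2, ℤ)) :
    0 < cuspWidth N γ ∧ (N : ℤ) ∣ cuspWidth N γ * γ 1 0 ^ 2 := by
  have h : cuspWidth N γ ∈
      {m : ℕ | 0 < m ∧ γ * ModularGroup.T ^ m * γ⁻¹ ∈ CongruenceSubgroup.Gamma0 N} :=
    Nat.sInf_mem ⟨N, hN, mul_T_pow_mul_inv_mem_iff.2 (dvd_mul_right _ _)⟩
  exact ⟨h.1, mul_T_pow_mul_inv_mem_iff.1 h.2⟩

theorem cuspWidth_dvd {N : ℕ} (hN : 0 < N) {γ : SL(2, ℤ)} {n : ℕ}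
    (h : (N : ℤ) ∣ n * γ 1 0 ^ 2) : cuspWidth N γ ∣ n := by
  obtain ⟨hpos, hm⟩ := cuspWidth_spec hN γ
  by_contra hn
  have hr : 0 < n % cuspWidth N γ := Nat.pos_of_ne_zero fun h0 => hn (Nat.dvd_of_mod_eq_zero h0)
  have hmem : (N : ℤ) ∣ (n % cuspWidth N γ : ℕ) * γ 1 0 ^ 2 := by
    have e : ((n % cuspWidth N γ : ℕ) : ℤ) * γ 1 0 ^ 2 =
        n * γ 1 0 ^ 2 - (n / cuspWidth N γ : ℕ) * (cuspWidth N γ * γ 1 0 ^ 2) := by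
      have := Nat.mod_add_div n (cuspWidth N γ)
      have h' : ((n % cuspWidth N γ : ℕ) : ℤ) + cuspWidth N γ * (n / cuspWidth N γ : ℕ) = n := by
        exact_mod_cast this
      linear_combination (γ 1 0 ^ 2) * h'
    rw [e]
    exact dvd_sub h (hm.mul_left _)
  have hle : cuspWidth N γ ≤ n % cuspWidth N γ :=
    Nat.sInf_le ⟨hr, mul_T_pow_mul_inv_mem_iff.2 hmem⟩
  exact absurd (Nat.mod_lt n hpos) (not_lt.2 hle)

theorem dvd_iff_of_isCuspMul {N : ℕ} {p b : ℤ} (hb : p * b ≡ 1 [ZMOD N]) {γ γ' : SL(2, ℤ)}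
    (h : IsCuspMul N p γ γ') (m : ℤ) : (N : ℤ) ∣ m * γ 1 0 ^ 2 ↔ (N : ℤ) ∣ m * γ' 1 0 ^ 2 := by
  obtain ⟨u, v, j, h0, h1, -⟩ := isCuspMul_iff.1 h
  simp only [← ZMod.intCast_eq_intCast_iff, ← ZMod.intCast_zmod_eq_zero_iff_dvd] at *
  push_cast at *
  constructor <;> intro hm
  · have e : (γ' 1 0 : ZMod N) = v * p * γ 1 0 := by
      linear_combination -γ' 1 0 * h0 - v * h1
    rw [e]
    linear_combination (v * p) ^ 2 * hm
  · have e : (γ 1 0 : ZMod N) = b * u * γ' 1 0 := by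
      linear_combination -γ 1 0 * hb + b * h1
    rw [e]
    linear_combination (b * u) ^ 2 * hm

theorem cuspWidth_eq_of_isCuspMul {N : ℕ} {p b : ℤ} (hb : p * b ≡ 1 [ZMOD N]) {γ γ' : SL(2, ℤ)}
    (h : IsCuspMul N p γ γ') : cuspWidth N γ' = cuspWidth N γ := by
  simp only [cuspWidth, mul_T_pow_mul_inv_mem_iff, dvd_iff_of_isCuspMul hb h]

theorem charTilde_cuspGenerator {N : ℕ} (χ : DirichletCharacter ℂ N) (γ : SL(2, ℤ)) :
    charTilde χ (cuspGenerator N γ) =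
      χ (1 + cuspWidth N γ * (γ 0 0 : ℤ) * (γ 1 0 : ℤ)) := by
  rw [charTilde, cuspGenerator, (mul_T_pow_mul_inv_apply γ _).2]
  push_cast
  rfl

theorem one_add_pow_of_sq_eq_zero {R : Type*} [CommRing R] {x : R} (hx : x * x = 0) (n : ℕ) :
    (1 + x) ^ n = 1 + n * x := by
  induction n with
  | zero => simp
  | succ n ih =>
    rw [pow_succ, ih]
    push_cast
    linear_combination (n : R) * hx

theorem charTilde_cuspGenerator_pow {N : ℕ} (hN : 0 < N) (χ : DirichletCharacter ℂ N) (γ : SL(2, ℤ))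
    (n : ℕ) : charTilde χ (cuspGenerator N γ) ^ n =
      χ (1 + n * (cuspWidth N γ * (γ 0 0 : ℤ) * (γ 1 0 : ℤ))) := by
  rw [charTilde_cuspGenerator, ← map_pow, one_add_pow_of_sq_eq_zero]
  have h := (ZMod.intCast_zmod_eq_zero_iff_dvd _ _).2 (cuspWidth_spec hN γ).2
  push_cast at h
  linear_combination (cuspWidth N γ : ZMod N) * (γ 0 0 : ZMod N) ^ 2 * h

/-- The character values at the generators of the stabilizers of `𝔞` and `p · 𝔞`: the second is
the `p`-th power of the first. -/
theorem charTilde_cuspGenerator_of_isCuspMul {N : ℕ} (hN : 0 < N) (χ : DirichletCharacter ℂ N)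
    {p : ℕ} {b : ℤ} (hb : p * b ≡ 1 [ZMOD N]) {γ γ' : SL(2, ℤ)} (h : IsCuspMul N p γ γ') :
    charTilde χ (cuspGenerator N γ') = charTilde χ (cuspGenerator N γ) ^ p := by
  rw [charTilde_cuspGenerator_pow hN, charTilde_cuspGenerator, cuspWidth_eq_of_isCuspMul hb h]
  congr 2
  obtain ⟨u, v, j, h0, h1, h2⟩ := isCuspMul_iff.1 h
  have hm' := (cuspWidth_spec hN γ).2
  have hm := (dvd_iff_of_isCuspMul hb h _).1 hm'
  have hd := det_eq_one γ
  have hd' := det_eq_one γ'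
  simp only [← ZMod.intCast_eq_intCast_iff, ← ZMod.intCast_zmod_eq_zero_iff_dvd] at *
  push_cast at *
  have hd := congrArg (Int.cast : ℤ → ZMod N) hd
  have hd' := congrArg (Int.cast : ℤ → ZMod N) hd'
  push_cast at hd hd'
  generalize (cuspWidth N γ : ZMod N) = m at *
  generalize (γ 0 0 : ZMod N) = a at *
  generalize (γ 0 1 : ZMod N) = a₂ at *
  generalize (γ 1 0 : ZMod N) = c at *
  generalize (γ 1 1 : ZMod N) = d at *
  generalize (γ' 0 0 : ZMod N) = a' at *
  generalize (γ' 0 1 : ZMod N) = a₂' at *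
  generalize (γ' 1 0 : ZMod N) = c' at *
  generalize (γ' 1 1 : ZMod N) = d' at *
  -- both sides are determined by their products with the unimodular row `(c, d)`
  have e1 : m * a' * c' * c = 0 := by
    linear_combination -m * a' * c' * c * hb + m * a' * c' * b * h1 + a' * b * u * hm
  have e2 : m * a' * c' * d = p * m * c := by
    linear_combination m * a' * c' * h2 + (u * m * c') * hd' + (u * a₂' + u * j * a') * hm - m * h1
  linear_combination -m * a' * c' * hd + a * e2 - a₂ * e1

theorem expTwoPiI_cuspParam {N : ℕ} (hN : 0 < N) (χ : DirichletCharacter ℂ N) (γ : SL(2, ℤ)) :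
    expTwoPiI (cuspParam χ γ) = charTilde χ (cuspGenerator N γ) := by
  set w := charTilde χ (cuspGenerator N γ) with hw
  have hnorm : ‖w‖ = 1 := by
    have hmem : cuspGenerator N γ ∈ CongruenceSubgroup.Gamma0 N :=
      mul_T_pow_mul_inv_mem_iff.2 (cuspWidth_spec hN γ).2
    obtain ⟨h, -⟩ := bottom_row_modEq (j := 0) (γ := 1) (g := cuspGenerator N γ) hmem (by simp)
    have h' := (ZMod.intCast_eq_intCast_iff _ _ _).2 h
    push_cast at h'
    exact χ.unit_norm_eq_one ⟨_, _, h', by rw [mul_comm, h']⟩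
  have hpi : (Real.pi : ℂ) ≠ 0 := by exact_mod_cast Real.pi_ne_zero
  have h1 : expTwoPiI (w.arg / (2 * Real.pi)) = w := by
    have h := Complex.norm_mul_exp_arg_mul_I w
    rw [hnorm] at h
    rw [expTwoPiI]
    conv_rhs => rw [← h]
    rw [Complex.ofReal_one, one_mul]
    congr 1
    push_cast
    field_simp
  have h2 : expTwoPiI (⌊w.arg / (2 * Real.pi)⌋ : ℤ) = 1 := by
    rw [expTwoPiI]
    refine (congrArg Complex.exp ?_).trans
      (Complex.exp_int_mul_two_pi_mul_I ⌊w.arg / (2 * Real.pi)⌋)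
    push_cast
    ring
  rw [cuspParam, ← hw]
  have h3 := Int.floor_add_fract (w.arg / (2 * Real.pi))
  have h4 := expTwoPiI_add (⌊w.arg / (2 * Real.pi)⌋ : ℤ) (Int.fract (w.arg / (2 * Real.pi)))
  rw [h3, h1, h2, one_mul] at h4
  exact h4.symm

/-! ### Fourier integrals of twisted periodic functions -/

theorem expTwoPiI_eq_one_iff {x : ℝ} : expTwoPiI x = 1 ↔ ∃ n : ℤ, x = n := by
  rw [expTwoPiI, Complex.exp_eq_one_iff]
  have hpi : 2 * (Real.pi : ℂ) * Complex.I ≠ 0 := Complex.two_pi_I_ne_zero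
  constructor
  · rintro ⟨n, hn⟩
    refine ⟨n, ?_⟩
    have h : (x : ℂ) = (n : ℂ) := mul_left_cancel₀ hpi (by rw [hn]; ring)
    exact_mod_cast h
  · rintro ⟨n, rfl⟩
    exact ⟨n, by push_cast; ring⟩

theorem expTwoPiI_intCast (n : ℤ) : expTwoPiI n = 1 := expTwoPiI_eq_one_iff.2 ⟨n, rfl⟩

theorem expTwoPiI_natCast_mul (n : ℕ) (x : ℝ) : expTwoPiI (n * x) = expTwoPiI x ^ n := by
  rw [expTwoPiI, expTwoPiI, ← Complex.exp_nat_mul]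
  congr 1
  push_cast
  ring

theorem expTwoPiI_neg_mul_self (x : ℝ) : expTwoPiI (-x) * expTwoPiI x = 1 := by
  rw [← expTwoPiI_add, neg_add_cancel]
  exact_mod_cast expTwoPiI_intCast 0

theorem apply_add_natCast {G : ℝ → ℂ} {μ : ℝ} (hG : ∀ x, G (x + 1) = expTwoPiI μ * G x) (n : ℕ)
    (x : ℝ) : G (x + n) = expTwoPiI (n * μ) * G x := by
  rw [expTwoPiI_natCast_mul]
  induction n with
  | zero => simp
  | succ n ih =>
    push_cast
    rw [← add_assoc, hG, ih]
    ring

theorem integral_comp_mul_add_of_frequency {G : ℝ → ℂ} (hc : Continuous G) {μ : ℝ}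
    (hG : ∀ x, G (x + 1) = expTwoPiI μ * G x) {p : ℕ} (hp : 0 < p) (s κ : ℝ) {n : ℤ}
    (hn : κ / p - μ = n) :
    ∫ x in (0 : ℝ)..1, G (p * x + s) * expTwoPiI (-(κ * x)) =
      expTwoPiI (κ * s / p) * ∫ x in (0 : ℝ)..1, G x * expTwoPiI (-(κ / p * x)) := by
  have hp' : (p : ℝ) ≠ 0 := by exact_mod_cast hp.ne'
  set K : ℝ → ℂ := fun u => G u * expTwoPiI (-(κ / p * u)) with hK
  have hKc : Continuous K := by
    refine hc.mul ?_
    have := continuous_expTwoPiI_mul (-(κ / p))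
    simpa [neg_mul] using this
  have hper : Function.Periodic K 1 := by
    intro x
    simp only [hK]
    have e : -(κ / p * (x + 1)) = -(κ / p * x) + ((-n : ℤ) : ℝ) + -μ := by
      push_cast
      rw [← hn]
      ring
    rw [hG, e, expTwoPiI_add, expTwoPiI_add, expTwoPiI_intCast]
    linear_combination G x * expTwoPiI (-(κ / p * x)) * expTwoPiI_neg_mul_self μ
  have h1 : ∀ x : ℝ, G (p * x + s) * expTwoPiI (-(κ * x)) =
      expTwoPiI (κ * s / p) * K (p * x + s) := by
    intro x
    simp only [hK]
    have e : -(κ * x) = κ * s / p + -(κ / p * (p * x + s)) := by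
      field_simp
      ring
    rw [e, expTwoPiI_add]
    ring
  simp_rw [h1]
  rw [intervalIntegral.integral_const_mul, intervalIntegral.integral_comp_mul_add K hp']
  have h2 := hper.intervalIntegral_add_zsmul_eq p s fun a b => hKc.intervalIntegrable a b
  rw [hper.intervalIntegral_add_eq s 0, zero_add] at h2
  have e2 : (p : ℝ) * 1 + s = s + (p : ℤ) • (1 : ℝ) := by simp [add_comm]
  rw [mul_zero, zero_add, e2, h2]
  congr 1
  rw [natCast_zsmul, ← Nat.cast_smul_eq_nsmul ℝ, smul_smul, inv_mul_cancel₀ hp', one_smul]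

theorem integral_comp_mul_add_eq_zero {G : ℝ → ℂ} {μ : ℝ}
    (hG : ∀ x, G (x + 1) = expTwoPiI μ * G x) {p : ℕ} (hp : 0 < p) (s κ : ℝ)
    (hμ : expTwoPiI (p * μ) = expTwoPiI κ) (hn : ¬ ∃ n : ℤ, κ / p - μ = n) :
    ∫ x in (0 : ℝ)..1, G (p * x + s) * expTwoPiI (-(κ * x)) = 0 := by
  have hp' : (p : ℝ) ≠ 0 := by exact_mod_cast hp.ne'
  set H : ℝ → ℂ := fun x => G (p * x + s) * expTwoPiI (-(κ * x)) with hH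
  have hper : Function.Periodic H 1 := by
    intro x
    simp only [hH]
    have e : (p : ℝ) * (x + 1) + s = (p * x + s) + p := by ring
    rw [e, apply_add_natCast hG, hμ, show -(κ * (x + 1)) = -(κ * x) + -κ by ring, expTwoPiI_add]
    linear_combination G (p * x + s) * expTwoPiI (-(κ * x)) * expTwoPiI_neg_mul_self κ
  -- translation by `1 / p` multiplies the integrand by a constant different from `1`
  have hshift : ∀ x, H (x + 1 / p) = expTwoPiI (μ - κ / p) * H x := by
    intro x
    simp only [hH]
    have e : (p : ℝ) * (x + 1 / p) + s = (p * x + s) + 1 := by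
      field_simp
      ring
    rw [e, hG, show -(κ * (x + 1 / p)) = -(κ * x) + -(κ / p) by ring, expTwoPiI_add,
      sub_eq_add_neg, expTwoPiI_add]
    ring
  have h1 : ∫ x in (0 : ℝ)..1, H (x + 1 / p) = ∫ x in (0 : ℝ)..1, H x := by
    rw [intervalIntegral.integral_comp_add_right, zero_add, add_comm (1 : ℝ),
      hper.intervalIntegral_add_eq (1 / p) 0, zero_add]
  simp_rw [hshift] at h1
  rw [intervalIntegral.integral_const_mul] at h1
  have hne : expTwoPiI (μ - κ / p) ≠ 1 := fun h => by
    obtain ⟨n, h'⟩ := expTwoPiI_eq_one_iff.1 h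
    exact hn ⟨-n, by push_cast; rw [← h']; ring⟩
  have h2 : (expTwoPiI (μ - κ / p) - 1) * ∫ x in (0 : ℝ)..1, H x = 0 := by
    rw [sub_mul, h1, one_mul, sub_self]
  exact (mul_eq_zero.1 h2).resolve_left (sub_ne_zero.2 hne)

/-- A sum over `M t`, `0 ≤ t < p`, of a function of period `p`, for `M` prime to `p`. -/
theorem sum_range_comp_mul_of_periodic {K : ℕ → ℂ} {p M : ℕ} (hp : 0 < p) (hM : M.Coprime p)
    (hK : Function.Periodic K p) :
    ∑ t ∈ Finset.range p, K (M * t) = ∑ t ∈ Finset.range p, K t := by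
  have hinj : Set.InjOn (fun t => M * t % p) (Finset.range p : Set ℕ) := by
    intro t ht t' ht' h
    rw [Finset.mem_coe, Finset.mem_range] at ht ht'
    exact Nat.ModEq.eq_of_lt_of_lt (Nat.ModEq.cancel_left_of_coprime hM.symm h) ht ht'
  have himage : (Finset.range p).image (fun t => M * t % p) = Finset.range p := by
    refine Finset.eq_of_subset_of_card_le (fun u hu => ?_) (Finset.card_image_of_injOn hinj).ge
    obtain ⟨t, -, rfl⟩ := Finset.mem_image.1 hu
    exact Finset.mem_range.2 (Nat.mod_lt _ hp)
  conv_rhs => rw [← himage, Finset.sum_image hinj]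
  exact Finset.sum_congr rfl fun t _ => (hK.map_mod_nat _).symm

/-- The intervals `[r / m + M t, r / m + M t + 1]`, `0 ≤ t < p`, with `M` prime to `p`, cover a
period of length `p`. -/
theorem sum_integral_comp_add_div {G : ℝ → ℂ} (hc : Continuous G) {μ : ℝ}
    (hG : ∀ x, G (x + 1) = expTwoPiI μ * G x) {p : ℕ} (hp : 0 < p) {M : ℕ} (hM : M.Coprime p)
    (s κ : ℝ) (hμ : expTwoPiI (p * κ) = expTwoPiI μ) (hκ : expTwoPiI (M * κ) = 1) :
    ∑ t ∈ Finset.range p, ∫ x in (0 : ℝ)..1, G ((x + (s + (M * t : ℕ))) / p) *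
        expTwoPiI (-(κ * x)) =
      p * expTwoPiI (κ * s) * ∫ x in (0 : ℝ)..1, G x * expTwoPiI (-(p * κ * x)) := by
  have hp' : (p : ℝ) ≠ 0 := by exact_mod_cast hp.ne'
  set H : ℝ → ℂ := fun x => G (x / p) * expTwoPiI (-(κ * x)) with hH
  have hHc : Continuous H := by
    refine (hc.comp (continuous_id.div_const _)).mul ?_
    have := continuous_expTwoPiI_mul (-κ)
    simpa [neg_mul] using this
  have hper : Function.Periodic H p := by
    intro x
    simp only [hH]
    rw [add_div, div_self hp', hG, show -(κ * (x + p)) = -(κ * x) + -(p * κ) by ring,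
      expTwoPiI_add, ← hμ]
    linear_combination G (x / p) * expTwoPiI (-(κ * x)) * expTwoPiI_neg_mul_self (p * κ)
  have h1 : ∀ t : ℕ, ∫ x in (0 : ℝ)..1, G ((x + (s + (M * t : ℕ))) / p) * expTwoPiI (-(κ * x)) =
      expTwoPiI (κ * s) * ∫ x in (s + (M * t : ℕ))..(s + (M * t : ℕ) + 1), H x := by
    intro t
    have e : ∀ x : ℝ, G ((x + (s + (M * t : ℕ))) / p) * expTwoPiI (-(κ * x)) =
        expTwoPiI (κ * s) * H (x + (s + (M * t : ℕ))) := by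
      intro x
      simp only [hH]
      have e2 : -(κ * x) = κ * s + t * (M * κ) + -(κ * (x + (s + (M * t : ℕ)))) := by
        push_cast
        ring
      rw [e2, expTwoPiI_add, expTwoPiI_add, expTwoPiI_natCast_mul t, hκ, one_pow]
      ring
    simp_rw [e]
    rw [intervalIntegral.integral_const_mul, intervalIntegral.integral_comp_add_right, zero_add,
      add_comm (1 : ℝ)]
  simp_rw [h1]
  rw [← Finset.mul_sum, sum_range_comp_mul_of_periodic
    (K := fun n : ℕ => ∫ x in (s + n)..(s + n + 1), H x) hp hM]
  · have h2 := intervalIntegral.sum_integral_adjacent_intervals (f := H) (μ := volume)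
      (a := fun n : ℕ => s + n) (n := p) fun k _ => hHc.intervalIntegrable _ _
    have h3 : ∑ t ∈ Finset.range p, ∫ x in (s + t)..(s + t + 1), H x =
        ∫ x in (0 : ℝ)..(0 + p), H x := by
      rw [← hper.intervalIntegral_add_eq s 0]
      simp only [Nat.cast_add, Nat.cast_one, Nat.cast_zero, add_zero, ← add_assoc] at h2
      exact h2
    have h4 := intervalIntegral.smul_integral_comp_mul_add (a := 0) (b := 1) H (p : ℝ) 0
    simp only [mul_zero, add_zero, mul_one] at h4
    have h5 : ∫ x in (0 : ℝ)..1, H (p * x) =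
        ∫ x in (0 : ℝ)..1, G x * expTwoPiI (-(p * κ * x)) := by
      refine intervalIntegral.integral_congr fun x _ => ?_
      simp only [hH]
      rw [mul_div_cancel_left₀ _ hp', show κ * ((p : ℝ) * x) = p * κ * x by ring]
    rw [h3, zero_add, ← h4, h5, Complex.real_smul, Complex.ofReal_natCast]
    ring
  · intro n
    simp only
    push_cast
    rw [show s + ((n : ℝ) + p) = s + n + p by ring,
      show s + n + (p : ℝ) + 1 = s + n + 1 + p by ring,
      ← intervalIntegral.integral_comp_add_right]
    exact intervalIntegral.integral_congr fun x _ => hper x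

/-! ### The three-term relation -/

/-- The function `x ↦ (f |ₖ γ)(m (x + iy))`; for `m` the width of the cusp `γ∞` it is
`x ↦ (f |ₖ σ)(x + iy)`. -/
def cuspFunction (k : ℤ) (f : UpperHalfPlane → ℂ) (γ : SL(2, ℤ)) (m : ℕ) (y x : ℝ) : ℂ :=
  slash k (realMatrix γ) f (UpperHalfPlane.ofComplex (m * (x + y * Complex.I)))

theorem im_mul_add_mul_I_pos {m : ℕ} (hm : 0 < m) {y : ℝ} (hy : 0 < y) (x : ℝ) :
    0 < ((m : ℂ) * (x + y * Complex.I)).im := by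
  have : (0 : ℝ) < m := by exact_mod_cast hm
  simp only [Complex.mul_im, Complex.natCast_re, Complex.natCast_im, Complex.add_im,
    Complex.ofReal_im, Complex.ofReal_re, Complex.I_im, Complex.I_re, mul_zero, mul_one, zero_mul,
    add_zero, zero_add]
  positivity

theorem slash_scalingMatrix {N : ℕ} (hN : 0 < N) (k : ℤ) (f : UpperHalfPlane → ℂ) (γ : SL(2, ℤ))
    (z : UpperHalfPlane) : slash k (scalingMatrix N γ) f z =
      slash k (realMatrix γ) f (UpperHalfPlane.ofComplex (cuspWidth N γ * z)) := by
  have hm : (0 : ℝ) < cuspWidth N γ := by exact_mod_cast (cuspWidth_spec hN γ).1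
  have hs : 0 < √(cuspWidth N γ : ℝ) := Real.sqrt_pos.2 hm
  rw [scalingMatrix, slash_mul (by rw [det_realMatrix]; exact one_pos)
    (by rw [Matrix.det_fin_two_of]; simp [hs.ne']), slash_triangular (inv_pos.2 hs)]
  congr 2
  have e : ((√(cuspWidth N γ : ℝ) : ℝ) : ℂ) * (√(cuspWidth N γ : ℝ) : ℝ) = cuspWidth N γ := by
    rw [← Complex.ofReal_mul, Real.mul_self_sqrt hm.le, Complex.ofReal_natCast]
  rw [← e]
  push_cast
  rw [add_zero, div_inv_eq_mul]
  ring

theorem fourierIntegral_eq {N : ℕ} (hN : 0 < N) (k : ℤ) (χ : DirichletCharacter ℂ N)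
    (f : UpperHalfPlane → ℂ) (γ : SL(2, ℤ)) (n : ℤ) {y : ℝ} (hy : 0 < y) :
    fourierIntegral k χ f γ n y = ∫ x in (0 : ℝ)..1,
      cuspFunction k f γ (cuspWidth N γ) y x * expTwoPiI (-(freq χ γ n * x)) := by
  refine intervalIntegral.integral_congr fun x _ => ?_
  have him : 0 < ((x : ℂ) + y * Complex.I).im := by simpa using hy
  simp only [cuspFunction]
  rw [slash_scalingMatrix hN, UpperHalfPlane.ofComplex_apply_of_im_pos him]

theorem cuspFunction_add_one {N : ℕ} (hN : 0 < N) {χ : DirichletCharacter ℂ N} {k : ℤ}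
    {f : UpperHalfPlane → ℂ} (hf : ∀ γ ∈ CongruenceSubgroup.Gamma0 N, ∀ z,
      slash k (realMatrix γ) f z = charTilde χ γ * f z) (γ : SL(2, ℤ)) {y : ℝ} (hy : 0 < y)
    (x : ℝ) : cuspFunction k f γ (cuspWidth N γ) y (x + 1) =
      expTwoPiI (cuspParam χ γ) * cuspFunction k f γ (cuspWidth N γ) y x := by
  obtain ⟨hm, hd⟩ := cuspWidth_spec hN γ
  set m := cuspWidth N γ with hmdef
  have hg : slash k (realMatrix (cuspGenerator N γ)) f =
      charTilde χ (cuspGenerator N γ) • f := by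
    funext z
    exact hf _ (mul_T_pow_mul_inv_mem_iff.2 hd) z
  have hcomm : cuspGenerator N γ * γ = γ * ModularGroup.T ^ m := by
    rw [cuspGenerator, inv_mul_cancel_right]
  have hT : realMatrix (ModularGroup.T ^ m) = !![1, (m : ℝ); 0, 1] := by
    rw [← zpow_natCast, realMatrix, ModularGroup.coe_T_zpow]
    ext i j
    fin_cases i <;> fin_cases j <;> simp
  have h := slash_realMatrix_mul k γ (ModularGroup.T ^ m) f
  rw [← hcomm, slash_realMatrix_mul, hg, slash_smul, hT] at h
  have hz := congrFun h (UpperHalfPlane.ofComplex (m * (x + y * Complex.I)))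
  rw [slash_triangular one_pos, UpperHalfPlane.ofComplex_apply_of_im_pos
    (im_mul_add_mul_I_pos hm hy x)] at hz
  rw [cuspFunction, cuspFunction, expTwoPiI_cuspParam hN, UpperHalfPlane.ofComplex_apply_of_im_pos
    (im_mul_add_mul_I_pos hm hy x)]
  refine Eq.trans ?_ hz.symm
  congr 2
  push_cast
  ring

theorem continuous_cuspFunction (k : ℤ) {f : UpperHalfPlane → ℂ}
    (hf : ContinuousOn (fun w : ℂ => f (UpperHalfPlane.ofComplex w)) {w : ℂ | 0 < w.im})
    (γ : SL(2, ℤ)) {m : ℕ} (hm : 0 < m) {y : ℝ} (hy : 0 < y) :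
    Continuous (cuspFunction k f γ m y) := by
  have hf' : Continuous f := by
    have h := hf.comp_continuous (f := fun z : UpperHalfPlane => (z : ℂ))
      UpperHalfPlane.continuous_coe fun z => z.im_pos
    simpa [Function.comp_def] using h
  have hdet : 0 < (realMatrix γ).det := by
    rw [det_realMatrix]
    exact one_pos
  set g := Matrix.GeneralLinearGroup.mkOfDetNeZero (realMatrix γ) hdet.ne' with hg
  have hline : Continuous fun x : ℝ =>
      UpperHalfPlane.ofComplex ((m : ℂ) * (x + y * Complex.I)) := by
    have e : (fun x : ℝ => UpperHalfPlane.ofComplex ((m : ℂ) * (x + y * Complex.I))) =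
        fun x : ℝ => (⟨(m : ℂ) * (x + y * Complex.I), im_mul_add_mul_I_pos hm hy x⟩ :
          UpperHalfPlane) := by
      funext x
      exact UpperHalfPlane.ofComplex_apply_of_im_pos _
    rw [e, UpperHalfPlane.isEmbedding_coe.continuous_iff]
    change Continuous fun x : ℝ => (m : ℂ) * (x + y * Complex.I)
    fun_prop
  have hslash : Continuous (slash k (realMatrix γ) f) := by
    have e : slash k (realMatrix γ) f = fun z : UpperHalfPlane =>
        (UpperHalfPlane.denom g z / (‖UpperHalfPlane.denom g z‖ : ℝ)) ^ (-k) * f (g • z) := by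
      funext z
      exact slash_coe (g := g) hdet k f z
    rw [e]
    have hden : Continuous fun z : UpperHalfPlane => UpperHalfPlane.denom g z := by
      unfold UpperHalfPlane.denom
      exact (continuous_const.mul UpperHalfPlane.continuous_coe).add continuous_const
    have hne := fun z : UpperHalfPlane => UpperHalfPlane.denom_ne_zero g z
    have hne' : ∀ z : UpperHalfPlane, ((‖UpperHalfPlane.denom g z‖ : ℝ) : ℂ) ≠ 0 := fun z => by
      exact_mod_cast norm_ne_zero_iff.2 (hne z)
    refine Continuous.mul ?_ (hf'.comp (continuous_const_smul g))
    exact (hden.div (Complex.continuous_ofReal.comp hden.norm) hne').zpow₀ _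
      fun z => Or.inl (div_ne_zero (hne z) (hne' z))
  exact hslash.comp hline

theorem sign_mul_of_pos {c : ℝ} (hc : 0 < c) (x : ℝ) : Real.sign (c * x) = Real.sign x := by
  rcases lt_trichotomy x 0 with h | h | h
  · rw [Real.sign_of_neg h, Real.sign_of_neg (mul_neg_of_pos_of_neg hc h)]
  · simp [h]
  · rw [Real.sign_of_pos h, Real.sign_of_pos (mul_pos hc h)]

/-- The height at which the `n`-th Fourier coefficient is read off. -/
def readHeight {N : ℕ} (k : ℤ) (ν : ℂ) (χ : DirichletCharacter ℂ N) (γ : SL(2, ℤ)) (n : ℤ) : ℝ :=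
  whittakerPoint (whittakerIndex k (freq χ γ n)) (ν - 1 / 2) / (4 * Real.pi * |freq χ γ n|)

/-- The value by which the Fourier integral is divided to obtain the `n`-th coefficient. -/
def readValue {N : ℕ} (k : ℤ) (ν : ℂ) (χ : DirichletCharacter ℂ N) (γ : SL(2, ℤ)) (n : ℤ) : ℂ :=
  whittakerW (whittakerIndex k (freq χ γ n)) (ν - 1 / 2)
    (whittakerPoint (whittakerIndex k (freq χ γ n)) (ν - 1 / 2))

theorem fourierCoeff_eq {N : ℕ} (k : ℤ) (ν : ℂ) (χ : DirichletCharacter ℂ N)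
    (f : UpperHalfPlane → ℂ) (γ : SL(2, ℤ)) {n : ℤ} (hn : freq χ γ n ≠ 0) :
    fourierCoeff k ν χ f γ n =
      fourierIntegral k χ f γ n (readHeight k ν χ γ n) / readValue k ν χ γ n := by
  rw [fourierCoeff, if_neg hn]
  rfl

/-- When the frequency is multiplied by `c > 0`, the height is divided by `c`. -/
theorem readHeight_and_readValue_of_freq {N : ℕ} (k : ℤ) (ν : ℂ) (χ : DirichletCharacter ℂ N)
    {γ γ' : SL(2, ℤ)} {n n' : ℤ} {c : ℝ} (hc : 0 < c) (h : freq χ γ' n' = c * freq χ γ n) :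
    readHeight k ν χ γ' n' = readHeight k ν χ γ n / c ∧
      readValue k ν χ γ' n' = readValue k ν χ γ n := by
  have hi : whittakerIndex k (freq χ γ' n') = whittakerIndex k (freq χ γ n) := by
    rw [whittakerIndex, whittakerIndex, h, sign_mul_of_pos hc]
  rw [readHeight, readHeight, readValue, readValue, hi, h, abs_mul, abs_of_pos hc]
  refine ⟨?_, rfl⟩
  rw [div_div]
  congr 1
  ring

/-- The three-term relation between the Fourier integrals at the cusps `𝔞''`, `𝔞` and `𝔞'`, before
the integrals at `𝔞''` and `𝔞'` are evaluated. -/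
theorem fourierIntegral_relation {N : ℕ} (hN : 0 < N) {χ : DirichletCharacter ℂ N} {k : ℤ}
    {f : UpperHalfPlane → ℂ}
    (hc : ContinuousOn (fun w : ℂ => f (UpperHalfPlane.ofComplex w)) {w : ℂ | 0 < w.im})
    (hf : ∀ γ ∈ CongruenceSubgroup.Gamma0 N, ∀ z,
      slash k (realMatrix γ) f z = charTilde χ γ * f z) {p : ℕ+}
    (hp : (p : ℕ).Prime) (hpN : ¬ (p : ℕ) ∣ N)
    {lam : ℂ} (hT : ∀ z, hecke k χ p f z = lam * f z)
    {γ γ₁ γ₂ : SL(2, ℤ)} {s s₁ s₂ : ℕ → LocalCusp}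
    (hs : ∀ q ∈ N.primeFactors, IsLocalCusp N q γ (s q))
    (hs₁ : ∀ q ∈ N.primeFactors, IsLocalCusp N q γ₁ (s₁ q))
    (hs₂ : ∀ q ∈ N.primeFactors, IsLocalCusp N q γ₂ (s₂ q)) {lam₁ j₁ lam₂ j₂ : ℤ}
    (h₁ : GlobalData (LocalDataOne p) N s s₁ lam₁ j₁)
    (h₂ : GlobalData (LocalDataTwo p) N s s₂ lam₂ j₂) {m M : ℕ} (hm : 0 < m)
    (hM : auxLevel N s = m * M) {y : ℝ} (hy : 0 < y) (κ : ℝ) :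
    (√((p : ℕ) : ℝ) : ℂ) * lam *
        ∫ x in (0 : ℝ)..1, cuspFunction k f γ m y x * expTwoPiI (-(κ * x)) =
      χ (lam₂ : ZMod N) * (∫ x in (0 : ℝ)..1, cuspFunction k f γ₂ m ((p : ℕ) * y)
        ((p : ℕ) * x + j₂ / m) * expTwoPiI (-(κ * x))) +
      χ (lam₁ : ZMod N) * ∑ t ∈ Finset.range p, ∫ x in (0 : ℝ)..1,
        cuspFunction k f γ₁ m (y / (p : ℕ)) ((x + ((((p : ℕ) * j₁ : ℤ) % auxLevel N s : ℤ) / m +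
          (M * t : ℕ))) / (p : ℕ)) * expTwoPiI (-(κ * x)) := by
  have hp0 : (0 : ℝ) < (p : ℕ) := by exact_mod_cast p.pos
  have hpc : ((p : ℕ) : ℂ) ≠ 0 := by exact_mod_cast hp0.ne'
  have hmc : (m : ℂ) ≠ 0 := by exact_mod_cast hm.ne'
  have hrel : ∀ x : ℝ, (√((p : ℕ) : ℝ) : ℂ) * lam * cuspFunction k f γ m y x =
      χ (lam₂ : ZMod N) * cuspFunction k f γ₂ m ((p : ℕ) * y) ((p : ℕ) * x + j₂ / m) +
      χ (lam₁ : ZMod N) * ∑ t ∈ Finset.range p,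
        cuspFunction k f γ₁ m (y / (p : ℕ)) ((x + ((((p : ℕ) * j₁ : ℤ) % auxLevel N s : ℤ) / m +
          (M * t : ℕ))) / (p : ℕ)) := by
    intro x
    have h := hecke_functional_relation hN hf hp hpN hT hs hs₁ hs₂ h₁ h₂
      (UpperHalfPlane.ofComplex (m * (x + y * Complex.I)))
    rw [Finset.sum_range]
    simp only [cuspFunction]
    rw [h, UpperHalfPlane.ofComplex_apply_of_im_pos (im_mul_add_mul_I_pos hm hy x)]
    congr 2
    · congr 2
      push_cast
      field_simp
      ring
    · refine Finset.sum_congr rfl fun t _ => ?_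
      congr 2
      have hr : ((((((p : ℕ) * j₁ : ℤ) % auxLevel N s).toNat : ℕ) : ℤ) : ℂ) =
          ((((p : ℕ) * j₁ : ℤ) % auxLevel N s : ℤ) : ℂ) := by
        rw [Int.toNat_of_nonneg (Int.emod_nonneg _ (by exact_mod_cast (auxLevel_pos hN s).ne'))]
      rw [Int.cast_natCast] at hr
      rw [Nat.cast_add, hr, Nat.cast_mul, hM]
      generalize ((p : ℕ) * j₁ : ℤ) % ((m * M : ℕ) : ℤ) = r
      push_cast
      field_simp
      ring
  have hexp : Continuous fun x : ℝ => expTwoPiI (-(κ * x)) := by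
    have := continuous_expTwoPiI_mul (-κ)
    simpa [neg_mul] using this
  have hcont : ∀ (γ : SL(2, ℤ)) {y : ℝ}, 0 < y → Continuous (cuspFunction k f γ m y) :=
    fun γ y hy => continuous_cuspFunction k hc γ hm hy
  have c2 : Continuous fun x : ℝ => cuspFunction k f γ₂ m ((p : ℕ) * y)
      ((p : ℕ) * x + j₂ / m) * expTwoPiI (-(κ * x)) :=
    ((hcont γ₂ (mul_pos hp0 hy)).comp (by fun_prop)).mul hexp
  have c1 : ∀ t : ℕ, Continuous fun x : ℝ => cuspFunction k f γ₁ m (y / (p : ℕ))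
      ((x + ((((p : ℕ) * j₁ : ℤ) % auxLevel N s : ℤ) / m + (M * t : ℕ))) / (p : ℕ)) *
        expTwoPiI (-(κ * x)) := fun t =>
    ((hcont γ₁ (div_pos hy hp0)).comp (by fun_prop)).mul hexp
  rw [← intervalIntegral.integral_finsetSum fun t _ => (c1 t).intervalIntegrable _ _,
    ← intervalIntegral.integral_const_mul, ← intervalIntegral.integral_const_mul,
    ← intervalIntegral.integral_const_mul, ← intervalIntegral.integral_add]
  · refine intervalIntegral.integral_congr fun x _ => ?_
    rw [← mul_assoc, hrel, ← Finset.sum_mul]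
    ring
  · exact (c2.const_mul _).intervalIntegrable _ _
  · exact ((continuous_finsetSum _ fun t _ => c1 t).const_mul _).intervalIntegrable _ _

theorem cuspParam_nonneg {N : ℕ} (χ : DirichletCharacter ℂ N) (γ : SL(2, ℤ)) :
    0 ≤ cuspParam χ γ := Int.fract_nonneg _

theorem cuspParam_lt_one {N : ℕ} (χ : DirichletCharacter ℂ N) (γ : SL(2, ℤ)) :
    cuspParam χ γ < 1 := Int.fract_lt_one _

theorem expTwoPiI_freq {N : ℕ} (χ : DirichletCharacter ℂ N) (γ : SL(2, ℤ)) (n : ℤ) :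
    expTwoPiI (freq χ γ n) = expTwoPiI (cuspParam χ γ) := by
  rw [freq, expTwoPiI_add, expTwoPiI_intCast, one_mul]

/-- The cusp parameters of `𝔞` and `p · 𝔞` satisfy `μ' ≡ p μ` modulo `1`. -/
theorem expTwoPiI_cuspParam_of_isCuspMul {N : ℕ} (hN : 0 < N) (χ : DirichletCharacter ℂ N)
    {p : ℕ} {b : ℤ} (hb : p * b ≡ 1 [ZMOD N]) {γ γ' : SL(2, ℤ)} (h : IsCuspMul N p γ γ') :
    expTwoPiI (p * cuspParam χ γ) = expTwoPiI (cuspParam χ γ') := by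
  rw [expTwoPiI_natCast_mul, expTwoPiI_cuspParam hN, expTwoPiI_cuspParam hN,
    charTilde_cuspGenerator_of_isCuspMul hN χ hb h]

theorem freq_floor_of_isCuspMul {N : ℕ} (hN : 0 < N) (χ : DirichletCharacter ℂ N)
    {p : ℕ} {b : ℤ} (hb : p * b ≡ 1 [ZMOD N]) {γ γ' : SL(2, ℤ)} (h : IsCuspMul N p γ γ') (n : ℤ) :
    freq χ γ' ⌊(p : ℝ) * freq χ γ n⌋ = p * freq χ γ n := by
  have h1 : expTwoPiI (p * freq χ γ n + -cuspParam χ γ') = 1 := by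
    rw [expTwoPiI_add, expTwoPiI_natCast_mul, expTwoPiI_freq, ← expTwoPiI_natCast_mul,
      expTwoPiI_cuspParam_of_isCuspMul hN χ hb h, mul_comm, expTwoPiI_neg_mul_self]
  obtain ⟨l, hl⟩ := expTwoPiI_eq_one_iff.1 h1
  have h2 : ⌊(p : ℝ) * freq χ γ n⌋ = l := by
    rw [Int.floor_eq_iff]
    have := cuspParam_nonneg χ γ'
    have := cuspParam_lt_one χ γ'
    constructor <;> linarith
  rw [h2, freq]
  linarith

/-- Translation by `N'` acts trivially at the cusp, as `N' c ≡ 0` modulo `N`. -/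
theorem expTwoPiI_mul_freq_eq_one {N : ℕ} (hN : 0 < N) (χ : DirichletCharacter ℂ N)
    {γ : SL(2, ℤ)} {s : ℕ → LocalCusp} (hs : ∀ q ∈ N.primeFactors, IsLocalCusp N q γ (s q)) {M : ℕ}
    (hM : auxLevel N s = cuspWidth N γ * M) (n : ℤ) : expTwoPiI (M * freq χ γ n) = 1 := by
  rw [expTwoPiI_natCast_mul, expTwoPiI_freq, expTwoPiI_cuspParam hN,
    charTilde_cuspGenerator_pow hN]
  have h := (ZMod.intCast_zmod_eq_zero_iff_dvd _ _).2 (dvd_auxLevel_mul hN hs)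
  rw [hM] at h
  push_cast at h
  have e : (1 + M * (cuspWidth N γ * (γ 0 0 : ℤ) * (γ 1 0 : ℤ)) : ZMod N) = 1 := by
    linear_combination (γ 0 0 : ZMod N) * h
  rw [e, map_one]

/-- The three-term relation between the Fourier coefficients at `p⁻¹ · 𝔞`, `𝔞` and `p · 𝔞`: the
relation between the functions `f |ₖ γ`, integrated against a character at the height where the
`n`-th coefficient at `𝔞` is read off. The heights `p y` and `y / p` that this gives at the other
two cusps are those where their coefficients are read off. -/
theorem three_term_relation {N : ℕ} (hN : 0 < N) {χ : DirichletCharacter ℂ N} {k : ℤ} {ν : ℂ}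
    {f : UpperHalfPlane → ℂ} (hf : IsMaassForm k ν χ f) {p : ℕ+}
    (hp : (p : ℕ).Prime) (hpN : ¬ (p : ℕ) ∣ N) {b : ℤ} (hb : (p : ℕ) * b ≡ 1 [ZMOD N])
    {lam : ℂ} (hT : ∀ z, hecke k χ p f z = lam * f z)
    {γ γ₁ γ₂ : SL(2, ℤ)} (hγ₁ : IsCuspMul N (p : ℕ) γ γ₁) (hγ₂ : IsCuspMul N (p : ℕ) γ₂ γ)
    {s s₁ s₂ : ℕ → LocalCusp}
    (hs : ∀ q ∈ N.primeFactors, IsLocalCusp N q γ (s q))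
    (hs₁ : ∀ q ∈ N.primeFactors, IsLocalCusp N q γ₁ (s₁ q))
    (hs₂ : ∀ q ∈ N.primeFactors, IsLocalCusp N q γ₂ (s₂ q)) {lam₁ j₁ lam₂ j₂ : ℤ}
    (h₁ : GlobalData (LocalDataOne p) N s s₁ lam₁ j₁)
    (h₂ : GlobalData (LocalDataTwo p) N s s₂ lam₂ j₂) (n : ℤ) :
    χ (lam₂ : ZMod N) / (√((p : ℕ) : ℝ) : ℂ) *
        fourierCoeffReal k ν χ f γ₂ (freq χ γ n / ((p : ℕ) : ℝ) - cuspParam χ γ₂) *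
        expTwoPiI (j₂ * freq χ γ n / (((p : ℕ) : ℝ) * cuspWidth N γ)) -
      lam * fourierCoeff k ν χ f γ n +
      (√((p : ℕ) : ℝ) : ℂ) * χ (lam₁ : ZMod N) *
        expTwoPiI (((p : ℕ) : ℝ) * j₁ * freq χ γ n / cuspWidth N γ) *
        fourierCoeff k ν χ f γ₁ ⌊((p : ℕ) : ℝ) * freq χ γ n⌋ = 0 := by
  have hp0 : (0 : ℝ) < (p : ℕ) := by exact_mod_cast p.pos
  have hfreq₁ := freq_floor_of_isCuspMul hN χ hb hγ₁ n
  have hfreq₂ : ∀ n₂ : ℤ, freq χ γ n / ((p : ℕ) : ℝ) - cuspParam χ γ₂ = n₂ →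
      freq χ γ₂ n₂ = freq χ γ n / ((p : ℕ) : ℝ) := fun n₂ h => by
    rw [freq, ← h]
    ring
  have hreal : ∀ n₂ : ℤ, freq χ γ n / ((p : ℕ) : ℝ) - cuspParam χ γ₂ = n₂ →
      fourierCoeffReal k ν χ f γ₂ (freq χ γ n / ((p : ℕ) : ℝ) - cuspParam χ γ₂) =
        fourierCoeff k ν χ f γ₂ n₂ := fun n₂ h => by
    rw [fourierCoeffReal, h, Int.floor_intCast, if_pos rfl]
  have hreal' : (¬ ∃ n₂ : ℤ, freq χ γ n / ((p : ℕ) : ℝ) - cuspParam χ γ₂ = n₂) →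
      fourierCoeffReal k ν χ f γ₂ (freq χ γ n / ((p : ℕ) : ℝ) - cuspParam χ γ₂) = 0 := fun h => by
    rw [fourierCoeffReal, if_neg fun h' => h ⟨_, h'.symm⟩]
  by_cases hκ : freq χ γ n = 0
  · -- there are no coefficients of frequency zero, so that all terms vanish
    have e1 : fourierCoeff k ν χ f γ₁ ⌊((p : ℕ) : ℝ) * freq χ γ n⌋ = 0 := by
      rw [fourierCoeff, if_pos (by rw [hfreq₁, hκ, mul_zero])]
    have e2 : fourierCoeffReal k ν χ f γ₂ (freq χ γ n / ((p : ℕ) : ℝ) - cuspParam χ γ₂) = 0 := by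
      by_cases h : ∃ n₂ : ℤ, freq χ γ n / ((p : ℕ) : ℝ) - cuspParam χ γ₂ = n₂
      · obtain ⟨n₂, hn₂⟩ := h
        rw [hreal n₂ hn₂, fourierCoeff, if_pos (by rw [hfreq₂ n₂ hn₂, hκ, zero_div])]
      · exact hreal' h
    have e3 : fourierCoeff k ν χ f γ n = 0 := by rw [fourierCoeff, if_pos hκ]
    rw [e1, e2, e3]
    ring
  set κ := freq χ γ n with hκdef
  set y := readHeight k ν χ γ n with hydef
  set V := readValue k ν χ γ n with hVdef
  have hy : 0 < y := by
    rw [hydef, readHeight]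
    have := abs_pos.2 hκ
    exact div_pos (whittakerPoint_pos _ _) (by positivity)
  have hV : V ≠ 0 := whittakerW_point_ne_zero _ _
  obtain ⟨hm, -⟩ := cuspWidth_spec hN γ
  obtain ⟨M, hM⟩ := cuspWidth_dvd hN (γ := γ) (n := auxLevel N s) (by
    rw [sq, ← mul_assoc]
    exact (dvd_auxLevel_mul hN hs).mul_right _)
  have hw₁ : cuspWidth N γ₁ = cuspWidth N γ := cuspWidth_eq_of_isCuspMul hb hγ₁
  have hw₂ : cuspWidth N γ = cuspWidth N γ₂ := cuspWidth_eq_of_isCuspMul hb hγ₂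
  have hMp : M.Coprime p := ((Nat.Prime.coprime_iff_not_dvd hp).2 fun h =>
    hpN (h.trans ((Dvd.intro_left _ hM.symm).trans (auxLevel_dvd hN s)))).symm
  have hMκ := expTwoPiI_mul_freq_eq_one hN χ hs hM n
  rw [← hκdef] at hMκ
  have hcont := hf.smooth.continuousOn
  have hrel := fourierIntegral_relation hN hcont hf.automorphic hp hpN hT hs hs₁ hs₂ h₁ h₂
    hm hM hy κ
  have hG₁ : ∀ x, cuspFunction k f γ₁ (cuspWidth N γ) (y / (p : ℕ)) (x + 1) =
      expTwoPiI (cuspParam χ γ₁) * cuspFunction k f γ₁ (cuspWidth N γ) (y / (p : ℕ)) x := by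
    rw [← hw₁]
    exact cuspFunction_add_one hN hf.automorphic γ₁ (div_pos hy hp0)
  have hG₂ : ∀ x, cuspFunction k f γ₂ (cuspWidth N γ) ((p : ℕ) * y) (x + 1) =
      expTwoPiI (cuspParam χ γ₂) * cuspFunction k f γ₂ (cuspWidth N γ) ((p : ℕ) * y) x := by
    rw [hw₂]
    exact cuspFunction_add_one hN hf.automorphic γ₂ (mul_pos hp0 hy)
  have hpκ : expTwoPiI ((p : ℕ) * κ) = expTwoPiI (cuspParam χ γ₁) := by
    rw [expTwoPiI_natCast_mul, hκdef, expTwoPiI_freq, ← expTwoPiI_natCast_mul,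
      expTwoPiI_cuspParam_of_isCuspMul hN χ hb hγ₁]
  have hκμ : expTwoPiI ((p : ℕ) * cuspParam χ γ₂) = expTwoPiI κ := by
    rw [hκdef, expTwoPiI_freq, expTwoPiI_cuspParam_of_isCuspMul hN χ hb hγ₂]
  -- the integral at the cusp itself
  have hI : ∫ x in (0 : ℝ)..1, cuspFunction k f γ (cuspWidth N γ) y x * expTwoPiI (-(κ * x)) =
      fourierCoeff k ν χ f γ n * V := by
    rw [fourierCoeff_eq k ν χ f γ hκ, div_mul_cancel₀ _ hV, fourierIntegral_eq hN k χ f γ n hy]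
  -- the integrals at `p · 𝔞`
  have hI₁ := sum_integral_comp_add_div
    (continuous_cuspFunction k hcont γ₁ hm (div_pos hy hp0)) hG₁ hp.pos hMp
    ((((p : ℕ) * j₁ : ℤ) % auxLevel N s : ℤ) / cuspWidth N γ) κ hpκ hMκ
  have hphase : expTwoPiI (κ * ((((p : ℕ) * j₁ : ℤ) % auxLevel N s : ℤ) / cuspWidth N γ)) =
      expTwoPiI (((p : ℕ) : ℝ) * j₁ * κ / cuspWidth N γ) := by
    obtain ⟨l, hl⟩ := expTwoPiI_eq_one_iff.1 hMκ
    have hdiv := Int.emod_add_mul_ediv ((p : ℕ) * j₁ : ℤ) (auxLevel N s)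
    generalize ((p : ℕ) * j₁ : ℤ) % auxLevel N s = r at hdiv ⊢
    generalize ((p : ℕ) * j₁ : ℤ) / auxLevel N s = q at hdiv
    have hdiv' : (r : ℝ) + cuspWidth N γ * M * q = (p : ℕ) * j₁ := by
      rw [hM] at hdiv
      exact_mod_cast hdiv
    have hm' : (cuspWidth N γ : ℝ) ≠ 0 := by exact_mod_cast hm.ne'
    have e : ((p : ℕ) : ℝ) * j₁ * κ / cuspWidth N γ =
        κ * (r / cuspWidth N γ) + ((q * l : ℤ) : ℝ) := by
      push_cast
      rw [← hl, ← hdiv']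
      field_simp
    rw [e, expTwoPiI_add, expTwoPiI_intCast, mul_one]
  have hI₁' : ∫ x in (0 : ℝ)..1, cuspFunction k f γ₁ (cuspWidth N γ) (y / (p : ℕ)) x *
      expTwoPiI (-((p : ℕ) * κ * x)) =
        fourierCoeff k ν χ f γ₁ ⌊((p : ℕ) : ℝ) * κ⌋ * V := by
    obtain ⟨e1, e2⟩ := readHeight_and_readValue_of_freq k ν χ hp0 hfreq₁
    rw [fourierCoeff_eq k ν χ f γ₁ (by rw [hfreq₁]; exact mul_ne_zero hp0.ne' hκ), e1, e2,
      div_mul_cancel₀ _ hV, fourierIntegral_eq hN k χ f γ₁ _ (div_pos hy hp0), hfreq₁, hw₁]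
  rw [hI₁', hphase] at hI₁
  -- the integral at `p⁻¹ · 𝔞`
  have hI₂ : ∫ x in (0 : ℝ)..1, cuspFunction k f γ₂ (cuspWidth N γ) ((p : ℕ) * y)
      ((p : ℕ) * x + j₂ / cuspWidth N γ) * expTwoPiI (-(κ * x)) =
        expTwoPiI (j₂ * κ / (((p : ℕ) : ℝ) * cuspWidth N γ)) *
          (fourierCoeffReal k ν χ f γ₂ (κ / ((p : ℕ) : ℝ) - cuspParam χ γ₂) * V) := by
    by_cases h : ∃ n₂ : ℤ, κ / ((p : ℕ) : ℝ) - cuspParam χ γ₂ = n₂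
    · obtain ⟨n₂, hn₂⟩ := h
      have hf₂ := hfreq₂ n₂ hn₂
      obtain ⟨e1, e2⟩ := readHeight_and_readValue_of_freq k ν χ (γ := γ) (γ' := γ₂) (n := n)
        (n' := n₂) (inv_pos.2 hp0) (by rw [hf₂, ← hκdef, div_eq_inv_mul])
      rw [integral_comp_mul_add_of_frequency
        (continuous_cuspFunction k hcont γ₂ hm (mul_pos hp0 hy)) hG₂ hp.pos _ κ hn₂, hreal n₂ hn₂,
        fourierCoeff_eq k ν χ f γ₂ (by rw [hf₂]; exact div_ne_zero hκ hp0.ne'), e1, e2,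
        div_mul_cancel₀ _ hV, ← hydef, div_inv_eq_mul, mul_comm y,
        fourierIntegral_eq hN k χ f γ₂ _ (mul_pos hp0 hy), hf₂, hw₂]
      congr 2
      have hm' : (cuspWidth N γ₂ : ℝ) ≠ 0 := by
        rw [← hw₂]
        exact_mod_cast hm.ne'
      field_simp
    · rw [hreal' h, zero_mul, mul_zero]
      exact integral_comp_mul_add_eq_zero hG₂ hp.pos _ κ hκμ h
  rw [hI, hI₁, hI₂] at hrel
  have hsq : (√((p : ℕ) : ℝ) : ℂ) * (√((p : ℕ) : ℝ) : ℂ) = (p : ℕ) := by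
    rw [← Complex.ofReal_mul, Real.mul_self_sqrt hp0.le, Complex.ofReal_natCast]
  have hsq0 : (√((p : ℕ) : ℝ) : ℂ) ≠ 0 := by
    exact_mod_cast (Real.sqrt_pos.2 hp0).ne'
  rw [← hsq] at hrel
  generalize fourierCoeffReal k ν χ f γ₂ (κ / ((p : ℕ) : ℝ) - cuspParam χ γ₂) = A₂ at hrel ⊢
  generalize fourierCoeff k ν χ f γ₁ ⌊((p : ℕ) : ℝ) * κ⌋ = A₁ at hrel ⊢
  generalize expTwoPiI (j₂ * κ / (((p : ℕ) : ℝ) * cuspWidth N γ)) = E₂ at hrel ⊢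
  generalize expTwoPiI (((p : ℕ) : ℝ) * j₁ * κ / cuspWidth N γ) = E₁ at hrel ⊢
  have hrel' : (√((p : ℕ) : ℝ) : ℂ) * lam * fourierCoeff k ν χ f γ n =
      χ (lam₂ : ZMod N) * (E₂ * A₂) +
      χ (lam₁ : ZMod N) * ((√((p : ℕ) : ℝ) : ℂ) * (√((p : ℕ) : ℝ) : ℂ) * E₁ * A₁) :=
    mul_right_cancel₀ hV (by linear_combination hrel)
  field_simp
  linear_combination -hrel'

end MaassForm
end

theorem mainTheorem6 (N : ℕ) (hN : 0 < N) (k : ℤ) (ν : ℂ) (χ : DirichletCharacter ℂ N)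
    (f : UpperHalfPlane → ℂ) (hf : MaassForm.IsMaassForm k ν χ f)
    (C : Set (Matrix.SpecialLinearGroup (Fin 2) ℤ)) (hC : MaassForm.IsCuspRepresentatives N C)
    (p : ℕ+) (hp : (p : ℕ).Prime) (hpN : ¬ (p : ℕ) ∣ N)
    (lam : ℂ) (hT : ∀ z, MaassForm.hecke k χ p f z = lam * f z)
    (γ : Matrix.SpecialLinearGroup (Fin 2) ℤ) (hγ : γ ∈ C)
    (s : ℕ → MaassForm.LocalCusp)
    (hs : ∀ q ∈ N.primeFactors, MaassForm.IsLocalCusp N q γ (s q)) :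
    ∃ γ₁ ∈ C, ∃ γ₂ ∈ C,
      -- the cusps `𝔞' = p · 𝔞` and `𝔞'' = p⁻¹ · 𝔞`
      (∀ g ∈ C, MaassForm.IsCuspMul N (p : ℕ) γ g ↔ g = γ₁) ∧
      (∀ g ∈ C, MaassForm.IsCuspMul N (p : ℕ) g γ ↔ g = γ₂) ∧
      ∃ s₁ s₂ : ℕ → MaassForm.LocalCusp,
        (∀ q ∈ N.primeFactors, MaassForm.IsLocalCusp N q γ₁ (s₁ q)) ∧
        (∀ q ∈ N.primeFactors, MaassForm.IsLocalCusp N q γ₂ (s₂ q)) ∧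
        -- the systems of congruences for the constants are solvable
        (∃ lam₁ j₁ : ℤ, 0 < lam₁ ∧ lam₁ ≤ N ∧ 0 ≤ j₁ ∧ j₁ < MaassForm.auxLevel N s ∧
          MaassForm.GlobalData (MaassForm.LocalDataOne p) N s s₁ lam₁ j₁) ∧
        (∃ lam₂ j₂ : ℤ, 0 < lam₂ ∧ lam₂ ≤ N ∧ 0 ≤ j₂ ∧ j₂ < MaassForm.auxLevel N s ∧
          MaassForm.GlobalData (MaassForm.LocalDataTwo p) N s s₂ lam₂ j₂) ∧
        ∀ lam₁ j₁ lam₂ j₂ : ℤ,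
          MaassForm.GlobalData (MaassForm.LocalDataOne p) N s s₁ lam₁ j₁ →
          MaassForm.GlobalData (MaassForm.LocalDataTwo p) N s s₂ lam₂ j₂ →
          -- the three-term relation
          (∀ n : ℤ,
            χ (lam₂ : ZMod N) / (√((p : ℕ) : ℝ) : ℂ) *
                MaassForm.fourierCoeffReal k ν χ f γ₂
                  (MaassForm.freq χ γ n / ((p : ℕ) : ℝ) - MaassForm.cuspParam χ γ₂) *
                MaassForm.expTwoPiI
                  (j₂ * MaassForm.freq χ γ n / (((p : ℕ) : ℝ) * MaassForm.cuspWidth N γ)) -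
              lam * MaassForm.fourierCoeff k ν χ f γ n +
              (√((p : ℕ) : ℝ) : ℂ) * χ (lam₁ : ZMod N) *
                MaassForm.expTwoPiI
                  (((p : ℕ) : ℝ) * j₁ * MaassForm.freq χ γ n / MaassForm.cuspWidth N γ) *
                MaassForm.fourierCoeff k ν χ f γ₁ ⌊((p : ℕ) : ℝ) * MaassForm.freq χ γ n⌋ = 0) ∧
          -- the underlying congruence in the group ring of `GL(2, ℚ)⁺`
          MaassForm.heckeElement χ p * MaassForm.ringOf (MaassForm.ratSL γ) -
            (χ (lam₂ : ZMod N) • MaassForm.ringOf (MaassForm.ratSL γ₂ *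
                (MaassForm.ratTriangular 1 1 j₂ * MaassForm.ratTriangular p 1 0)) +
              χ (lam₁ : ZMod N) •
                ∑ b ∈ (Finset.range (MaassForm.auxLevel N s * p)).filter
                  (fun b : ℕ => (b : ℤ) ≡ (p : ℕ) * j₁ [ZMOD MaassForm.auxLevel N s]),
                  MaassForm.ringOf (MaassForm.ratSL γ₁ * MaassForm.ratTriangular 1 p b)) ∈
            MaassForm.automorphyIdeal χ := by
  obtain ⟨b, hb⟩ := MaassForm.exists_mul_modEq_one
    (Nat.isCoprime_iff_coprime.2 ((Nat.Prime.coprime_iff_not_dvd hp).2 hpN))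
  obtain ⟨γ₁, hγ₁, h₁⟩ := MaassForm.exists_isCuspMul_right hC hp hpN γ
  obtain ⟨γ₂, hγ₂, h₂⟩ := MaassForm.exists_isCuspMul_left hC hp hpN hb γ
  have : Nonempty MaassForm.LocalCusp := ⟨.infty⟩
  choose! s₁ hs₁ using hC.2 γ₁ hγ₁
  choose! s₂ hs₂ using hC.2 γ₂ hγ₂
  refine ⟨γ₁, hγ₁, γ₂, hγ₂, fun g hg => ⟨?_, ?_⟩, fun g hg => ⟨?_, ?_⟩, s₁, s₂, hs₁, hs₂,
    ?_, ?_, ?_⟩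
  · exact MaassForm.isCuspMul_unique_right hC hγ₁ hg h₁
  · rintro rfl
    exact h₁
  · exact MaassForm.isCuspMul_unique_left hC hb hγ₂ hg h₂
  · rintro rfl
    exact h₂
  · refine MaassForm.exists_globalData hN fun q hq => MaassForm.exists_localDataOne
      (Nat.prime_of_mem_primeFactors hq) ?_ (hs q hq).1 (hs₁ q hq).1
      (MaassForm.localMul_of_isCuspMul hp hpN h₁ hq (hs q hq) (hs₁ q hq))
    refine Nat.isCoprime_iff_coprime.2
      ((Nat.coprime_primes hp (Nat.prime_of_mem_primeFactors hq)).2 ?_)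
    rintro rfl
    exact hpN (Nat.dvd_of_mem_primeFactors hq)
  · exact MaassForm.exists_globalData hN fun q hq => MaassForm.exists_localDataTwo
      (Nat.prime_of_mem_primeFactors hq) (hs q hq).1 (hs₂ q hq).1
      (MaassForm.localMul_of_isCuspMul hp hpN h₂ hq (hs₂ q hq) (hs q hq))
  · intro lam₁ j₁ lam₂ j₂ hd₁ hd₂
    exact ⟨fun n => MaassForm.three_term_relation hN hf hp hpN hb hT h₁ h₂ hs hs₁ hs₂ hd₁ hd₂ n,
      MaassForm.heckeElement_mul_cusp_congruence hN χ hp hpN hs hs₁ hs₂ hd₁ hd₂⟩
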